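/- Let $\Omega\subset\mathbb R^3$ be a bounded domain (nonempty, open, connected) of class $C^1$ (in particular, any smooth bounded domain), with outward unit normal $n$ and surface measure $\sigma$ on $\partial\Omega$. Let $\gamma>\tfrac32$, $\mu>0$, $\eta\ge 0$, $T>0$, $p(\rho)=\rho^\gamma$ and $$\mathbb S(\nabla u)=\mu\Big(\nabla u+(\nabla u)^T-\tfrac23(\operatorname{div}u)\,\mathrm{Id}\Big)+\eta(\operatorname{div}u)\,\mathrm{Id},\qquad \mathcal E(\rho,u)=\int_\Omega\Big(\tfrac12\rho|u|^2+\frac{\rho^\gamma}{\gamma-1}\Big)dx .$$ **Weak solutions.** Let $\varepsilon>0$, $\beta\ge0$ and let $(\rho_0,u_0)$ be initial data with $\rho_0\ge 0$, $\rho_0\in L^\gamma(\Omega)$, $\rho_0|u_0|^2\in L^1(\Omega)$. A pair $(\rho,u)$ with $\rho\ge 0$ is a *finite energy weak solution on $[0,T]$ of the compressible Navier–Stokes system under Navier slip-with-friction conditions* with scaling factor $\varepsilon$, friction coefficient $\beta$ and initial data $(\rho_0,u_0)$ if: 1. $\rho\in C_w([0,T];L^\gamma(\Omega))$, $\rho u\in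 C_w([0,T];L^{2\gamma/(\gamma+1)}(\Omega))$, $\rho|u|^2\in C_w([0,T];L^1(\Omega))$ (weak continuity in time), and $\nabla u\in L^2((0,T)\times\Omega)$; 2. for every $\phi\in C^\infty([0,T]\times\overline\Omega;\mathbb R)$, $$\int_\Omega\rho(T)\phi(T)\,dx-\int_\Omega\rho_0\,\phi(0)\,dx=\int_0^T\!\!\int_\Omega(\rho\,\partial_t\phi+\rho u\cdot\nabla\phi)\,dx\,dt;$$ 3. for every $\phi\in C^\infty([0,T]\times\overline\Omega;\mathbb R^3)$ with $\phi\cdot n=0$ on $\partial\Omega$, $$\int_\Omega\rho(T)u(T)\cdot\phi(T)\,dx-\int_\Omega\rho_0u_0\cdot\phi(0)\,dx=-\beta\int_0^T\!\!\int_{\partial\Omega}u\cdot\phi\,d\sigma\,dt+\int_0^T\!\!\int_\Omega\big(\rho u\cdot\partial_t\phi+\rho u\otimes u:\nabla\phi+p(\rho)\operatorname{div}\phi-\varepsilon\,\mathbb S(\nabla u):\nabla\phi\big)dx\,dt;$$ 4. for almost every $\tau\in[0,T]$, $$\mathcal E(\rho(\tau),u(\tau))+\varepsilon\int_0^\tau\!\!\int_\Omega\mathbb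 S(\nabla u):\nabla u\,dx\,dt+\beta\int_0^\tau\!\!\int_{\partial\Omega}|u|^2\,d\sigma\,dt\le\mathcal E(\rho_0,u_0).$$ Here the values of $u$ on $\partial\Omega$ are understood in the sense of traces, and $\beta|u|^2$ is integrable on $(0,T)\times\partial\Omega$. **Theorem.** Let $(\rho^E,u^E)\in C^\infty([0,T]\times\overline\Omega)$ be a solution of the compressible Euler system $$\partial_t\rho^E+\operatorname{div}(\rho^Eu^E)=0,\qquad \partial_t(\rho^Eu^E)+\operatorname{div}(\rho^Eu^E\otimes u^E)+\nabla p(\rho^E)=0\quad\text{in }(0,T)\times\Omega,$$ with $u^E\cdot n=0$ on $\partial\Omega$, initial data $\rho^E|_{t=0}=\rho^E_0$, $(\rho^Eu^E)|_{t=0}=\rho^E_0u^E_0$, and $0<\inf_{(0,T)\times\Omega}\rho^E$, $\sup_{(0,T)\times\Omega}\rho^E<\infty$. For every $\varepsilon\in(0,1)$ let $\beta^\varepsilon\ge0$, let $(\rho_0^\varepsilon,u_0^\varepsilon)$ be initial data with $\rho_0^\varepsilon\ge0$, $\rho_0^\varepsilon\in L^\gamma(\Omega)$, $\rho_0^\varepsilon|u_0^\varepsilon|^2\in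 L^1(\Omega)$, and let $(\rho^\varepsilon,u^\varepsilon)$ be a finite energy weak solution on $[0,T]$ with scaling factor $\varepsilon$, friction coefficient $\beta^\varepsilon$ and these initial data. Assume that, as $\varepsilon\to0$, $$\|\rho_0^\varepsilon-\rho_0^E\|_{L^\gamma(\Omega)}+\int_\Omega\rho_0^\varepsilon|u_0^\varepsilon-u_0^E|^2\,dx\to0\qquad\text{and}\qquad\beta^\varepsilon\to0 .$$ Then, as $\varepsilon\to0$, $$\sup_{t\in(0,T)}\Big(\|\rho^\varepsilon(t)-\rho^E(t)\|_{L^\gamma(\Omega)}+\int_\Omega\tfrac12\rho^\varepsilon(t)|u^\varepsilon(t)-u^E(t)|^2\,dx\Big)\to0 .$$ -/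

import Mathlib

open MeasureTheory Filter Topology Set
open scoped ENNReal ContDiff RealInnerProductSpace Gradient

namespace CompressibleNS

noncomputable section

/-- Physical space `ℝ³` with its Euclidean norm. -/
abbrev E3 : Type := EuclideanSpace ℝ (Fin 3)

/-- The `j`-th vector of the canonical basis of `ℝ³`. -/
def e (j : Fin 3) : E3 := EuclideanSpace.single j 1

/-! ### The domain -/

/-- A bounded domain (nonempty, open, connected) of `ℝ³` of class `C¹`: near each of its boundary
points it is the set of points lying strictly below the graph of a `C¹` function over the plane
orthogonal to some unit vector `a`. -/
structure IsBoundedRegularDomain (Ω : Set E3) : Prop where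
  isOpen : IsOpen Ω
  isConnected : IsConnected Ω
  isBounded : Bornology.IsBounded Ω
  boundary : ∀ x ∈ frontier Ω, ∃ r > 0, ∃ a : E3, ‖a‖ = 1 ∧ ∃ ζ : E3 → ℝ, ContDiff ℝ 1 ζ ∧
    ∀ y ∈ Metric.ball x r, (y ∈ Ω ↔ ⟪a, y⟫ < ζ (y - ⟪a, y⟫ • a))

/-- `ν` is the outward unit normal to `Ω` at the boundary point `x`: it is `∇g(x) / |∇g(x)|` for
a `C¹` function `g` such that `Ω = {g < 0}` near `x` and `∇g(x) ≠ 0`. -/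
def IsOutwardUnitNormal (Ω : Set E3) (x ν : E3) : Prop :=
  x ∈ frontier Ω ∧ ∃ r > 0, ∃ g : E3 → ℝ, ContDiff ℝ 1 g ∧
    (∀ y ∈ Metric.ball x r, (y ∈ Ω ↔ g y < 0)) ∧ ∇ g x ≠ 0 ∧ ν = ‖∇ g x‖⁻¹ • ∇ g x

/-- `v · n = 0` on `∂Ω`. -/
def TangentToBoundary (Ω : Set E3) (v : E3 → E3) : Prop :=
  ∀ x ν, IsOutwardUnitNormal Ω x ν → ⟪v x, ν⟫ = 0

/-- Lebesgue measure on `Ω`. -/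
def volOn (Ω : Set E3) : Measure E3 := volume.restrict Ω

/-- Surface measure on `∂Ω`: the two-dimensional Hausdorff measure, normalized so that it agrees
with the area on planes. -/
def surfaceMeasure (Ω : Set E3) : Measure E3 :=
  (Measure.euclideanHausdorffMeasure 2).restrict (frontier Ω)

/-- Lebesgue measure on `(0,T)`. -/
def timeMeasure (T : ℝ) : Measure ℝ := volume.restrict (Ioo 0 T)

/-! ### Differential operators and the viscous stress -/

/-- The Jacobian matrix `(∇u)_{ij} = ∂_j u_i`. -/
def jacobian (v : E3 → E3) (x : E3) : Matrix (Fin 3) (Fin 3) ℝ :=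
  Matrix.of fun i j => fderiv ℝ v x (e j) i

/-- `div v = ∑ i, ∂_i v_i`. -/
def divergence (v : E3 → E3) (x : E3) : ℝ := (jacobian v x).trace

/-- The scalar product `A : B` of two matrices. -/
def contraction (A B : Matrix (Fin 3) (Fin 3) ℝ) : ℝ := ∑ i, ∑ j, A i j * B i j

/-- `S(A) = μ (A + Aᵀ - (2/3) (tr A) Id) + η (tr A) Id`. -/
def viscousStress (μ η : ℝ) (A : Matrix (Fin 3) (Fin 3) ℝ) : Matrix (Fin 3) (Fin 3) ℝ :=
  μ • (A + A.transpose - ((2 / 3 : ℝ) * A.trace) • (1 : Matrix (Fin 3) (Fin 3) ℝ))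
    + (η * A.trace) • (1 : Matrix (Fin 3) (Fin 3) ℝ)

/-- The matrix `v ⊗ v`. -/
def tensorSquare (v : E3) : Matrix (Fin 3) (Fin 3) ℝ := Matrix.of fun i j => v i * v j

/-! ### Function spaces -/

/-- `φ ∈ C^∞([0,T] × Ω̄)`. For bounded `Ω` this is the same as `C^∞_c([0,T] × Ω̄)`. -/
def SmoothUpToBoundary {F : Type*} [NormedAddCommGroup F] [NormedSpace ℝ F]
    (Ω : Set E3) (T : ℝ) (φ : ℝ → E3 → F) : Prop :=
  ContDiffOn ℝ ∞ (fun z : ℝ × E3 => φ z.1 z.2) (Icc 0 T ×ˢ closure Ω)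

/-- `f ∈ C_w([0,T]; L^p(Ω))`, for `1 ≤ p < ∞`: every `f(t)` is in `L^p(Ω)` and
`t ↦ ∫_Ω f(t) · ψ dx` is continuous on `[0,T]` for every `ψ` in the dual space `L^q(Ω)`. -/
def WeaklyContinuousLp {F : Type*} [NormedAddCommGroup F] [InnerProductSpace ℝ F]
    (Ω : Set E3) (T : ℝ) (p : ℝ≥0∞) (f : ℝ → E3 → F) : Prop :=
  (∀ t ∈ Icc 0 T, MemLp (f t) p (volOn Ω)) ∧
  ∀ q : ℝ≥0∞, ENNReal.HolderConjugate p q → ∀ ψ : E3 → F, MemLp ψ q (volOn Ω) →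
    ContinuousOn (fun t => ∫ x, ⟪f t x, ψ x⟫ ∂(volOn Ω)) (Icc 0 T)

/-- `G` is the weak Jacobian matrix of `v` in `Ω`: `G_{ij} = ∂_j v_i` in the sense of
distributions. -/
def HasWeakJacobian (Ω : Set E3) (v : E3 → E3) (G : E3 → Matrix (Fin 3) (Fin 3) ℝ) : Prop :=
  ∀ i j : Fin 3, LocallyIntegrableOn (fun x => v x i) Ω ∧
    LocallyIntegrableOn (fun x => G x i j) Ω ∧
    ∀ φ : E3 → ℝ, ContDiff ℝ ∞ φ → HasCompactSupport φ → tsupport φ ⊆ Ω →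
      ∫ x, v x i * fderiv ℝ φ x (e j) ∂(volOn Ω) = - ∫ x, G x i j * φ x ∂(volOn Ω)

/-- `w` is the trace on `∂Ω` of the vector field `v` with weak Jacobian matrix `G`: there are
fields `v_k ∈ C^∞(Ω̄)` converging to `v` in `H¹(Ω)` whose restrictions to `∂Ω` converge to `w`
in `L²(∂Ω)`. -/
def HasTrace (Ω : Set E3) (v : E3 → E3) (G : E3 → Matrix (Fin 3) (Fin 3) ℝ) (w : E3 → E3) :
    Prop :=
  ∃ V : ℕ → E3 → E3, (∀ k, ContDiffOn ℝ ∞ (V k) (closure Ω)) ∧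
    Tendsto (fun k => eLpNorm (fun x => V k x - v x) 2 (volOn Ω)) atTop (𝓝 0) ∧
    (∀ i j, Tendsto (fun k => eLpNorm (fun x => jacobian (V k) x i j - G x i j) 2 (volOn Ω))
      atTop (𝓝 0)) ∧
    Tendsto (fun k => eLpNorm (fun x => V k x - w x) 2 (surfaceMeasure Ω)) atTop (𝓝 0)

/-! ### Energy and weak solutions of the compressible Navier-Stokes system -/

/-- The energy `∫_Ω (1/2) ρ |u|² + ρ^γ / (γ - 1) dx`. -/
def energy (Ω : Set E3) (γ : ℝ) (ρ : E3 → ℝ) (u : E3 → E3) : ℝ :=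
  ∫ x, ((1 / 2) * ρ x * ‖u x‖ ^ 2 + ρ x ^ γ / (γ - 1)) ∂(volOn Ω)

/-- Initial data with `ρ₀ ≥ 0`, `ρ₀ ∈ L^γ(Ω)`, `ρ₀ |u₀|² ∈ L¹(Ω)`. -/
structure IsAdmissibleInitialData (Ω : Set E3) (γ : ℝ) (ρ₀ : E3 → ℝ) (u₀ : E3 → E3) : Prop where
  nonneg : ∀ᵐ x ∂(volOn Ω), 0 ≤ ρ₀ x
  memLp : MemLp ρ₀ (ENNReal.ofReal γ) (volOn Ω)
  measurable : AEStronglyMeasurable u₀ (volOn Ω)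
  integrable : Integrable (fun x => ρ₀ x * ‖u₀ x‖ ^ 2) (volOn Ω)

/-- `(ρ, u)` is a finite energy weak solution on `[0,T]`, associated to the initial data
`(ρ₀, u₀)`, of the compressible Navier-Stokes system with pressure `ρ^γ`, viscosity coefficients
`μ`, `η` and scaling factor `ε`, under the Navier boundary conditions with friction
coefficient `β`. The field `G` below is the weak Jacobian matrix of `u` and `w` is the trace
of `u` on `∂Ω`; both are determined by `u` up to null sets. -/
structure IsFiniteEnergyWeakSolution (Ω : Set E3) (T γ μ η ε β : ℝ)
    (ρ₀ : E3 → ℝ) (u₀ : E3 → E3) (ρ : ℝ → E3 → ℝ) (u : ℝ → E3 → E3) : Prop where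
  nonneg : ∀ t ∈ Icc 0 T, ∀ᵐ x ∂(volOn Ω), 0 ≤ ρ t x
  measurable_density : AEStronglyMeasurable (fun z : ℝ × E3 => ρ z.1 z.2)
    ((timeMeasure T).prod (volOn Ω))
  measurable_velocity : AEStronglyMeasurable (fun z : ℝ × E3 => u z.1 z.2)
    ((timeMeasure T).prod (volOn Ω))
  density : WeaklyContinuousLp Ω T (ENNReal.ofReal γ) ρ
  momentum : WeaklyContinuousLp Ω T (ENNReal.ofReal (2 * γ / (γ + 1)))
    (fun t x => ρ t x • u t x)
  kinetic : WeaklyContinuousLp Ω T 1 (fun t x => ρ t x * ‖u t x‖ ^ 2)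
  mass_equation : ∀ φ : ℝ → E3 → ℝ, SmoothUpToBoundary Ω T φ →
    (∫ x, ρ T x * φ T x ∂(volOn Ω)) - ∫ x, ρ₀ x * φ 0 x ∂(volOn Ω) =
      ∫ t in (0 : ℝ)..T, ∫ x, (ρ t x * deriv (fun s => φ s x) t
        + ρ t x * ⟪u t x, ∇ (φ t) x⟫) ∂(volOn Ω)
  viscous_part : ∃ (G : ℝ → E3 → Matrix (Fin 3) (Fin 3) ℝ) (w : ℝ → E3 → E3),
    (∀ᵐ t ∂(timeMeasure T), HasWeakJacobian Ω (u t) (G t)) ∧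
    (∀ i j, MemLp (fun z : ℝ × E3 => G z.1 z.2 i j) 2 ((timeMeasure T).prod (volOn Ω))) ∧
    (∀ᵐ t ∂(timeMeasure T), HasTrace Ω (u t) (G t) (w t)) ∧
    AEStronglyMeasurable (fun z : ℝ × E3 => w z.1 z.2)
      ((timeMeasure T).prod (surfaceMeasure Ω)) ∧
    Integrable (fun z : ℝ × E3 => β * ‖w z.1 z.2‖ ^ 2)
      ((timeMeasure T).prod (surfaceMeasure Ω)) ∧
    -- the momentum equation
    (∀ φ : ℝ → E3 → E3, SmoothUpToBoundary Ω T φ →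
      (∀ t ∈ Icc 0 T, TangentToBoundary Ω (φ t)) →
      (∫ x, ⟪ρ T x • u T x, φ T x⟫ ∂(volOn Ω)) - ∫ x, ⟪ρ₀ x • u₀ x, φ 0 x⟫ ∂(volOn Ω) =
        - β * (∫ t in (0 : ℝ)..T, ∫ x, ⟪w t x, φ t x⟫ ∂(surfaceMeasure Ω))
        + ∫ t in (0 : ℝ)..T, ∫ x, (⟪ρ t x • u t x, deriv (fun s => φ s x) t⟫
            + ρ t x * contraction (tensorSquare (u t x)) (jacobian (φ t) x)
            + ρ t x ^ γ * divergence (φ t) x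
            - ε * contraction (viscousStress μ η (G t x)) (jacobian (φ t) x)) ∂(volOn Ω)) ∧
    -- the energy inequality
    ∀ᵐ τ ∂(timeMeasure T),
      energy Ω γ (ρ τ) (u τ)
        + ε * (∫ t in (0 : ℝ)..τ, ∫ x,
            contraction (viscousStress μ η (G t x)) (G t x) ∂(volOn Ω))
        + β * (∫ t in (0 : ℝ)..τ, ∫ x, ‖w t x‖ ^ 2 ∂(surfaceMeasure Ω))
      ≤ energy Ω γ ρ₀ u₀

/-! ### Smooth solutions of the compressible Euler system -/

/-- `(ρE, uE)` is a smooth solution on `[0,T] × Ω̄`, with initial data `(ρE₀, uE₀)`, of the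
compressible Euler system with pressure `ρ^γ`, whose velocity is tangent to the boundary and
whose density is bounded and bounded away from zero. -/
structure IsSmoothEulerSolution (Ω : Set E3) (T γ : ℝ) (ρE₀ : E3 → ℝ) (uE₀ : E3 → E3)
    (ρE : ℝ → E3 → ℝ) (uE : ℝ → E3 → E3) : Prop where
  smooth_density : SmoothUpToBoundary Ω T ρE
  smooth_velocity : SmoothUpToBoundary Ω T uE
  mass_equation : ∀ t ∈ Ioo 0 T, ∀ x ∈ Ω,
    deriv (fun s => ρE s x) t + divergence (fun y => ρE t y • uE t y) x = 0
  momentum_equation : ∀ t ∈ Ioo 0 T, ∀ x ∈ Ω,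
    deriv (fun s => ρE s x • uE s x) t
      + ∑ j, fderiv ℝ (fun y => (ρE t y * uE t y j) • uE t y) x (e j)
      + ∇ (fun y => ρE t y ^ γ) x = 0
  boundary : ∀ t ∈ Icc 0 T, TangentToBoundary Ω (uE t)
  bounds : ∃ a b : ℝ, 0 < a ∧ ∀ t ∈ Ioo 0 T, ∀ x ∈ Ω, a ≤ ρE t x ∧ ρE t x ≤ b
  initial_density : ∀ x ∈ Ω, ρE 0 x = ρE₀ x
  initial_momentum : ∀ x ∈ Ω, ρE 0 x • uE 0 x = ρE₀ x • uE₀ x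

/-! ### Distance between two states -/

/-- `‖ρ - r‖_{L^γ(Ω)} + c ∫_Ω ρ |u - U|² dx`, as an extended nonnegative number. -/
def stateDistance (Ω : Set E3) (γ c : ℝ) (ρ : E3 → ℝ) (u : E3 → E3) (r : E3 → ℝ)
    (U : E3 → E3) : ℝ≥0∞ :=
  eLpNorm (fun x => ρ x - r x) (ENNReal.ofReal γ) (volOn Ω)
    + ∫⁻ x, ENNReal.ofReal (c * (ρ x * ‖u x - U x‖ ^ 2)) ∂(volOn Ω)

end

end CompressibleNS

/-! The proof is the relative energy method. With H(s) = s^γ / (γ - 1), the distance between a weak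
solution (ρ, u) and the Euler solution (r, U) is measured by `relEnergy`, the integral of ½ρ|u - U|²
+ H(ρ|r), where H(ρ|r) is the gap between the convex function H and its tangent at r. Since r H'(r)
- H(r) = r^γ, it equals the energy of (ρ, u), minus ∫ρu·U, plus ∫ρ(½|U|² - H'(r)), plus ∫r^γ. The
first term is governed by the energy inequality, the second by the momentum equation tested with U,
the third by the mass equation tested with ½|U|² - H'(r), the last by the smoothness of r. The slip
condition is decisive: U is tangent to the boundary, hence an admissible test field, and no boundary
layer corrector is needed.

By the Euler equations the inviscid fluxes collapse (`remainder_eq`) to -ρ(u - U)·∇U(u - U) - (γ -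
1) H(ρ|r) div U - div(r^γ U). The first two terms are at most a constant times the relative energy
density, and the divergence integrates to zero by tangency. The viscous and friction cross terms are
absorbed by the dissipation, at a cost O(ε + β). This gives `exists_relEnergy_le`, and Grönwall's
inequality bounds the relative energy by its initial value plus O(ε + β), for almost every time. The
bound passes to every time because the relative energy is lower semicontinuous along weakly
continuous solutions (`relEnergy_le_of_ae`).

Two supporting facts carry the rest. The weak formulation only compares times 0 and T;
`eq_add_integral_of_weak_deriv` turns it into a balance at each time. The boundary is only C¹, and
`integral_divergence_eq_zero_of_tangent` proves the divergence theorem there for tangent fields by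
cutting off near the boundary.

Convergence of the relative energy is then equivalent to convergence of the distance, locally
uniformly in the data: H(ρ|r) ≤ C(|ρ - r|^γ + |ρ - r|), while |ρ - r|^γ ≤ κ + C_κ H(ρ|r) for each κ
> 0. The slack κ is needed when γ < 2, since H(·|r) is quadratic near r; it is fixed before ε tends
to 0. -/

namespace CompressibleNS

noncomputable section

section

/-! ### The viscous stress as a quadratic form -/

/-- The shear part D = A + Aᵀ - (2/3)(tr A) Id is symmetric and, in dimension three, traceless;
hence D : A = ½ D : (A + Aᵀ) = ½ D : D. -/
lemma contraction_viscousStress_self (μ η : ℝ) (A : Matrix (Fin 3) (Fin 3) ℝ) :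
    contraction (viscousStress μ η A) A =
      μ / 2 * (∑ i, ∑ j, (A i j + A j i - if i = j then (2 / 3) * A.trace else 0) ^ 2)
        + η * A.trace ^ 2 := by
  simp [contraction, viscousStress, Fin.sum_univ_three, Matrix.trace, Matrix.one_apply]
  ring

lemma contraction_viscousStress_self_nonneg {μ η : ℝ} (hμ : 0 ≤ μ) (hη : 0 ≤ η)
    (A : Matrix (Fin 3) (Fin 3) ℝ) : 0 ≤ contraction (viscousStress μ η A) A := by
  rw [contraction_viscousStress_self]
  positivity

/-- Young's inequality for a nonnegative symmetric form, read off from its value at A - B/2. The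
coefficient of the first term is exactly 1, so the dissipation of the weak solution absorbs it
entirely. -/
lemma contraction_viscousStress_le {μ η : ℝ} (hμ : 0 ≤ μ) (hη : 0 ≤ η)
    (A B : Matrix (Fin 3) (Fin 3) ℝ) :
    contraction (viscousStress μ η A) B ≤
      contraction (viscousStress μ η A) A + 1 / 4 * contraction (viscousStress μ η B) B := by
  have h := contraction_viscousStress_self_nonneg hμ hη (A - (1 / 2 : ℝ) • B)
  have key : contraction (viscousStress μ η (A - (1 / 2 : ℝ) • B)) (A - (1 / 2 : ℝ) • B) =
      contraction (viscousStress μ η A) A + 1 / 4 * contraction (viscousStress μ η B) B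
        - contraction (viscousStress μ η A) B := by
    simp [contraction, viscousStress, Fin.sum_univ_three, Matrix.trace, Matrix.one_apply]
    ring
  linarith

/-! ### The relative pressure potential -/

/-- `H(ρ | r) = H(ρ) - H'(r) (ρ - r) - H(r)` for `H(s) = s^γ / (γ - 1)`. -/
def relPotential (γ ρ r : ℝ) : ℝ :=
  ρ ^ γ / (γ - 1) - γ / (γ - 1) * r ^ (γ - 1) * (ρ - r) - r ^ γ / (γ - 1)

/-- Homogeneity reduces every estimate on the potential to the base point 1. -/
lemma relPotential_mul {γ r s : ℝ} (hr : 0 < r) (hs : 0 ≤ s) :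
    relPotential γ (r * s) r = r ^ γ * relPotential γ s 1 := by
  have h : r ^ γ = r ^ (γ - 1) * r := by
    rw [← Real.rpow_add_one hr.ne']; simp
  simp only [relPotential, Real.mul_rpow hr.le hs, Real.one_rpow, h]
  ring

lemma relPotential_eq_mul {γ r ρ : ℝ} (hr : 0 < r) (hρ : 0 ≤ ρ) :
    relPotential γ ρ r = r ^ γ * relPotential γ (ρ / r) 1 := by
  rw [← relPotential_mul hr (by positivity), mul_div_cancel₀ _ hr.ne']

/-- Strict Bernoulli inequality: s^γ > 1 + γ(s - 1) for s ≠ 1. -/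
lemma relPotential_one_pos {γ s : ℝ} (hγ : 1 < γ) (hs : 0 ≤ s) (hs1 : s ≠ 1) :
    0 < relPotential γ s 1 := by
  have h := one_add_mul_self_lt_rpow_one_add (s := s - 1) (by linarith) (sub_ne_zero.2 hs1) hγ
  have h1 : 0 < γ - 1 := by linarith
  have : relPotential γ s 1 = (s ^ γ - (1 + γ * (s - 1))) / (γ - 1) := by
    simp [relPotential]; ring
  rw [this]
  rw [add_sub_cancel] at h
  exact div_pos (by linarith) h1

lemma relPotential_self (γ r : ℝ) : relPotential γ r r = 0 := by simp [relPotential]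

lemma relPotential_nonneg {γ ρ r : ℝ} (hγ : 1 < γ) (hρ : 0 ≤ ρ) (hr : 0 < r) :
    0 ≤ relPotential γ ρ r := by
  rw [relPotential_eq_mul hr hρ]
  rcases eq_or_ne (ρ / r) 1 with h | h
  · simp [h, relPotential_self]
  · exact mul_nonneg (by positivity) (relPotential_one_pos hγ (by positivity) h).le

lemma continuous_relPotential_one {γ : ℝ} (hγ : 1 < γ) :
    Continuous fun s => relPotential γ s 1 := by
  have : Continuous fun s : ℝ => s ^ γ := Real.continuous_rpow_const (by linarith)
  unfold relPotential
  fun_prop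

/-- A Taylor inequality for the convex function `s^γ`, at a nonnegative base point. -/
lemma rpow_tangent_le {γ a b : ℝ} (hγ : 1 < γ) (ha : 0 ≤ a) (hb : 0 ≤ b) :
    a ^ γ + γ * a ^ (γ - 1) * (b - a) ≤ b ^ γ := by
  rcases ha.eq_or_lt with rfl | ha
  · rw [Real.zero_rpow (by linarith), Real.zero_rpow (by linarith)]
    simpa using Real.rpow_nonneg hb γ
  · have h := relPotential_nonneg hγ hb ha
    have h1 : 0 < γ - 1 := by linarith
    have : relPotential γ b a = (b ^ γ - γ * a ^ (γ - 1) * (b - a) - a ^ γ) / (γ - 1) := by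
      simp [relPotential]; ring
    rw [this, le_div_iff₀ h1] at h
    linarith

/-- Close to s = 1 the left side is below κ; for large s the power s^γ dominates both sides; in
between, the potential has a positive minimum on a compact set that avoids 1. Without κ the bound
fails for γ < 2, where |s - 1|^γ is larger than the quadratic behaviour of the potential at 1. -/
lemma exists_abs_sub_one_rpow_le {γ : ℝ} (hγ : 1 < γ) {κ : ℝ} (hκ : 0 < κ) :
    ∃ C, 0 < C ∧ ∀ s, 0 ≤ s → |s - 1| ^ γ ≤ κ + C * relPotential γ s 1 := by
  have h1 : 0 < γ - 1 := by linarith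
  have h0 : 0 < γ := by linarith
  -- Beyond M one has s^(γ-1) ≥ 2γ, so the linear term γs uses at most half of s^γ.
  set M : ℝ := max 2 ((2 * γ) ^ (γ - 1)⁻¹) with hM
  have hM2 : 2 ≤ M := le_max_left _ _
  -- large values
  have hlarge : ∀ s, M ≤ s → |s - 1| ^ γ ≤ 2 * (γ - 1) * relPotential γ s 1 := by
    intro s hs
    have hs0 : 0 < s := by linarith
    have h2 : 2 * γ ≤ s ^ (γ - 1) := by
      calc 2 * γ = ((2 * γ) ^ (γ - 1)⁻¹) ^ (γ - 1) := by
            rw [← Real.rpow_mul (by positivity), inv_mul_cancel₀ h1.ne', Real.rpow_one]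
        _ ≤ s ^ (γ - 1) := Real.rpow_le_rpow (by positivity) ((le_max_right _ _).trans hs) h1.le
    have h3 : 2 * γ * s ≤ s ^ γ := by
      have : s ^ γ = s ^ (γ - 1) * s := by rw [← Real.rpow_add_one hs0.ne']; simp
      rw [this]; gcongr
    have h4 : |s - 1| ^ γ ≤ s ^ γ := by
      apply Real.rpow_le_rpow (abs_nonneg _) _ h0.le
      rw [abs_le]; constructor <;> linarith
    have h5 : 2 * (γ - 1) * relPotential γ s 1 = 2 * (s ^ γ - γ * (s - 1) - 1) := by
      simp [relPotential]; field_simp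
    rw [h5]; linarith
  -- intermediate values
  set K : Set ℝ := Icc 0 M ∩ {s | κ ≤ |s - 1| ^ γ} with hK
  have hKc : IsCompact K := by
    apply isCompact_Icc.inter_right
    exact isClosed_le continuous_const
      ((Real.continuous_rpow_const h0.le).comp (by fun_prop))
  obtain ⟨c, hc, hcK⟩ : ∃ c, 0 < c ∧ ∀ s ∈ K, c ≤ relPotential γ s 1 := by
    rcases K.eq_empty_or_nonempty with h | h
    · exact ⟨1, one_pos, by simp [h]⟩
    · obtain ⟨s, hs, hmin⟩ := hKc.exists_isMinOn h (continuous_relPotential_one hγ).continuousOn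
      refine ⟨_, relPotential_one_pos hγ hs.1.1 ?_, hmin⟩
      rintro rfl
      have := hs.2
      simp [Real.zero_rpow h0.ne'] at this
      linarith
  refine ⟨M ^ γ / c + 2 * (γ - 1), by positivity, fun s hs => ?_⟩
  have hp : 0 ≤ relPotential γ s 1 := relPotential_nonneg hγ hs one_pos
  rcases le_total M s with h | h
  · have := hlarge s h
    have h5 : 0 ≤ M ^ γ / c * relPotential γ s 1 := by positivity
    rw [add_mul]; linarith
  · rcases le_total κ (|s - 1| ^ γ) with h' | h'
    · have h3 := hcK s ⟨⟨hs, h⟩, h'⟩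
      have h4 : |s - 1| ^ γ ≤ M ^ γ := by
        apply Real.rpow_le_rpow (abs_nonneg _) _ h0.le
        rw [abs_le]; constructor <;> linarith
      have h5 : M ^ γ ≤ M ^ γ / c * relPotential γ s 1 := by
        rw [div_mul_eq_mul_div, le_div_iff₀ hc]; gcongr
      have h6 : 0 ≤ 2 * (γ - 1) * relPotential γ s 1 := by positivity
      rw [add_mul]; linarith
    · have : 0 ≤ (M ^ γ / c + 2 * (γ - 1)) * relPotential γ s 1 := by positivity
      linarith

lemma exists_relPotential_one_le {γ : ℝ} (hγ : 1 < γ) :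
    ∃ C, 0 < C ∧ ∀ s, 0 ≤ s → relPotential γ s 1 ≤ C * (|s - 1| ^ γ + |s - 1|) := by
  have h1 : 0 < γ - 1 := by linarith
  have h0 : 0 < γ := by linarith
  refine ⟨γ / (γ - 1) * 2 ^ (γ - 1), by positivity, fun s hs => ?_⟩
  have ht := rpow_tangent_le hγ hs zero_le_one
  rw [Real.one_rpow] at ht
  -- The tangent at s, evaluated at 1, bounds s^γ from above and leaves the product of the
  -- increments of s^(γ-1) and of s.
  have h2 : relPotential γ s 1 ≤ γ / (γ - 1) * ((s ^ (γ - 1) - 1) * (s - 1)) := by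
    have : relPotential γ s 1 = (s ^ γ - γ * (s - 1) - 1) / (γ - 1) := by
      simp [relPotential]; field_simp
    rw [this, div_mul_eq_mul_div]
    gcongr
    linarith
  have h3 : (s ^ (γ - 1) - 1) * (s - 1) ≤ (2 ^ (γ - 1)) * (|s - 1| ^ γ + |s - 1|) := by
    rcases le_total s 1 with h | h
    · have : s ^ (γ - 1) ≤ 1 := Real.rpow_le_one hs h h1.le
      have h5 : 0 ≤ s ^ (γ - 1) := by positivity
      have h6 : (1:ℝ) ≤ 2 ^ (γ - 1) := Real.one_le_rpow (by norm_num) h1.le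
      have h7 : 0 ≤ |s - 1| ^ γ := by positivity
      rw [abs_of_nonpos (by linarith : s - 1 ≤ 0)] at *
      nlinarith
    · set d := s - 1 with hd
      have hd0 : 0 ≤ d := by linarith
      rw [abs_of_nonneg hd0]
      have h4 : s ^ (γ - 1) ≤ 2 ^ (γ - 1) * (d ^ (γ - 1) + 1) := by
        rcases le_total d 1 with h' | h'
        · calc s ^ (γ - 1) ≤ 2 ^ (γ - 1) := Real.rpow_le_rpow hs (by linarith) h1.le
            _ ≤ _ := by
              have : 0 ≤ d ^ (γ - 1) := by positivity
              have : (0:ℝ) < 2 ^ (γ - 1) := by positivity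
              nlinarith
        · calc s ^ (γ - 1) ≤ (2 * d) ^ (γ - 1) := Real.rpow_le_rpow hs (by linarith) h1.le
            _ = 2 ^ (γ - 1) * d ^ (γ - 1) := Real.mul_rpow (by norm_num) hd0
            _ ≤ _ := by gcongr; linarith
      rcases hd0.eq_or_lt with h' | h'
      · rw [← h']; simp; positivity
      · have h5 : d ^ γ = d ^ (γ - 1) * d := by
          rw [← Real.rpow_add_one h'.ne']; simp
        rw [h5, ← add_one_mul, ← mul_assoc]
        gcongr
        linarith
  calc _ ≤ _ := h2
    _ ≤ γ / (γ - 1) * ((2 ^ (γ - 1)) * (|s - 1| ^ γ + |s - 1|)) := by gcongr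
    _ = _ := by ring

/-! ### Two facts on functions of time -/

/-- Grönwall's inequality in integral form, with inequalities almost everywhere. -/
lemma gronwall_ae {T R C : ℝ} (hT : 0 ≤ T) (hC : 0 ≤ C) (hR : 0 ≤ R) {f : ℝ → ℝ}
    (hf : IntervalIntegrable f volume 0 T)
    (h : ∀ᵐ τ ∂(timeMeasure T), f τ ≤ R + C * ∫ t in (0 : ℝ)..τ, f t) :
    ∀ᵐ τ ∂(timeMeasure T), f τ ≤ R * Real.exp (C * T) := by
  have hf' : ∀ τ ∈ Icc 0 T, IntervalIntegrable f volume 0 τ := fun τ hτ =>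
    hf.mono_set (by rw [uIcc_of_le hτ.1, uIcc_of_le hT]; exact Icc_subset_Icc_right hτ.2)
  -- Here f is only integrable. Y is continuous, dominates f almost everywhere and therefore
  -- satisfies the same integral inequality, now at every time; its primitive Z is differentiable
  -- from the right and satisfies Z' ≤ CZ + R with Z(0) = 0.
  set Y : ℝ → ℝ := fun τ => R + C * ∫ t in (0 : ℝ)..τ, f t with hY
  have hYc : ContinuousOn Y (Icc 0 T) := by
    have := intervalIntegral.continuousOn_primitive_interval' hf left_mem_uIcc
    rw [uIcc_of_le hT] at this
    fun_prop
  have hYi : ∀ τ ∈ Icc 0 T, IntervalIntegrable Y volume 0 τ := fun τ hτ =>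
    (hYc.mono (by rw [uIcc_of_le hτ.1]; exact Icc_subset_Icc_right hτ.2)).intervalIntegrable
  have hYle : ∀ τ ∈ Icc 0 T, Y τ ≤ R + C * ∫ t in (0 : ℝ)..τ, Y t := by
    intro τ hτ
    have : ∫ t in (0 : ℝ)..τ, f t ≤ ∫ t in (0 : ℝ)..τ, Y t := by
      apply intervalIntegral.integral_mono_ae_restrict hτ.1 (hf' τ hτ) (hYi τ hτ)
      rw [Measure.restrict_congr_set Ioo_ae_eq_Icc.symm]
      exact ae_restrict_of_ae_restrict_of_subset (Ioo_subset_Ioo_right hτ.2) h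
    simp only [hY]
    gcongr
  set Z : ℝ → ℝ := fun τ => ∫ t in (0 : ℝ)..τ, Y t with hZ
  have hZc : ContinuousOn Z (Icc 0 T) := by
    have := intervalIntegral.continuousOn_primitive_interval' (hYi T ⟨hT, le_rfl⟩) left_mem_uIcc
    rwa [uIcc_of_le hT] at this
  have hZd : ∀ x ∈ Ico 0 T, HasDerivWithinAt Z (Y x) (Ici x) x := by
    intro x hx
    have hm : Icc 0 T ∈ 𝓝[>] x := mem_of_superset (Ioc_mem_nhdsGT hx.2)
      (fun y hy => ⟨hx.1.trans hy.1.le, hy.2⟩)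
    apply intervalIntegral.integral_hasDerivWithinAt_right (hYi x ⟨hx.1, hx.2.le⟩) (t := Ioi x)
    · exact ⟨Icc 0 T, hm, hYc.aestronglyMeasurable measurableSet_Icc⟩
    · exact (hYc x ⟨hx.1, hx.2.le⟩).mono_of_mem_nhdsWithin hm
  have hZb : ∀ x ∈ Icc 0 T, Z x ≤ gronwallBound 0 C R (x - 0) := by
    apply le_gronwallBound_of_liminf_deriv_right_le hZc (f' := Y)
    · intro x hx r hr
      exact (hZd x hx).liminf_right_slope_le hr
    · simp [hZ]
    · intro x hx
      have := hYle x ⟨hx.1, hx.2.le⟩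
      simp only [hZ]; linarith
  filter_upwards [h, ae_restrict_mem measurableSet_Ioo] with τ hτ hm
  have h1 := hYle τ ⟨hm.1.le, hm.2.le⟩
  have h2 := hZb τ ⟨hm.1.le, hm.2.le⟩
  refine hτ.trans (h1.trans ?_)
  have h3 : R + C * gronwallBound 0 C R τ = R * Real.exp (C * τ) := by
    rcases hC.eq_or_lt with rfl | hC'
    · simp
    · rw [gronwallBound_of_K_ne_0 hC'.ne']; field_simp; ring_nf
  calc R + C * Z τ ≤ R + C * gronwallBound 0 C R τ := by gcongr; simpa using h2
    _ = _ := h3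
    _ ≤ _ := by gcongr; exact hm.2.le

/-- A continuous function whose weak time derivative is integrable is its primitive. -/
lemma eq_add_integral_of_weak_deriv {T A₀ : ℝ} (hT : 0 < T) {A B : ℝ → ℝ}
    (hA : ContinuousOn A (Icc 0 T)) (hB : IntervalIntegrable B volume 0 T)
    (h : ∀ θ : ℝ → ℝ, ContDiff ℝ ∞ θ →
      θ T * A T - θ 0 * A₀ = ∫ t in (0 : ℝ)..T, (deriv θ t * A t + θ t * B t)) :
    ∀ τ ∈ Icc 0 T, A τ = A₀ + ∫ t in (0 : ℝ)..τ, B t := by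
  set b : ℝ → ℝ := fun τ => ∫ t in (0 : ℝ)..τ, B t with hb
  have hbc : ContinuousOn b (Icc 0 T) := by
    have := intervalIntegral.continuousOn_primitive_interval' hB left_mem_uIcc
    rwa [uIcc_of_le hT.le] at this
  have hF : ContinuousOn (fun t => A t - (A₀ + b t)) (Icc 0 T) := by fun_prop
  have hae : ∀ᵐ t ∂volume, t ∈ Ioo 0 T → A t - (A₀ + b t) = 0 := by
    apply isOpen_Ioo.ae_eq_zero_of_integral_contDiff_smul_eq_zero
    · exact (hF.mono Ioo_subset_Icc_self).locallyIntegrableOn measurableSet_Ioo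
    intro η hη hηc hηs
    -- The primitive of η that vanishes at T removes the unknown end value, while θ(0) = -∫η brings
    -- in A₀. Integrating θB by parts then leaves ∫η (A - A₀ - b) = 0. Since θ need not vanish at 0,
    -- the initial value is identified as well.
    set θ : ℝ → ℝ := fun t => ∫ s in T..t, η s with hθ
    have hθd : ∀ t, HasDerivAt θ (η t) t := fun t =>
      intervalIntegral.integral_hasDerivAt_right (hη.continuous.intervalIntegrable _ _)
        (hη.continuous.stronglyMeasurableAtFilter _ _) hη.continuous.continuousAt
    have hθ' : deriv θ = η := funext fun t => (hθd t).deriv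
    have hθs : ContDiff ℝ ∞ θ := by
      rw [contDiff_infty_iff_deriv]
      exact ⟨fun t => (hθd t).differentiableAt, hθ' ▸ hη⟩
    have h1 := h θ hθs
    have hθT : θ T = 0 := by simp [hθ]
    have hθ0 : θ 0 = - ∫ s in (0 : ℝ)..T, η s := intervalIntegral.integral_symm _ _
    have hi : ∀ g : ℝ → ℝ, ContinuousOn g (Icc 0 T) →
        IntervalIntegrable (fun t => η t * g t) volume 0 T := fun g hg => by
      apply ContinuousOn.intervalIntegrable
      rw [uIcc_of_le hT.le]
      exact hη.continuous.continuousOn.mul hg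
    have hi2 : IntervalIntegrable (fun t => θ t * B t) volume 0 T :=
      hB.continuousOn_mul hθs.continuous.continuousOn
    -- b is merely absolutely continuous, since B is only integrable.
    have hac1 : AbsolutelyContinuousOnInterval θ 0 T :=
      (hη.continuous.intervalIntegrable 0 T).absolutelyContinuousOnInterval_intervalIntegral
        right_mem_uIcc
    have hac2 : AbsolutelyContinuousOnInterval b 0 T :=
      hB.absolutelyContinuousOnInterval_intervalIntegral left_mem_uIcc
    have hibp : ∫ t in (0 : ℝ)..T, θ t * B t = - ∫ t in (0 : ℝ)..T, η t * b t := by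
      have h2 := hac1.integral_mul_deriv_eq_deriv_mul hac2
      have hb0 : b 0 = 0 := by simp [hb]
      rw [hθT, hb0, hθ'] at h2
      rw [zero_mul, mul_zero, sub_zero, zero_sub] at h2
      rw [← h2]
      apply intervalIntegral.integral_congr_ae
      filter_upwards [hB.ae_hasDerivAt_integral] with t ht hm
      rw [(ht (uIoc_subset_uIcc hm) 0 left_mem_uIcc).deriv]
    rw [hθT, hθ0, hθ', intervalIntegral.integral_add (hi A hA) hi2, hibp] at h1
    have h2 : ∫ t, η t • (A t - (A₀ + b t)) = ∫ t in (0 : ℝ)..T, η t * (A t - (A₀ + b t)) := by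
      rw [intervalIntegral.integral_of_le hT.le, setIntegral_eq_integral_of_forall_compl_eq_zero]
      · simp
      · intro t ht
        have : η t = 0 := image_eq_zero_of_notMem_tsupport
          fun h' => ht (Ioo_subset_Ioc_self (hηs h'))
        simp [this]
    rw [h2]
    have h3 : ∀ t, η t * (A t - (A₀ + b t)) = (η t * A t - η t * A₀) - η t * b t := by
      intro t; ring
    simp_rw [h3]
    rw [intervalIntegral.integral_sub ((hi A hA).sub (hi _ continuousOn_const)) (hi b hbc),
      intervalIntegral.integral_sub (hi A hA) (hi _ continuousOn_const),
      intervalIntegral.integral_mul_const]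
    linarith
  have hae' : (fun t => A t - (A₀ + b t)) =ᵐ[volume.restrict (Icc 0 T)] fun _ => 0 := by
    rw [Measure.restrict_congr_set Ioo_ae_eq_Icc.symm]
    exact (ae_restrict_iff' measurableSet_Ioo).2 hae
  intro τ hτ
  have := Measure.eqOn_Icc_of_ae_eq volume hT.ne hae' hF continuousOn_const hτ
  simp only at this
  linarith

end

section

/-! ### Local defining functions and the surface measure -/

/-- The defining function `y ↦ ⟪a, y⟫ - ζ(y - ⟪a, y⟫ a)` of the subgraph of `ζ`. -/
def graphFunction (a : E3) (ζ : E3 → ℝ) (y : E3) : ℝ := ⟪a, y⟫ - ζ (y - ⟪a, y⟫ • a)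

lemma contDiff_graphFunction {a : E3} {ζ : E3 → ℝ} (hζ : ContDiff ℝ 1 ζ) :
    ContDiff ℝ 1 (graphFunction a ζ) := by
  have h : ContDiff ℝ 1 fun y : E3 => ⟪a, y⟫ := contDiff_const.inner ℝ contDiff_id
  exact h.sub (hζ.comp (contDiff_id.sub (h.smul contDiff_const)))

/-- Level sets of the defining function are translates of one another along a; this is what makes
the volume of thin strips easy to estimate. -/
lemma graphFunction_add_smul {a : E3} (ha : ‖a‖ = 1) (ζ : E3 → ℝ) (y : E3) (s : ℝ) :
    graphFunction a ζ (y + s • a) = graphFunction a ζ y + s := by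
  have h : ⟪a, y + s • a⟫ = ⟪a, y⟫ + s := by
    rw [inner_add_right, inner_smul_right, real_inner_self_eq_norm_sq, ha]; ring
  have h' : y + s • a - (⟪a, y⟫ + s) • a = y - ⟪a, y⟫ • a := by
    rw [add_smul]; abel
  simp only [graphFunction, h, h']; ring

lemma IsBoundedRegularDomain.exists_graphFunction {Ω : Set E3} (hΩ : IsBoundedRegularDomain Ω)
    {x : E3} (hx : x ∈ frontier Ω) : ∃ r > 0, ∃ a : E3, ‖a‖ = 1 ∧ ∃ ζ : E3 → ℝ, ContDiff ℝ 1 ζ ∧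
      ∀ y ∈ Metric.ball x r, (y ∈ Ω ↔ graphFunction a ζ y < 0) := by
  obtain ⟨r, hr, a, ha, ζ, hζ, h⟩ := hΩ.boundary x hx
  exact ⟨r, hr, a, ha, ζ, hζ, fun y hy => by rw [h y hy, graphFunction, sub_neg]⟩

lemma graphFunction_eq_zero_of_mem_frontier {Ω : Set E3} (hΩ : IsOpen Ω) {x : E3} {r : ℝ}
    {g : E3 → ℝ} (hg : Continuous g) (h : ∀ y ∈ Metric.ball x r, (y ∈ Ω ↔ g y < 0))
    {y : E3} (hy : y ∈ frontier Ω) (hyr : y ∈ Metric.ball x r) : g y = 0 := by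
  rw [hΩ.frontier_eq] at hy
  apply le_antisymm
  · have h1 : y ∈ closure (Metric.ball x r ∩ Ω) := by
      have := Metric.isOpen_ball.inter_closure (s := Metric.ball x r) (t := Ω)
      exact this ⟨hyr, hy.1⟩
    have h2 : closure (Metric.ball x r ∩ Ω) ⊆ {z | g z ≤ 0} :=
      closure_minimal (fun z hz => ((h z hz.1).1 hz.2).le) (isClosed_le hg continuous_const)
    exact h2 h1
  · by_contra hlt
    exact hy.2 ((h y hyr).2 (not_le.1 hlt))

lemma IsBoundedRegularDomain.isCompact_closure {Ω : Set E3} (hΩ : IsBoundedRegularDomain Ω) :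
    IsCompact (closure Ω) := hΩ.isBounded.isCompact_closure

lemma IsBoundedRegularDomain.isCompact_frontier {Ω : Set E3} (hΩ : IsBoundedRegularDomain Ω) :
    IsCompact (frontier Ω) :=
  hΩ.isCompact_closure.of_isClosed_subset isClosed_frontier frontier_subset_closure

lemma IsBoundedRegularDomain.isFiniteMeasure_volOn {Ω : Set E3}
    (hΩ : IsBoundedRegularDomain Ω) : IsFiniteMeasure (volOn Ω) :=
  ⟨by rw [volOn, Measure.restrict_apply_univ]; exact hΩ.isBounded.measure_lt_top⟩

/-- The plane orthogonal to a has dimension 2, so its two-dimensional Hausdorff measure is a Haar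
measure, finite on bounded sets. -/
lemma hausdorffMeasure_lt_top_of_plane {a : E3} (ha : ‖a‖ = 1)
    {s : Set (Submodule.span ℝ {a})ᗮ} (hs : Bornology.IsBounded s) : μH[2] s < ⊤ := by
  have : Fact (Module.finrank ℝ E3 = 2 + 1) := ⟨by simp⟩
  have hd : Module.finrank ℝ (Submodule.span ℝ {a})ᗮ = 2 :=
    Submodule.finrank_orthogonal_span_singleton (by rintro rfl; simp at ha)
  have hm := isAddHaarMeasure_hausdorffMeasure (E := (Submodule.span ℝ {a})ᗮ)
  rw [hd] at hm
  exact hs.measure_lt_top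

/-- The surface measure of a bounded `C¹` domain is finite. -/
lemma IsBoundedRegularDomain.isFiniteMeasure_surfaceMeasure {Ω : Set E3}
    (hΩ : IsBoundedRegularDomain Ω) : IsFiniteMeasure (surfaceMeasure Ω) := by
  suffices h : (μH[2] : Measure E3).restrict (frontier Ω) (frontier Ω) < ⊤ by
    rw [Measure.restrict_apply_self] at h
    refine ⟨?_⟩
    rw [surfaceMeasure, Measure.restrict_apply_univ, Measure.euclideanHausdorffMeasure_def,
      Measure.smul_apply]
    exact ENNReal.mul_lt_top ENNReal.coe_lt_top (by simpa using h)
  -- By compactness local finiteness suffices. Near x the boundary lies in the image of a bounded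
  -- piece of the plane under z ↦ z + ζ(z) a, which is locally Lipschitz because ζ is C¹, and
  -- Lipschitz maps preserve finiteness of μH[2].
  apply hΩ.isCompact_frontier.measure_lt_top_of_nhdsWithin
  intro x hx
  obtain ⟨r, hr, a, ha, ζ, hζ, h⟩ := hΩ.exists_graphFunction hx
  set S := (Submodule.span ℝ {a})ᗮ
  have hq : ∀ y : E3, y - ⟪a, y⟫ • a ∈ S := fun y => by
    rw [Submodule.mem_orthogonal_singleton_iff_inner_right, inner_sub_right, inner_smul_right,
      real_inner_self_eq_norm_sq, ha]
    ring
  set q : E3 → S := fun y => ⟨y - ⟪a, y⟫ • a, hq y⟩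
  have hqc : Continuous q := by
    apply Continuous.subtype_mk
    fun_prop
  set Φ : S → E3 := fun z => (z : E3) + ζ z • a
  have hΦ : ContDiff ℝ 1 Φ := by
    have hc : ContDiff ℝ 1 (fun z : S => (z : E3)) := S.subtypeL.contDiff
    exact hc.add ((hζ.comp hc).smul contDiff_const)
  obtain ⟨K, t, ht, hK⟩ := (hΦ.contDiffAt (x := q x)).exists_lipschitzOnWith
  set t' := t ∩ Metric.ball (q x) 1
  refine ⟨frontier Ω ∩ (Metric.ball x r ∩ q ⁻¹' t'), ?_, ?_⟩
  · apply inter_mem_nhdsWithin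
    refine inter_mem (Metric.ball_mem_nhds x hr) (hqc.continuousAt.preimage_mem_nhds ?_)
    exact inter_mem ht (Metric.ball_mem_nhds _ one_pos)
  · refine (Measure.restrict_apply_le _ _).trans_lt ?_
    have hsub : frontier Ω ∩ (Metric.ball x r ∩ q ⁻¹' t') ⊆ Φ '' t' := by
      rintro y ⟨hy, hyr, hyt⟩
      refine ⟨q y, hyt, ?_⟩
      have := graphFunction_eq_zero_of_mem_frontier hΩ.isOpen
        (contDiff_graphFunction hζ).continuous h hy hyr
      have h' : ζ (y - ⟪a, y⟫ • a) = ⟪a, y⟫ := by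
        rw [graphFunction] at this; linarith
      simp [Φ, q, h']
    refine (measure_mono hsub).trans_lt ?_
    refine ((hK.mono inter_subset_left).hausdorffMeasure_image_le zero_le_two).trans_lt ?_
    exact ENNReal.mul_lt_top (ENNReal.rpow_lt_top_of_nonneg zero_le_two ENNReal.coe_ne_top)
      (hausdorffMeasure_lt_top_of_plane ha (Metric.isBounded_ball.subset inter_subset_right))

/-! ### The divergence theorem for tangent vector fields -/

/-- The `i`-th coordinate, as a continuous linear form. -/
def coord (i : Fin 3) : E3 →L[ℝ] ℝ := EuclideanSpace.proj i

lemma coord_apply (i : Fin 3) (v : E3) : coord i v = v i := rfl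

lemma divergence_eq (v : E3 → E3) (x : E3) : divergence v x = ∑ i, fderiv ℝ v x (e i) i := rfl

lemma sum_smul_e (v : E3) : ∑ i, v i • e i = v := by
  ext j
  simp [e, Finset.sum_apply, Pi.single_apply]

lemma map_eq_sum_e (L : E3 →L[ℝ] ℝ) (v : E3) : L v = ∑ i, L (e i) * v i := by
  conv_lhs => rw [← sum_smul_e v]
  simp [mul_comm]

lemma norm_e (i : Fin 3) : ‖e i‖ = 1 := by simp [e]

lemma fderiv_apply_coord {v : E3 → E3} {x : E3} (hv : DifferentiableAt ℝ v x) (w : E3)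
    (i : Fin 3) : fderiv ℝ (fun y => v y i) x w = fderiv ℝ v x w i := by
  have := ((coord i).hasFDerivAt.comp x
    hv.hasFDerivAt).fderiv
  exact congrArg (fun L : E3 →L[ℝ] ℝ => L w) this

lemma continuousOn_divergence {Ω : Set E3} (hΩ : IsOpen Ω) {V : E3 → E3}
    (hV : ContDiffOn ℝ 1 V Ω) : ContinuousOn (divergence V) Ω := by
  have h : ContinuousOn (fderiv ℝ V) Ω := hV.continuousOn_fderiv_of_isOpen hΩ le_rfl
  refine continuousOn_finsetSum (f := fun i x => fderiv ℝ V x (e i) i) Finset.univ fun i _ => ?_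
  exact (coord i).continuous.comp_continuousOn
    (h.clm_apply continuousOn_const)

/-- Integration by parts over the whole space, one coordinate at a time. All products vanish off the
compact support of f, so the values of V outside Ω play no role. -/
lemma integral_divergence_smul_of_tsupport_subset {Ω : Set E3} (hΩ : IsOpen Ω) {f : E3 → ℝ}
    (hf : ContDiff ℝ 1 f) (hfc : HasCompactSupport f) (hfs : tsupport f ⊆ Ω) {V : E3 → E3}
    (hV : ContDiffOn ℝ 1 V Ω) :
    ∫ x, (f x * divergence V x + fderiv ℝ f x (V x)) ∂(volOn Ω) = 0 := by
  have hVd : ∀ x ∈ Ω, DifferentiableAt ℝ V x := fun x hx =>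
    (hV.differentiableOn one_ne_zero).differentiableAt (hΩ.mem_nhds hx)
  have hf' : Continuous (fderiv ℝ f) := hf.continuous_fderiv one_ne_zero
  have hV' : ContinuousOn (fderiv ℝ V) Ω := hV.continuousOn_fderiv_of_isOpen hΩ le_rfl
  have hz : ∀ x, x ∉ tsupport f → f x = 0 ∧ fderiv ℝ f x = 0 := fun x hx =>
    ⟨image_eq_zero_of_notMem_tsupport hx,
      image_eq_zero_of_notMem_tsupport (f := fderiv ℝ f) fun h => hx (tsupport_fderiv_subset ℝ h)⟩
  have hint : ∀ F : E3 → ℝ, ContinuousOn F Ω → (∀ x, x ∉ tsupport f → F x = 0) →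
      Integrable F := by
    intro F hF h0
    have : IntegrableOn F (tsupport f) := (hF.mono hfs).integrableOn_compact hfc
    rw [← integrable_indicator_iff (isClosed_tsupport f).measurableSet] at this
    refine this.congr (Eventually.of_forall fun x => ?_)
    by_cases hx : x ∈ tsupport f
    · simp [hx]
    · simp [hx, h0 x hx]
  have hVi : ∀ i, ContinuousOn (fun x => V x i) Ω := fun i =>
    (coord i).continuous.comp_continuousOn
      hV.continuousOn
  have hVi' : ∀ i, ContinuousOn (fun x => fderiv ℝ (fun y => V y i) x (e i)) Ω := by
    intro i
    have : ContinuousOn (fun x => fderiv ℝ V x (e i) i) Ω :=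
      (coord i).continuous.comp_continuousOn
        (hV'.clm_apply continuousOn_const)
    exact this.congr fun x hx => fderiv_apply_coord (hVd x hx) _ _
  have hi1 : ∀ i, Integrable fun x => f x * fderiv ℝ (fun y => V y i) x (e i) := fun i =>
    hint _ (hf.continuous.continuousOn.mul (hVi' i)) fun x hx => by simp [(hz x hx).1]
  have hi2 : ∀ i, Integrable fun x => fderiv ℝ f x (e i) * V x i := fun i =>
    hint _ ((hf'.clm_apply continuous_const).continuousOn.mul (hVi i))
      fun x hx => by simp [(hz x hx).2]
  have hi3 : ∀ i, Integrable fun x => f x * V x i := fun i =>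
    hint _ (hf.continuous.continuousOn.mul (hVi i)) fun x hx => by simp [(hz x hx).1]
  have hparts : ∀ i, ∫ x, (f x * fderiv ℝ (fun y => V y i) x (e i) + fderiv ℝ f x (e i) * V x i)
      = 0 := by
    intro i
    rw [integral_add (hi1 i) (hi2 i), integral_mul_fderiv_eq_neg_fderiv_mul_of_integrable (hi2 i)
      (hi1 i) (hi3 i), neg_add_cancel]
    · exact fun x _ => hf.differentiable one_ne_zero x
    · intro x hx
      exact (coord i).differentiableAt.comp x
        (hVd x (hfs hx))
  rw [volOn, setIntegral_eq_integral_of_forall_compl_eq_zero]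
  · have : ∀ x, f x * divergence V x + fderiv ℝ f x (V x) =
        ∑ i, (f x * fderiv ℝ (fun y => V y i) x (e i) + fderiv ℝ f x (e i) * V x i) := by
      intro x
      rw [Finset.sum_add_distrib, ← map_eq_sum_e, divergence_eq, Finset.mul_sum]
      by_cases hx : x ∈ tsupport f
      · simp_rw [fderiv_apply_coord (hVd x (hfs hx))]
      · simp [(hz x hx).1]
    simp_rw [this]
    rw [integral_finsetSum Finset.univ (f := fun i x => f x * fderiv ℝ (fun y => V y i) x (e i)
      + fderiv ℝ f x (e i) * V x i) fun i _ => (hi1 i).add (hi2 i)]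
    exact Finset.sum_eq_zero fun i _ => hparts i
  · intro x hx
    have := hz x fun h => hx (hfs h)
    simp [this.1, this.2]

/-- The strips `{-h ≤ g < 0}` along a graph have volume `O(h)`. -/
lemma volume_strip_le {a : E3} (ha : ‖a‖ = 1) {ζ : E3 → ℝ} (hζ : ContDiff ℝ 1 ζ) (x : E3)
    (ρ : ℝ) (n : ℕ) :
    (n + 1 : ℝ≥0∞) * volume (Metric.closedBall x ρ ∩
      {y | -(2 / (n + 1 : ℝ)) ≤ graphFunction a ζ y ∧ graphFunction a ζ y < 0})
      ≤ volume (Metric.closedBall x (ρ + 2)) := by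
  set g := graphFunction a ζ
  have hg : Continuous g := (contDiff_graphFunction hζ).continuous
  set h : ℝ := 2 / (n + 1 : ℝ) with hh
  have hn : (0 : ℝ) < n + 1 := by positivity
  have hh0 : 0 < h := by positivity
  set S := Metric.closedBall x ρ ∩ {y | -h ≤ g y ∧ g y < 0}
  have hS : MeasurableSet S := Metric.isClosed_closedBall.measurableSet.inter
    ((measurableSet_le measurable_const hg.measurable).inter
      (measurableSet_lt hg.measurable measurable_const))
  -- These are the strip translated by j h along a, for j = 0, ..., n. On the j-th one g lies in
  -- [(j-1)h, jh), so they are disjoint; they have equal volume, and since jh ≤ 2 they all stay in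
  -- the ball enlarged by 2.
  set t : ℕ → Set E3 := fun j => (fun y => y + (-(j * h)) • a) ⁻¹' S
  have htm : ∀ j, MeasurableSet (t j) := fun j => (measurable_add_const _) hS
  have hgt : ∀ j y, y ∈ t j → (j - 1) * h ≤ g y ∧ g y < j * h := by
    intro j y hy
    have h1 := hy.2
    simp only [mem_ofPred_eq, g, graphFunction_add_smul ha] at h1
    constructor <;> [linarith [h1.1]; linarith [h1.2]]
  have hd : ∀ i j : ℕ, i < j → Disjoint (t i) (t j) := by
    intro i j hij
    rw [Set.disjoint_left]
    intro y hi hj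
    have h1 := (hgt i y hi).2
    have h2 := (hgt j y hj).1
    have : (i : ℝ) + 1 ≤ j := by exact_mod_cast hij
    nlinarith
  have hdis : PairwiseDisjoint (↑(Finset.range (n + 1))) t := by
    intro i _ j _ hij
    rcases hij.lt_or_gt with h | h
    · exact hd i j h
    · exact (hd j i h).symm
  have hsub : (⋃ j ∈ Finset.range (n + 1), t j) ⊆ Metric.closedBall x (ρ + 2) := by
    intro y hy
    simp only [mem_iUnion, Finset.mem_range] at hy
    obtain ⟨j, hj, hy⟩ := hy
    have h1 := hy.1
    rw [Metric.mem_closedBall, dist_eq_norm] at h1 ⊢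
    have hj' : (j : ℝ) * h ≤ 2 := by
      have : (j : ℝ) ≤ n + 1 := by exact_mod_cast hj.le
      rw [hh, mul_div_assoc', div_le_iff₀ hn]; nlinarith
    calc ‖y - x‖ = ‖(y + (-(j * h)) • a - x) + (j * h) • a‖ := by
          congr 1; rw [neg_smul]; abel
      _ ≤ ‖y + (-(j * h)) • a - x‖ + ‖(j * h) • a‖ := norm_add_le _ _
      _ ≤ ρ + 2 := by
        rw [norm_smul, ha, mul_one, Real.norm_of_nonneg (by positivity)]
        exact add_le_add h1 hj'
  calc (n + 1 : ℝ≥0∞) * volume S = ∑ j ∈ Finset.range (n + 1), volume (t j) := by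
        simp [t, measure_preimage_add_right]
    _ = volume (⋃ j ∈ Finset.range (n + 1), t j) :=
        (measure_biUnion_finset hdis fun j _ => htm j).symm
    _ ≤ _ := measure_mono hsub

end

/-! ### Cutoffs along the boundary and the flux of a tangent field. -/

section

/-- Where the gradient of g is nonzero, its normalization is by definition an outward normal, with g
as the defining function on a smaller ball centred at y; where it vanishes there is nothing to
prove. -/
lemma fderiv_apply_eq_zero_of_tangent {Ω : Set E3} {V : E3 → E3} (hV : TangentToBoundary Ω V)
    {x : E3} {r : ℝ} {g : E3 → ℝ} (hg : ContDiff ℝ 1 g)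
    (h : ∀ y ∈ Metric.ball x r, (y ∈ Ω ↔ g y < 0)) {y : E3} (hy : y ∈ frontier Ω)
    (hyr : y ∈ Metric.ball x r) : fderiv ℝ g y (V y) = 0 := by
  by_cases h0 : ∇ g y = 0
  · have : fderiv ℝ g y = 0 := by
      rwa [gradient, LinearIsometryEquiv.map_eq_zero_iff] at h0
    simp [this]
  · have hn : IsOutwardUnitNormal Ω y (‖∇ g y‖⁻¹ • ∇ g y) := by
      refine ⟨hy, r - dist y x, by rw [Metric.mem_ball] at hyr; linarith, g, hg,
        fun z hz => h z ?_, h0, rfl⟩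
      rw [Metric.mem_ball] at hz ⊢
      linarith [dist_triangle z y x]
    have := hV y _ hn
    rw [inner_smul_right, mul_eq_zero] at this
    rcases this with h' | h'
    · simp [h0] at h'
    · rwa [real_inner_comm, gradient, InnerProductSpace.toDual_symm_apply] at h'

/-- The cutoff `1` for `s ≤ -2 / (n + 1)`, `0` for `s ≥ -1 / (n + 1)`. -/
def cutoff (n : ℕ) (s : ℝ) : ℝ := Real.smoothTransition (-(n + 1) * s - 1)

lemma contDiff_cutoff (n : ℕ) : ContDiff ℝ 1 (cutoff n) :=
  Real.smoothTransition.contDiff.comp (by fun_prop)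

lemma cutoff_eq_zero {n : ℕ} {s : ℝ} (h : -(n + 1 : ℝ)⁻¹ ≤ s) : cutoff n s = 0 := by
  apply Real.smoothTransition.zero_of_nonpos
  have hn : (0 : ℝ) < n + 1 := by positivity
  have : (n + 1 : ℝ) * (n + 1 : ℝ)⁻¹ = 1 := mul_inv_cancel₀ hn.ne'
  nlinarith

lemma cutoff_eq_one {n : ℕ} {s : ℝ} (h : s ≤ -(2 / (n + 1 : ℝ))) : cutoff n s = 1 := by
  apply Real.smoothTransition.one_of_one_le
  have hn : (0 : ℝ) < n + 1 := by positivity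
  have : (n + 1 : ℝ) * (2 / (n + 1 : ℝ)) = 2 := mul_div_cancel₀ _ hn.ne'
  nlinarith

lemma abs_cutoff_le (n : ℕ) (s : ℝ) : |cutoff n s| ≤ 1 := by
  rw [cutoff, abs_of_nonneg (Real.smoothTransition.nonneg _)]
  exact Real.smoothTransition.le_one _

lemma exists_abs_deriv_smoothTransition_le :
    ∃ C, 0 ≤ C ∧ ∀ s, |deriv Real.smoothTransition s| ≤ C := by
  have hc : Continuous (deriv Real.smoothTransition) :=
    (Real.smoothTransition.contDiff (n := 1)).continuous_deriv le_rfl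
  obtain ⟨C, hC⟩ := (isCompact_Icc (a := (0 : ℝ)) (b := 1)).exists_bound_of_continuousOn
    hc.continuousOn
  refine ⟨C, (norm_nonneg _).trans (hC 0 (by simp)), fun s => ?_⟩
  by_cases hs : s ∈ Icc (0 : ℝ) 1
  · exact hC s hs
  · have h0 : 0 ≤ C := (norm_nonneg _).trans (hC 0 (by simp))
    have : deriv Real.smoothTransition s = 0 := by
      rw [mem_Icc, not_and_or, not_le, not_le] at hs
      rcases hs with hs | hs
      · have : Real.smoothTransition =ᶠ[𝓝 s] fun _ => 0 := by
          filter_upwards [Iio_mem_nhds hs] with y hy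
          exact Real.smoothTransition.zero_of_nonpos (le_of_lt hy)
        rw [this.deriv_eq, deriv_const]
      · have : Real.smoothTransition =ᶠ[𝓝 s] fun _ => 1 := by
          filter_upwards [Ioi_mem_nhds hs] with y hy
          exact Real.smoothTransition.one_of_one_le (le_of_lt hy)
        rw [this.deriv_eq, deriv_const]
    simpa [this]

lemma hasDerivAt_cutoff (n : ℕ) (s : ℝ) : HasDerivAt (cutoff n)
    (deriv Real.smoothTransition (-(n + 1) * s - 1) * -(n + 1)) s := by
  have h1 : HasDerivAt Real.smoothTransition (deriv Real.smoothTransition (-(n + 1) * s - 1))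
      (-(n + 1) * s - 1) :=
    ((Real.smoothTransition.contDiff (n := 1)).differentiable one_ne_zero _).hasDerivAt
  have h2 : HasDerivAt (fun s : ℝ => -((n : ℝ) + 1) * s - 1) (-(n + 1)) s := by
    simpa using ((hasDerivAt_id s).const_mul (-((n : ℝ) + 1))).sub_const 1
  exact h1.comp s h2

lemma deriv_cutoff_eq_zero {n : ℕ} {s : ℝ} (h : s < -(2 / (n + 1 : ℝ))) :
    deriv (cutoff n) s = 0 := by
  have : cutoff n =ᶠ[𝓝 s] fun _ => 1 := by
    filter_upwards [Iio_mem_nhds h] with y hy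
    exact cutoff_eq_one (le_of_lt hy)
  rw [this.deriv_eq, deriv_const]

lemma integrable_volOn_of_continuousOn_of_bounded {Ω : Set E3} (hΩ : IsBoundedRegularDomain Ω)
    {F : Type*} [NormedAddCommGroup F] {f : E3 → F} (hf : ContinuousOn f Ω) {C : ℝ}
    (hC : ∀ x ∈ Ω, ‖f x‖ ≤ C) : Integrable f (volOn Ω) := by
  have := hΩ.isFiniteMeasure_volOn
  refine Integrable.of_bound (hf.aestronglyMeasurable hΩ.isOpen.measurableSet) C ?_
  filter_upwards [ae_restrict_mem hΩ.isOpen.measurableSet] with x hx using hC x hx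

lemma abs_divergence_le {V : E3 → E3} {x : E3} {C : ℝ} (h : ‖fderiv ℝ V x‖ ≤ C) :
    |divergence V x| ≤ 3 * C := by
  rw [divergence_eq]
  refine (Finset.abs_sum_le_sum_abs _ _).trans ?_
  have : ∀ i : Fin 3, |fderiv ℝ V x (e i) i| ≤ C := fun i => by
    calc |fderiv ℝ V x (e i) i| ≤ ‖fderiv ℝ V x (e i)‖ := by
          simpa using PiLp.norm_apply_le (fderiv ℝ V x (e i)) i
      _ ≤ ‖fderiv ℝ V x‖ * ‖e i‖ := ContinuousLinearMap.le_opNorm _ _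
      _ ≤ C := by rw [norm_e, mul_one]; exact h
  calc ∑ i : Fin 3, |fderiv ℝ V x (e i) i| ≤ ∑ i : Fin 3, C := Finset.sum_le_sum fun i _ => this i
    _ = 3 * C := by simp

lemma integrable_divergence_smul {Ω : Set E3} (hΩ : IsBoundedRegularDomain Ω)
    {V : E3 → E3} (hVc : ContinuousOn V (closure Ω)) (hV : ContDiffOn ℝ 1 V Ω) {C : ℝ}
    (hC : ∀ x ∈ Ω, ‖fderiv ℝ V x‖ ≤ C) {f : E3 → ℝ} (hf : ContDiff ℝ 1 f)
    (hfc : HasCompactSupport f) :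
    Integrable (fun y => f y * divergence V y + fderiv ℝ f y (V y)) (volOn Ω) := by
  have hf' := hf.continuous_fderiv one_ne_zero
  obtain ⟨CV, hCV⟩ := hΩ.isCompact_closure.exists_bound_of_continuousOn hVc
  obtain ⟨Cf, hCf⟩ := hfc.exists_bound_of_continuous hf.continuous
  obtain ⟨Cf', hCf'⟩ := (hfc.fderiv (𝕜 := ℝ)).exists_bound_of_continuous hf'
  refine integrable_volOn_of_continuousOn_of_bounded hΩ ?_
    (C := Cf * (3 * C) + Cf' * CV) fun y hy => ?_
  · exact (hf.continuous.continuousOn.mul (continuousOn_divergence hΩ.isOpen hV)).add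
      (hf'.continuousOn.clm_apply (hVc.mono subset_closure))
  · refine (norm_add_le _ _).trans (add_le_add ?_ ?_)
    · rw [norm_mul]
      exact mul_le_mul (hCf y) (abs_divergence_le (hC y hy)) (norm_nonneg _)
        ((norm_nonneg _).trans (hCf y))
    · refine (ContinuousLinearMap.le_opNorm _ _).trans ?_
      exact mul_le_mul (hCf' y) (hCV y (subset_closure hy)) (norm_nonneg _)
        ((norm_nonneg _).trans (hCf' y))

/-- Near a boundary point, a tangent field has no distributional flux through the boundary. -/
lemma integral_divergence_smul_of_boundary {Ω : Set E3} (hΩ : IsBoundedRegularDomain Ω)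
    {V : E3 → E3} (hVc : ContinuousOn V (closure Ω)) (hV : ContDiffOn ℝ 1 V Ω) {C : ℝ}
    (hC : ∀ x ∈ Ω, ‖fderiv ℝ V x‖ ≤ C) (hVt : TangentToBoundary Ω V) {x : E3}
    (hx : x ∈ frontier Ω) : ∃ ρ > 0, ∀ ψ : E3 → ℝ, ContDiff ℝ ∞ ψ → HasCompactSupport ψ →
      tsupport ψ ⊆ Metric.ball x ρ →
      ∫ y, (ψ y * divergence V y + fderiv ℝ ψ y (V y)) ∂(volOn Ω) = 0 := by
  obtain ⟨r, hr, a, ha, ζ, hζ, h⟩ := hΩ.exists_graphFunction hx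
  set g := graphFunction a ζ with hgdef
  have hg : ContDiff ℝ 1 g := contDiff_graphFunction hζ
  have hgc : Continuous g := hg.continuous
  have hg' : Continuous (fderiv ℝ g) := hg.continuous_fderiv one_ne_zero
  have hΩm := hΩ.isOpen.measurableSet
  have := hΩ.isFiniteMeasure_volOn
  refine ⟨r / 2, by positivity, fun ψ hψ hψc hψs => ?_⟩
  have hball : Metric.closedBall x (r / 2) ⊆ Metric.ball x r :=
    Metric.closedBall_subset_ball (by linarith)
  have hψ1 : ContDiff ℝ 1 ψ := hψ.of_le (by simp)
  have hψ' : Continuous (fderiv ℝ ψ) := hψ1.continuous_fderiv one_ne_zero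
  obtain ⟨Cψ, hCψ⟩ := hψc.exists_bound_of_continuous hψ1.continuous
  obtain ⟨Cψ', hCψ'⟩ := (hψc.fderiv (𝕜 := ℝ)).exists_bound_of_continuous hψ'
  obtain ⟨CV, hCV⟩ := hΩ.isCompact_closure.exists_bound_of_continuousOn hVc
  obtain ⟨Cs, hCs0, hCs⟩ := exists_abs_deriv_smoothTransition_le
  have hCψ0 : 0 ≤ Cψ := (norm_nonneg _).trans (hCψ x)
  have hψ0 : ∀ y, y ∉ Metric.closedBall x (r / 2) → ψ y = 0 := fun y hy =>
    image_eq_zero_of_notMem_tsupport fun h' => hy (Metric.ball_subset_closedBall (hψs h'))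
  have hVΩ : ContinuousOn V Ω := hVc.mono subset_closure
  -- the two parts of the integrand
  set A : E3 → ℝ := fun y => ψ y * divergence V y + fderiv ℝ ψ y (V y) with hA
  set B : E3 → ℝ := fun y => ψ y * fderiv ℝ g y (V y) with hB
  have hAc : ContinuousOn A Ω := (hψ1.continuous.continuousOn.mul
    (continuousOn_divergence hΩ.isOpen hV)).add (hψ'.continuousOn.clm_apply hVΩ)
  have hBc : ContinuousOn B Ω := hψ1.continuous.continuousOn.mul
    (hg'.continuousOn.clm_apply hVΩ)
  have hAb : ∀ y ∈ Ω, ‖A y‖ ≤ Cψ * (3 * C) + Cψ' * CV := fun y hy => by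
    refine (norm_add_le _ _).trans (add_le_add ?_ ?_)
    · rw [norm_mul]
      exact mul_le_mul (hCψ y) (abs_divergence_le (hC y hy)) (norm_nonneg _) hCψ0
    · refine (ContinuousLinearMap.le_opNorm _ _).trans ?_
      exact mul_le_mul (hCψ' y) (hCV y (subset_closure hy)) (norm_nonneg _)
        ((norm_nonneg _).trans (hCψ' y))
  have hAi : Integrable A (volOn Ω) := integrable_volOn_of_continuousOn_of_bounded hΩ hAc hAb
  -- the identity for the truncated test function
  have hn0 : ∀ n : ℕ, ∫ y, cutoff n (g y) * A y ∂(volOn Ω)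
      = - ∫ y, deriv (cutoff n) (g y) * B y ∂(volOn Ω) := by
    intro n
    set f : E3 → ℝ := fun y => cutoff n (g y) * ψ y with hf
    have hf1 : ContDiff ℝ 1 f := ((contDiff_cutoff n).comp hg).mul hψ1
    have hfc : HasCompactSupport f := hψc.mul_left
    -- The cutoff vanishes as soon as g ≥ -1/(n+1), so on the closed support g is at most -1/(n+1),
    -- hence negative.
    have hfs : tsupport f ⊆ Ω := by
      have h1 : tsupport f ⊆ tsupport ψ ∩ {y | g y ≤ -(n + 1 : ℝ)⁻¹} := by
        apply closure_minimal _ ((isClosed_tsupport ψ).inter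
          (isClosed_le hgc continuous_const))
        intro y hy
        refine ⟨subset_tsupport _ fun h0 => hy (by simp [hf, h0]), ?_⟩
        by_contra h0
        exact hy (by simp [hf, cutoff_eq_zero (not_le.1 h0).le])
      intro y hy
      have h2 := h1 hy
      apply (h y (hball (Metric.ball_subset_closedBall (hψs h2.1)))).2
      have h3 : (0 : ℝ) < (n + 1 : ℝ)⁻¹ := by positivity
      have h4 : g y ≤ -(n + 1 : ℝ)⁻¹ := h2.2
      linarith
    have key := integral_divergence_smul_of_tsupport_subset hΩ.isOpen hf1 hfc hfs hV
    -- Product rule: the derivative of the cutoff multiplies only the component of V along ∇g,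
    -- collected in B.
    have heq : ∀ y, f y * divergence V y + fderiv ℝ f y (V y) =
        cutoff n (g y) * A y + deriv (cutoff n) (g y) * B y := by
      intro y
      have hd1 : HasFDerivAt (fun z => cutoff n (g z)) (deriv (cutoff n) (g y) • fderiv ℝ g y) y :=
        (((contDiff_cutoff n).differentiable one_ne_zero (g y)).hasDerivAt).comp_hasFDerivAt y
          (hg.differentiable one_ne_zero y).hasFDerivAt
      have hd2 := (hd1.mul (hψ1.differentiable one_ne_zero y).hasFDerivAt).fderiv
      have hd3 : fderiv ℝ f y = cutoff n (g y) • fderiv ℝ ψ y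
        + ψ y • (deriv (cutoff n) (g y) • fderiv ℝ g y) := hd2
      rw [hd3]
      simp only [hf, hA, hB, _root_.add_apply, _root_.smul_apply,
        smul_eq_mul]
      ring
    simp_rw [heq] at key
    have hc1 : ContinuousOn (fun y => cutoff n (g y) * A y) Ω :=
      ((contDiff_cutoff n).continuous.comp hgc).continuousOn.mul hAc
    have hc2 : ContinuousOn (fun y => deriv (cutoff n) (g y) * B y) Ω :=
      (((contDiff_cutoff n).continuous_deriv le_rfl).comp hgc).continuousOn.mul hBc
    have hi1 : Integrable (fun y => cutoff n (g y) * A y) (volOn Ω) := by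
      refine integrable_volOn_of_continuousOn_of_bounded hΩ hc1
        (C := Cψ * (3 * C) + Cψ' * CV) fun y hy => ?_
      rw [norm_mul]
      calc _ ≤ 1 * ‖A y‖ := by gcongr; exact abs_cutoff_le _ _
        _ ≤ _ := by rw [one_mul]; exact hAb y hy
    have hi := integrable_divergence_smul hΩ hVc hV hC hf1 hfc
    have hi2 : Integrable (fun y => deriv (cutoff n) (g y) * B y) (volOn Ω) := by
      simp_rw [heq] at hi
      exact (hi.sub hi1).congr (Eventually.of_forall fun y => add_sub_cancel_left _ _)
    rw [integral_add hi1 hi2] at key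
    linarith
  -- limits
  have hlim1 : Tendsto (fun n : ℕ => ∫ y, cutoff n (g y) * A y ∂(volOn Ω)) atTop
      (𝓝 (∫ y, A y ∂(volOn Ω))) := by
    apply tendsto_integral_of_dominated_convergence (fun _ => Cψ * (3 * C) + Cψ' * CV)
    · intro n
      exact (((contDiff_cutoff n).continuous.comp hgc).continuousOn.mul hAc).aestronglyMeasurable
        hΩm
    · exact integrable_const _
    · intro n
      filter_upwards [ae_restrict_mem hΩm] with y hy
      rw [norm_mul]
      calc _ ≤ 1 * ‖A y‖ := by gcongr; exact abs_cutoff_le _ _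
        _ ≤ _ := by rw [one_mul]; exact hAb y hy
    · filter_upwards [ae_restrict_mem hΩm] with y hy
      by_cases hyb : y ∈ Metric.closedBall x (r / 2)
      · have hgy : g y < 0 := (h y (hball hyb)).1 hy
        have ht : Tendsto (fun n : ℕ => -(2 / ((n : ℝ) + 1))) atTop (𝓝 0) := by
          have := (tendsto_one_div_add_atTop_nhds_zero_nat (𝕜 := ℝ)).const_mul (-2)
          simpa [div_eq_mul_inv] using this
        apply tendsto_const_nhds.congr'
        filter_upwards [ht.eventually (lt_mem_nhds hgy)] with n hn
        rw [cutoff_eq_one hn.le, one_mul]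
      · have h1 : y ∉ tsupport ψ := fun h' => hyb (Metric.ball_subset_closedBall (hψs h'))
        have h2 : fderiv ℝ ψ y = 0 := image_eq_zero_of_notMem_tsupport (f := fderiv ℝ ψ)
          fun h' => h1 (tsupport_fderiv_subset ℝ h')
        have : A y = 0 := by simp [hA, hψ0 y hyb, h2]
        simp [this]
  -- The derivative of the cutoff is O(n), but it lives on a strip of volume O(1/n), where the
  -- component of V along ∇g is uniformly small because it vanishes on the boundary. The product of
  -- the three factors tends to 0.
  have hlim2 : Tendsto (fun n : ℕ => ∫ y, deriv (cutoff n) (g y) * B y ∂(volOn Ω)) atTop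
      (𝓝 0) := by
    set C₀ := (volume (Metric.closedBall x (r / 2 + 2))).toReal
    rw [Metric.tendsto_atTop]
    intro κ hκ
    -- Chosen so that the final bound Cs · Cψ · C₀ · δ is strictly below κ, even when one of the
    -- constants is 0.
    set δ := κ / (Cs * Cψ * C₀ + 1) with hδ
    have hden : 0 < Cs * Cψ * C₀ + 1 := by positivity
    have hδ0 : 0 < δ := by positivity
    -- the normal component is small in thin strips
    obtain ⟨m, hm, hsmall⟩ : ∃ m < 0, ∀ y ∈ Ω ∩ Metric.closedBall x (r / 2), m < g y →
        |fderiv ℝ g y (V y)| ≤ δ := by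
      -- K is the compact set where the component along ∇g is at least δ. Tangency keeps it off the
      -- boundary, so g has a negative maximum on K; any point of Ω in the ball where g exceeds this
      -- maximum is outside K.
      set K : Set E3 := (closure Ω ∩ Metric.closedBall x (r / 2)) ∩
        (fun y => |fderiv ℝ g y (V y)|) ⁻¹' Ici δ
      have hcl : IsClosed (closure Ω ∩ Metric.closedBall x (r / 2)) :=
        isClosed_closure.inter Metric.isClosed_closedBall
      have hKc : IsCompact K := by
        apply hΩ.isCompact_closure.of_isClosed_subset _
          (inter_subset_left.trans inter_subset_left)
        apply ContinuousOn.preimage_isClosed_of_isClosed _ hcl isClosed_Ici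
        exact ((hg'.continuousOn.clm_apply hVc).mono inter_subset_left).abs
      have hKneg : ∀ y ∈ K, g y < 0 := by
        rintro y ⟨⟨hy1, hy2⟩, hy3⟩
        apply (h y (hball hy2)).1
        by_contra hyΩ
        have hyf : y ∈ frontier Ω := by rw [hΩ.isOpen.frontier_eq]; exact ⟨hy1, hyΩ⟩
        have := fderiv_apply_eq_zero_of_tangent hVt hg h hyf (hball hy2)
        simp only [mem_preimage, this, abs_zero, mem_Ici] at hy3
        linarith
      rcases K.eq_empty_or_nonempty with hKe | hKne
      · refine ⟨-1, by norm_num, fun y hy _ => ?_⟩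
        by_contra hlt
        have : y ∈ K := ⟨⟨subset_closure hy.1, hy.2⟩, (not_le.1 hlt).le⟩
        simp [hKe] at this
      · obtain ⟨z, hz, hmax⟩ := hKc.exists_isMaxOn hKne hgc.continuousOn
        refine ⟨g z, hKneg z hz, fun y hy hlt => ?_⟩
        by_contra hlt'
        have : y ∈ K := ⟨⟨subset_closure hy.1, hy.2⟩, (not_le.1 hlt').le⟩
        exact absurd (hmax this) (not_le.2 hlt)
    have ht : Tendsto (fun n : ℕ => -(2 / ((n : ℝ) + 1))) atTop (𝓝 0) := by
      have := (tendsto_one_div_add_atTop_nhds_zero_nat (𝕜 := ℝ)).const_mul (-2)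
      simpa [div_eq_mul_inv] using this
    obtain ⟨N, hN⟩ := (ht.eventually (lt_mem_nhds hm)).exists_forall_of_atTop
    refine ⟨N, fun n hn => ?_⟩
    rw [dist_zero_right]
    have hn1 : (0 : ℝ) < n + 1 := by positivity
    set S := Metric.closedBall x (r / 2) ∩ {y | -(2 / (n + 1 : ℝ)) ≤ g y ∧ g y < 0}
    have hS : MeasurableSet S := Metric.isClosed_closedBall.measurableSet.inter
      ((measurableSet_le measurable_const hgc.measurable).inter
        (measurableSet_lt hgc.measurable measurable_const))
    have hSfin : volume S ≠ ⊤ :=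
      ((measure_mono inter_subset_left).trans_lt measure_closedBall_lt_top).ne
    have hpt : ∀ y ∈ Ω, ‖deriv (cutoff n) (g y) * B y‖ ≤
        S.indicator (fun _ => Cs * (n + 1) * (Cψ * δ)) y := by
      intro y hy
      by_cases hyb : y ∈ Metric.closedBall x (r / 2)
      · have hgy : g y < 0 := (h y (hball hyb)).1 hy
        by_cases hgn : -(2 / (n + 1 : ℝ)) ≤ g y
        · rw [indicator_of_mem (show y ∈ S from ⟨hyb, hgn, hgy⟩), norm_mul]
          have h1 : ‖deriv (cutoff n) (g y)‖ ≤ Cs * (n + 1) := by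
            rw [(hasDerivAt_cutoff n (g y)).deriv, norm_mul, norm_neg, Real.norm_of_nonneg hn1.le]
            gcongr
            exact hCs _
          have h2 : ‖B y‖ ≤ Cψ * δ := by
            rw [hB, norm_mul]
            exact mul_le_mul (hCψ y) (hsmall y ⟨hy, hyb⟩ ((hN n hn).trans_le hgn))
              (norm_nonneg _) hCψ0
          exact mul_le_mul h1 h2 (norm_nonneg _) (by positivity)
        · rw [deriv_cutoff_eq_zero (not_le.1 hgn), zero_mul, norm_zero]
          exact indicator_nonneg (fun _ _ => by positivity) _
      · have : B y = 0 := by simp [hB, hψ0 y hyb]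
        rw [this, mul_zero, norm_zero]
        exact indicator_nonneg (fun _ _ => by positivity) _
    have hvol : (n + 1 : ℝ) * (volume S).toReal ≤ C₀ := by
      have h1 := volume_strip_le ha hζ x (r / 2) n
      have h2 := ENNReal.toReal_mono measure_closedBall_lt_top.ne h1
      rw [ENNReal.toReal_mul] at h2
      have h3 : ((n : ℝ≥0∞) + 1).toReal = n + 1 := by
        rw [ENNReal.toReal_add (by simp) (by simp)]; simp
      rwa [h3] at h2
    calc ‖∫ y, deriv (cutoff n) (g y) * B y ∂(volOn Ω)‖
        ≤ ∫ y, S.indicator (fun _ => Cs * (n + 1) * (Cψ * δ)) y ∂(volOn Ω) := by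
          apply norm_integral_le_of_norm_le ((integrable_const _).indicator hS)
          filter_upwards [ae_restrict_mem hΩm] with y hy using hpt y hy
      _ = ((volOn Ω) S).toReal * (Cs * (n + 1) * (Cψ * δ)) := by
          rw [integral_indicator hS, setIntegral_const, smul_eq_mul]; rfl
      _ ≤ (volume S).toReal * (Cs * (n + 1) * (Cψ * δ)) := by
          refine mul_le_mul_of_nonneg_right ?_ (by positivity)
          exact ENNReal.toReal_mono hSfin (Measure.restrict_apply_le _ _)
      _ = Cs * Cψ * ((n + 1) * (volume S).toReal) * δ := by ring
      _ ≤ Cs * Cψ * C₀ * δ := by gcongr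
      _ < κ := by
        rw [hδ, mul_div_assoc', div_lt_iff₀ hden]; nlinarith
  have hlim3 := hlim2.neg
  rw [neg_zero] at hlim3
  simp_rw [hn0] at hlim1
  exact tendsto_nhds_unique hlim1 hlim3

open scoped Manifold in
/-- The divergence theorem for fields tangent to the boundary of a bounded `C¹` domain. -/
theorem integral_divergence_eq_zero_of_tangent {Ω : Set E3} (hΩ : IsBoundedRegularDomain Ω)
    {V : E3 → E3} (hVc : ContinuousOn V (closure Ω)) (hV : ContDiffOn ℝ 1 V Ω) {C : ℝ}
    (hC : ∀ x ∈ Ω, ‖fderiv ℝ V x‖ ≤ C) (hVt : TangentToBoundary Ω V) :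
    ∫ x, divergence V x ∂(volOn Ω) = 0 := by
  have hloc : ∀ x ∈ closure Ω, ∃ ρ > 0, ∀ ψ : E3 → ℝ, ContDiff ℝ ∞ ψ → HasCompactSupport ψ →
      tsupport ψ ⊆ Metric.ball x ρ →
      ∫ y, (ψ y * divergence V y + fderiv ℝ ψ y (V y)) ∂(volOn Ω) = 0 := by
    intro x hx
    by_cases hxΩ : x ∈ Ω
    · obtain ⟨ρ, hρ, hsub⟩ := Metric.isOpen_iff.1 hΩ.isOpen x hxΩ
      exact ⟨ρ, hρ, fun ψ hψ hψc hψs => integral_divergence_smul_of_tsupport_subset hΩ.isOpen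
        (hψ.of_le (by simp)) hψc (hψs.trans hsub) hV⟩
    · exact integral_divergence_smul_of_boundary hΩ hVc hV hC hVt
        (by rw [hΩ.isOpen.frontier_eq]; exact ⟨hx, hxΩ⟩)
  choose! ρ hρ hloc using hloc
  obtain ⟨t, htc, htcov⟩ := hΩ.isCompact_closure.elim_nhds_subcover
    (fun x => Metric.ball x (ρ x)) fun x hx => Metric.ball_mem_nhds x (hρ x hx)
  obtain ⟨f, hf⟩ := SmoothPartitionOfUnity.exists_isSubordinate 𝓘(ℝ, E3)
    (isClosed_closure (s := Ω)) (fun x : t => Metric.ball (x : E3) (ρ x))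
    (fun _ => Metric.isOpen_ball) (by simpa [iUnion_subtype] using htcov)
  have hfd : ∀ i, ContDiff ℝ ∞ (f i) := fun i => (f i).contMDiff.contDiff
  have hfc : ∀ i, HasCompactSupport (f i) := fun i => by
    apply HasCompactSupport.of_support_subset_isCompact
      (isCompact_closedBall (i : E3) (ρ i))
    exact (subset_tsupport _).trans ((hf i).trans Metric.ball_subset_closedBall)
  have hsum : ∀ x ∈ closure Ω, ∑ i, f i x = 1 := fun x hx => by
    rw [← finsum_eq_sum_of_fintype]; exact f.sum_eq_one hx
  -- The weights sum to 1 near x, so their gradients cancel; div V is thus the sum of the localized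
  -- integrands, each of integral zero.
  have hsum' : ∀ x ∈ Ω, ∑ i, fderiv ℝ (f i) x = 0 := by
    intro x hx
    have h1 : (fun y => ∑ i, f i y) =ᶠ[𝓝 x] fun _ => 1 := by
      filter_upwards [hΩ.isOpen.mem_nhds hx] with y hy using hsum y (subset_closure hy)
    have h2 := h1.fderiv_eq (𝕜 := ℝ)
    rw [fderiv_fun_sum fun i _ => (hfd i).differentiable (by simp) x] at h2
    simpa using h2
  have hint : ∀ i, Integrable (fun y => f i y * divergence V y + fderiv ℝ (f i) y (V y))
      (volOn Ω) := by
    exact fun i => integrable_divergence_smul hΩ hVc hV hC ((hfd i).of_le (by simp)) (hfc i)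
  calc ∫ x, divergence V x ∂(volOn Ω)
      = ∫ x, ∑ i, (f i x * divergence V x + fderiv ℝ (f i) x (V x)) ∂(volOn Ω) := by
        apply integral_congr_ae
        filter_upwards [ae_restrict_mem hΩ.isOpen.measurableSet] with x hx
        have h1 := congrArg (fun L : E3 →L[ℝ] ℝ => L (V x)) (hsum' x hx)
        simp only [_root_.sum_apply, _root_.zero_apply] at h1
        rw [Finset.sum_add_distrib, ← Finset.sum_mul, hsum x (subset_closure hx), h1]
        ring
    _ = ∑ i, ∫ x, (f i x * divergence V x + fderiv ℝ (f i) x (V x)) ∂(volOn Ω) :=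
        integral_finsetSum Finset.univ (f := fun (i : t) x =>
          f i x * divergence V x + fderiv ℝ (f i) x (V x)) fun i _ => hint i
    _ = 0 := Finset.sum_eq_zero fun i _ => hloc i (htc i i.2) (f i) (hfd i) (hfc i) (hf i)

end

section

/-! ### Functions that are smooth up to the boundary -/

namespace SmoothUpToBoundary

variable {F : Type*} [NormedAddCommGroup F] [NormedSpace ℝ F] {Ω : Set E3} {T : ℝ}
  {φ : ℝ → E3 → F}

lemma continuousOn (hφ : SmoothUpToBoundary Ω T φ) :
    ContinuousOn (fun z : ℝ × E3 => φ z.1 z.2) (Icc 0 T ×ˢ closure Ω) :=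
  ContDiffOn.continuousOn hφ

lemma contDiffOn_interior (hφ : SmoothUpToBoundary Ω T φ) :
    ContDiffOn ℝ ∞ (fun z : ℝ × E3 => φ z.1 z.2) (Ioo 0 T ×ˢ Ω) :=
  ContDiffOn.mono hφ (prod_mono Ioo_subset_Icc_self subset_closure)

lemma exists_norm_le (hφ : SmoothUpToBoundary Ω T φ) (hΩ : IsBoundedRegularDomain Ω) :
    ∃ C, 0 ≤ C ∧ ∀ t ∈ Icc 0 T, ∀ x ∈ closure Ω, ‖φ t x‖ ≤ C := by
  obtain ⟨C, hC⟩ := (isCompact_Icc.prod hΩ.isCompact_closure).exists_bound_of_continuousOn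
    hφ.continuousOn
  exact ⟨max C 0, le_max_right _ _, fun t ht x hx => (hC (t, x) ⟨ht, hx⟩).trans (le_max_left _ _)⟩

/-- Smoothness on the closed cylinder K supplies, near each of its points, a derivative within K
that is continuous at that point, hence locally bounded. At interior points it is the true
derivative, and compactness of K makes the bound uniform up to the boundary. -/
lemma exists_norm_fderiv_le (hφ : SmoothUpToBoundary Ω T φ) (hΩ : IsBoundedRegularDomain Ω) :
    ∃ C, 0 ≤ C ∧ ∀ z ∈ Ioo 0 T ×ˢ Ω, ‖fderiv ℝ (fun z : ℝ × E3 => φ z.1 z.2) z‖ ≤ C := by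
  set f : ℝ × E3 → F := fun z => φ z.1 z.2
  set K : Set (ℝ × E3) := Icc 0 T ×ˢ closure Ω
  have hO : IsOpen (Ioo 0 T ×ˢ Ω) := isOpen_Ioo.prod hΩ.isOpen
  have hOK : Ioo 0 T ×ˢ Ω ⊆ K := prod_mono Ioo_subset_Icc_self subset_closure
  have hloc : ∀ z ∈ K, ∃ C, ∃ W ∈ 𝓝[K] z, ∀ y ∈ W ∩ (Ioo 0 T ×ˢ Ω), ‖fderiv ℝ f y‖ ≤ C := by
    intro z hz
    have h1 : ContDiffWithinAt ℝ (0 + 1) f K z := (hφ z hz).of_le (by simp)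
    obtain ⟨u, hu, -, -, f', hf', hf'c⟩ :=
      (contDiffWithinAt_succ_iff_hasFDerivWithinAt' (by simp)).1 h1
    rw [insert_eq_of_mem hz] at hu
    have h2 : ∀ᶠ y in 𝓝[K] z, ‖f' y‖ < ‖f' z‖ + 1 :=
      hf'c.continuousWithinAt.norm.eventually (gt_mem_nhds (lt_add_one _))
    refine ⟨‖f' z‖ + 1, u ∩ {y | ‖f' y‖ < ‖f' z‖ + 1}, inter_mem hu h2, ?_⟩
    rintro y ⟨⟨hyu, hy⟩, hyO⟩
    have h3 : HasFDerivAt f (f' y) y :=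
      (hf' y hyu).hasFDerivAt (mem_of_superset (hO.mem_nhds hyO) hOK)
    rw [h3.fderiv]
    exact le_of_lt hy
  have hK : IsCompact K := isCompact_Icc.prod hΩ.isCompact_closure
  have := hK.induction_on (p := fun s => ∃ C, ∀ y ∈ s ∩ (Ioo 0 T ×ˢ Ω), ‖fderiv ℝ f y‖ ≤ C)
    ⟨0, by simp⟩
    (fun s t hst ⟨C, hC⟩ => ⟨C, fun y hy => hC y ⟨hst hy.1, hy.2⟩⟩)
    (fun s t ⟨C, hC⟩ ⟨D, hD⟩ => ⟨max C D, fun y hy => hy.1.elim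
      (fun h => (hC y ⟨h, hy.2⟩).trans (le_max_left _ _))
      (fun h => (hD y ⟨h, hy.2⟩).trans (le_max_right _ _))⟩)
    (fun z hz => let ⟨C, W, hW, h⟩ := hloc z hz; ⟨W, hW, C, h⟩)
  obtain ⟨C, hC⟩ := this
  exact ⟨max C 0, le_max_right _ _,
    fun z hz => (hC z ⟨hOK hz, hz⟩).trans (le_max_left _ _)⟩

lemma hasFDerivAt (hφ : SmoothUpToBoundary Ω T φ) (hΩ : IsOpen Ω) {t : ℝ} (ht : t ∈ Ioo 0 T)
    {x : E3} (hx : x ∈ Ω) : HasFDerivAt (fun z : ℝ × E3 => φ z.1 z.2)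
      (fderiv ℝ (fun z : ℝ × E3 => φ z.1 z.2) (t, x)) (t, x) :=
  ((hφ.contDiffOn_interior.differentiableOn (by simp)).differentiableAt
    ((isOpen_Ioo.prod hΩ).mem_nhds ⟨ht, hx⟩)).hasFDerivAt

lemma hasDerivAt_time' (hφ : SmoothUpToBoundary Ω T φ) (hΩ : IsOpen Ω) {t : ℝ}
    (ht : t ∈ Ioo 0 T) {x : E3} (hx : x ∈ Ω) : HasDerivAt (fun s => φ s x)
      (fderiv ℝ (fun z : ℝ × E3 => φ z.1 z.2) (t, x) (1, 0)) t :=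
  HasFDerivAt.comp_hasDerivAt (f := fun s => (s, x)) t (hφ.hasFDerivAt hΩ ht hx)
    ((hasDerivAt_id t).prodMk (hasDerivAt_const t x))

lemma hasFDerivAt_space' (hφ : SmoothUpToBoundary Ω T φ) (hΩ : IsOpen Ω) {t : ℝ}
    (ht : t ∈ Ioo 0 T) {x : E3} (hx : x ∈ Ω) : HasFDerivAt (φ t)
      ((fderiv ℝ (fun z : ℝ × E3 => φ z.1 z.2) (t, x)).comp (ContinuousLinearMap.inr ℝ ℝ E3)) x :=
  HasFDerivAt.comp (f := fun y => (t, y)) x (hφ.hasFDerivAt hΩ ht hx) (hasFDerivAt_prodMk_right t x)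

lemma hasDerivAt_time (hφ : SmoothUpToBoundary Ω T φ) (hΩ : IsOpen Ω) {t : ℝ}
    (ht : t ∈ Ioo 0 T) {x : E3} (hx : x ∈ Ω) :
    HasDerivAt (fun s => φ s x) (deriv (fun s => φ s x) t) t :=
  (hφ.hasDerivAt_time' hΩ ht hx).differentiableAt.hasDerivAt

lemma hasFDerivAt_space (hφ : SmoothUpToBoundary Ω T φ) (hΩ : IsOpen Ω) {t : ℝ}
    (ht : t ∈ Ioo 0 T) {x : E3} (hx : x ∈ Ω) : HasFDerivAt (φ t) (fderiv ℝ (φ t) x) x :=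
  (hφ.hasFDerivAt_space' hΩ ht hx).differentiableAt.hasFDerivAt

lemma exists_norm_deriv_le (hφ : SmoothUpToBoundary Ω T φ) (hΩ : IsBoundedRegularDomain Ω) :
    ∃ C, 0 ≤ C ∧ ∀ t ∈ Ioo 0 T, ∀ x ∈ Ω,
      ‖deriv (fun s => φ s x) t‖ ≤ C ∧ ‖fderiv ℝ (φ t) x‖ ≤ C := by
  obtain ⟨C, hC0, hC⟩ := hφ.exists_norm_fderiv_le hΩ
  refine ⟨C, hC0, fun t ht x hx => ⟨?_, ?_⟩⟩
  · rw [(hφ.hasDerivAt_time' hΩ.isOpen ht hx).deriv]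
    refine (ContinuousLinearMap.le_opNorm _ _).trans ?_
    have : ‖((1 : ℝ), (0 : E3))‖ = 1 := by simp [Prod.norm_def]
    rw [this, mul_one]
    exact hC _ ⟨ht, hx⟩
  · rw [(hφ.hasFDerivAt_space' hΩ.isOpen ht hx).fderiv]
    refine ContinuousLinearMap.opNorm_le_bound _ hC0 fun v => ?_
    rw [ContinuousLinearMap.comp_apply]
    refine (ContinuousLinearMap.le_opNorm _ _).trans ?_
    have : ‖ContinuousLinearMap.inr ℝ ℝ E3 v‖ = ‖v‖ := by simp [Prod.norm_def]
    rw [this]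
    gcongr
    exact hC _ ⟨ht, hx⟩

lemma continuousOn_fderiv (hφ : SmoothUpToBoundary Ω T φ) (hΩ : IsOpen Ω) :
    ContinuousOn (fderiv ℝ (fun z : ℝ × E3 => φ z.1 z.2)) (Ioo 0 T ×ˢ Ω) :=
  hφ.contDiffOn_interior.continuousOn_fderiv_of_isOpen (isOpen_Ioo.prod hΩ) (by simp)

lemma continuousOn_deriv_time (hφ : SmoothUpToBoundary Ω T φ) (hΩ : IsOpen Ω) :
    ContinuousOn (fun z : ℝ × E3 => deriv (fun s => φ s z.2) z.1) (Ioo 0 T ×ˢ Ω) :=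
  ((hφ.continuousOn_fderiv hΩ).clm_apply continuousOn_const).congr
    fun _ hz => (hφ.hasDerivAt_time' hΩ hz.1 hz.2).deriv

lemma continuousOn_fderiv_space (hφ : SmoothUpToBoundary Ω T φ) (hΩ : IsOpen Ω) :
    ContinuousOn (fun z : ℝ × E3 => fderiv ℝ (φ z.1) z.2) (Ioo 0 T ×ˢ Ω) :=
  ((hφ.continuousOn_fderiv hΩ).clm_comp continuousOn_const).congr
    fun _ hz => (hφ.hasFDerivAt_space' hΩ hz.1 hz.2).fderiv

lemma continuousOn_slice (hφ : SmoothUpToBoundary Ω T φ) {t : ℝ} (ht : t ∈ Icc 0 T) :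
    ContinuousOn (φ t) (closure Ω) :=
  hφ.continuousOn.comp (f := fun x => (t, x)) (by fun_prop) fun _ hx => ⟨ht, hx⟩

lemma contDiffOn_slice (hφ : SmoothUpToBoundary Ω T φ) {t : ℝ} (ht : t ∈ Icc 0 T) :
    ContDiffOn ℝ 1 (φ t) Ω := by
  have h : ContDiffOn ℝ 1 (fun z : ℝ × E3 => φ z.1 z.2) (Icc 0 T ×ˢ closure Ω) :=
    ContDiffOn.of_le hφ (by simp)
  exact h.comp (f := fun x => (t, x)) (by fun_prop) fun _ hx => ⟨ht, subset_closure hx⟩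

lemma time_smul (hφ : SmoothUpToBoundary Ω T φ) {θ : ℝ → ℝ} (hθ : ContDiff ℝ ∞ θ) :
    SmoothUpToBoundary Ω T fun t x => θ t • φ t x :=
  ContDiffOn.smul (hθ.comp contDiff_fst).contDiffOn hφ

end SmoothUpToBoundary

lemma volOn_prod_eq (Ω : Set E3) (T : ℝ) :
    (timeMeasure T).prod (volOn Ω) = volume.restrict (Ioo 0 T ×ˢ Ω) := by
  rw [timeMeasure, volOn, Measure.prod_restrict]; rfl

lemma aestronglyMeasurable_of_continuousOn {Ω : Set E3} (hΩ : IsOpen Ω) {T : ℝ} {F : Type*}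
    [NormedAddCommGroup F] [SecondCountableTopology F] {f : ℝ × E3 → F}
    (hf : ContinuousOn f (Ioo 0 T ×ˢ Ω)) :
    AEStronglyMeasurable f ((timeMeasure T).prod (volOn Ω)) := by
  rw [volOn_prod_eq]
  exact hf.aestronglyMeasurable (isOpen_Ioo.prod hΩ).measurableSet

lemma ae_prod_mem {Ω : Set E3} (hΩ : IsOpen Ω) (T : ℝ) :
    ∀ᵐ z ∂((timeMeasure T).prod (volOn Ω)), z ∈ Ioo 0 T ×ˢ Ω := by
  rw [volOn_prod_eq]
  exact ae_restrict_mem (isOpen_Ioo.prod hΩ).measurableSet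

/-! ### Pointwise identities for the Euler system -/

lemma contraction_tensorSquare_jacobian (v : E3) (V : E3 → E3) (x : E3) :
    contraction (tensorSquare v) (jacobian V x) = ⟪v, fderiv ℝ V x v⟫ := by
  have h : fderiv ℝ V x v = ∑ j, v j • fderiv ℝ V x (e j) := by
    conv_lhs => rw [← sum_smul_e v]
    simp
  rw [h]
  simp [contraction, tensorSquare, jacobian, PiLp.inner_apply, Fin.sum_univ_three]
  ring

namespace IsSmoothEulerSolution

variable {Ω : Set E3} {T γ : ℝ} {ρE₀ : E3 → ℝ} {uE₀ : E3 → E3} {r : ℝ → E3 → ℝ}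
  {U : ℝ → E3 → E3}

/-- The interior bounds extend to the closed cylinder by continuity. The upper bound is replaced by
its maximum with 1 only to have it positive. -/
lemma exists_density_bounds (hE : IsSmoothEulerSolution Ω T γ ρE₀ uE₀ r U) (hT : 0 < T) :
    ∃ a b : ℝ, 0 < a ∧ 0 < b ∧ ∀ t ∈ Icc 0 T, ∀ x ∈ closure Ω, a ≤ r t x ∧ r t x ≤ b := by
  obtain ⟨a, b, ha, hab⟩ := hE.bounds
  have hcl : closure (Ioo 0 T ×ˢ Ω) = Icc 0 T ×ˢ closure Ω := by
    rw [closure_prod_eq, closure_Ioo hT.ne]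
  have hc := hE.smooth_density.continuousOn
  rw [← hcl] at hc
  refine ⟨a, max b 1, ha, by positivity, fun t ht x hx => ?_⟩
  have hm : (t, x) ∈ closure (Ioo 0 T ×ˢ Ω) := by rw [hcl]; exact ⟨ht, hx⟩
  exact ⟨le_on_closure (fun z hz => (hab z.1 hz.1 z.2 hz.2).1) continuousOn_const hc hm,
    (le_on_closure (fun z hz => (hab z.1 hz.1 z.2 hz.2).2) hc continuousOn_const hm).trans
      (le_max_left _ _)⟩

lemma density_pos (hE : IsSmoothEulerSolution Ω T γ ρE₀ uE₀ r U) (hT : 0 < T) {t : ℝ}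
    (ht : t ∈ Icc 0 T) {x : E3} (hx : x ∈ closure Ω) : 0 < r t x := by
  obtain ⟨a, b, ha, -, h⟩ := hE.exists_density_bounds hT
  exact ha.trans_le (h t ht x hx).1

lemma smooth_rpow (hE : IsSmoothEulerSolution Ω T γ ρE₀ uE₀ r U) (hT : 0 < T) (q : ℝ) :
    SmoothUpToBoundary Ω T fun t x => r t x ^ q :=
  ContDiffOn.rpow_const_of_ne hE.smooth_density fun _ hz => (hE.density_pos hT hz.1 hz.2).ne'

lemma deriv_density (hE : IsSmoothEulerSolution Ω T γ ρE₀ uE₀ r U) (hΩ : IsOpen Ω)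
    {t : ℝ} (ht : t ∈ Ioo 0 T) {x : E3} (hx : x ∈ Ω) :
    deriv (fun s => r s x) t =
      -(fderiv ℝ (r t) x (U t x)) - r t x * divergence (U t) x := by
  have h := hE.mass_equation t ht x hx
  have h1 := (hE.smooth_density.hasFDerivAt_space hΩ ht hx).smul
    (hE.smooth_velocity.hasFDerivAt_space hΩ ht hx)
  have h2 : divergence (fun y => r t y • U t y) x =
      fderiv ℝ (r t) x (U t x) + r t x * divergence (U t) x := by
    rw [divergence_eq, divergence_eq, map_eq_sum_e, Finset.mul_sum, ← Finset.sum_add_distrib]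
    refine Finset.sum_congr rfl fun i _ => ?_
    have h3 : fderiv ℝ (fun y => r t y • U t y) x = _ := h1.fderiv
    rw [h3]
    simp
    ring
  rw [h2] at h
  linarith

/-- Subtracting U times the mass equation from the momentum equation and dividing by the positive
density gives ∂ₜU + (U·∇)U = -γ r^(γ-2) ∇r, here paired with v. -/
lemma inner_deriv_velocity (hE : IsSmoothEulerSolution Ω T γ ρE₀ uE₀ r U) (hΩ : IsOpen Ω)
    (hT : 0 < T) {t : ℝ} (ht : t ∈ Ioo 0 T) {x : E3} (hx : x ∈ Ω) (v : E3) :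
    ⟪deriv (fun s => U s x) t, v⟫ + ⟪fderiv ℝ (U t) x (U t x), v⟫ =
      -(γ * r t x ^ (γ - 2) * fderiv ℝ (r t) x v) := by
  have hr := hE.density_pos hT (Ioo_subset_Icc_self ht) (subset_closure hx)
  have h := hE.momentum_equation t ht x hx
  have hm := hE.deriv_density hΩ ht hx
  have dr := hE.smooth_density.hasFDerivAt_space hΩ ht hx
  have dU := hE.smooth_velocity.hasFDerivAt_space hΩ ht hx
  have h1 : deriv (fun s => r s x • U s x) t = r t x • deriv (fun s => U s x) t
      + deriv (fun s => r s x) t • U t x :=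
    ((hE.smooth_density.hasDerivAt_time hΩ ht hx).smul
      (hE.smooth_velocity.hasDerivAt_time hΩ ht hx)).deriv
  have h2 : ∑ j, fderiv ℝ (fun y => (r t y * U t y j) • U t y) x (e j) =
      r t x • fderiv ℝ (U t) x (U t x)
        + (fderiv ℝ (r t) x (U t x) + r t x * divergence (U t) x) • U t x := by
    have h3 : ∀ j, fderiv ℝ (fun y => (r t y * U t y j) • U t y) x (e j) =
        r t x • (U t x j • fderiv ℝ (U t) x (e j)) +
          (fderiv ℝ (r t) x (e j) * U t x j + r t x * fderiv ℝ (U t) x (e j) j) • U t x := by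
      intro j
      have dj : HasFDerivAt (fun y => U t y j) ((coord j).comp (fderiv ℝ (U t) x)) x :=
        (coord j).hasFDerivAt.comp x dU
      have h4 : fderiv ℝ (fun y => (r t y * U t y j) • U t y) x = _ := ((dr.mul dj).smul dU).fderiv
      rw [h4]
      simp [coord_apply, mul_smul]
      congr 1
      ring
    simp_rw [h3]
    rw [Finset.sum_add_distrib, ← Finset.smul_sum, ← Finset.sum_smul, Finset.sum_add_distrib,
      ← map_eq_sum_e, ← Finset.mul_sum, ← divergence_eq]
    congr 2
    conv_rhs => rw [← sum_smul_e (U t x)]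
    simp
  have h5 : ⟪∇ (fun y => r t y ^ γ) x, v⟫ = γ * r t x ^ (γ - 1) * fderiv ℝ (r t) x v := by
    rw [gradient, InnerProductSpace.toDual_symm_apply,
      (dr.rpow_const (Or.inl hr.ne')).fderiv]
    simp
  have h6 : r t x ^ (γ - 1) = r t x ^ (γ - 2) * r t x := by
    rw [← Real.rpow_add_one hr.ne']; ring_nf
  have h7 := congrArg (fun w : E3 => ⟪w, v⟫) h
  simp only [h1, h2, hm, inner_add_left, inner_smul_left, h5, h6, inner_zero_left,
    conj_trivial] at h7
  have h8 : r t x * (⟪deriv (fun s => U s x) t, v⟫ + ⟪fderiv ℝ (U t) x (U t x), v⟫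
      + γ * r t x ^ (γ - 2) * fderiv ℝ (r t) x v) = 0 := by linarith
  rcases mul_eq_zero.1 h8 with h9 | h9
  · exact absurd h9 hr.ne'
  · linarith

/-- The test function `|U|² / 2 - H'(r)` of the relative energy method. -/
def massTest (γ : ℝ) (r : ℝ → E3 → ℝ) (U : ℝ → E3 → E3) (t : ℝ) (x : E3) : ℝ :=
  1 / 2 * ‖U t x‖ ^ 2 - γ / (γ - 1) * r t x ^ (γ - 1)

lemma smooth_massTest (hE : IsSmoothEulerSolution Ω T γ ρE₀ uE₀ r U) (hT : 0 < T) :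
    SmoothUpToBoundary Ω T (massTest γ r U) := by
  have h1 : ContDiffOn ℝ ∞ (fun z : ℝ × E3 => ‖U z.1 z.2‖ ^ 2) (Icc 0 T ×ˢ closure Ω) :=
    ContDiffOn.norm_sq ℝ hE.smooth_velocity
  exact (contDiffOn_const.mul h1).sub (contDiffOn_const.mul (hE.smooth_rpow hT (γ - 1)))

/-- The remainder of the relative energy method, at a state `(ρ, u)`. -/
lemma remainder_eq (hE : IsSmoothEulerSolution Ω T γ ρE₀ uE₀ r U) (hΩ : IsOpen Ω)
    (hγ : 1 < γ) (hT : 0 < T) {t : ℝ} (ht : t ∈ Ioo 0 T) {x : E3} (hx : x ∈ Ω) (ρ : ℝ) (u : E3) :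
    -(⟪ρ • u, deriv (fun s => U s x) t⟫
        + ρ * contraction (tensorSquare u) (jacobian (U t) x) + ρ ^ γ * divergence (U t) x)
      + (ρ * deriv (fun s => massTest γ r U s x) t + ρ * ⟪u, ∇ (massTest γ r U t) x⟫)
      + deriv (fun s => r s x ^ γ) t
    = -(ρ * ⟪u - U t x, fderiv ℝ (U t) x (u - U t x)⟫)
      - (γ - 1) * relPotential γ ρ (r t x) * divergence (U t) x
      - divergence (fun y => r t y ^ γ • U t y) x := by
  have hr := hE.density_pos hT (Ioo_subset_Icc_self ht) (subset_closure hx)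
  have hγ1 : γ - 1 ≠ 0 := by linarith
  have dr := hE.smooth_density.hasFDerivAt_space hΩ ht hx
  have dU := hE.smooth_velocity.hasFDerivAt_space hΩ ht hx
  have tr := hE.smooth_density.hasDerivAt_time hΩ ht hx
  have tU := hE.smooth_velocity.hasDerivAt_time hΩ ht hx
  have hm := hE.deriv_density hΩ ht hx
  have hu := hE.inner_deriv_velocity hΩ hT ht hx
  -- k = H''(r), and k r = γ r^(γ-1) is the derivative of the pressure.
  set k := γ * r t x ^ (γ - 2) with hk
  have e1 : γ * r t x ^ (γ - 1) = k * r t x := by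
    have : r t x ^ (γ - 1) = r t x ^ (γ - 2) * r t x := by
      rw [← Real.rpow_add_one hr.ne']; ring_nf
    rw [this, hk]; ring
  have e2 : deriv (fun s => massTest γ r U s x) t =
      ⟪U t x, deriv (fun s => U s x) t⟫ - k * deriv (fun s => r s x) t := by
    have h := ((tU.norm_sq.const_mul (1 / 2)).sub
      ((tr.rpow_const (p := γ - 1) (Or.inl hr.ne')).const_mul (γ / (γ - 1)))).deriv
    have h' : deriv (fun s => massTest γ r U s x) t = _ := h
    rw [h', hk, show γ - 1 - 1 = γ - 2 by ring]
    field_simp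
  have e3 : ⟪u, ∇ (massTest γ r U t) x⟫ =
      ⟪U t x, fderiv ℝ (U t) x u⟫ - k * fderiv ℝ (r t) x u := by
    have h := ((dU.norm_sq.const_mul (1 / 2)).sub
      ((dr.rpow_const (p := γ - 1) (Or.inl hr.ne')).const_mul (γ / (γ - 1)))).fderiv
    have h' : fderiv ℝ (massTest γ r U t) x = _ := h
    rw [real_inner_comm, gradient, InnerProductSpace.toDual_symm_apply, h', hk,
      show γ - 1 - 1 = γ - 2 by ring]
    simp
    field_simp
  have e4 : deriv (fun s => r s x ^ γ) t = k * r t x * deriv (fun s => r s x) t := by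
    rw [(tr.rpow_const (p := γ) (Or.inl hr.ne')).deriv, ← e1]; ring
  have e5 : divergence (fun y => r t y ^ γ • U t y) x =
      k * r t x * fderiv ℝ (r t) x (U t x) + r t x ^ γ * divergence (U t) x := by
    rw [divergence_eq, divergence_eq, map_eq_sum_e, Finset.mul_sum, Finset.mul_sum,
      ← Finset.sum_add_distrib]
    refine Finset.sum_congr rfl fun i _ => ?_
    have h3 : fderiv ℝ (fun y => r t y ^ γ • U t y) x = _ :=
      ((dr.rpow_const (p := γ) (Or.inl hr.ne')).smul dU).fderiv
    rw [h3, ← e1]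
    simp
    ring
  -- For a power law, the relative pressure is γ - 1 times the relative potential.
  have e6 : (γ - 1) * relPotential γ ρ (r t x) =
      ρ ^ γ - k * r t x * (ρ - r t x) - r t x ^ γ := by
    rw [relPotential, ← e1]; field_simp
  have hu1 := hu (U t x)
  have hu2 := hu u
  rw [contraction_tensorSquare_jacobian, e2, e3, e4, e5, e6, hm]
  simp only [inner_sub_left, inner_sub_right, map_sub, inner_smul_left, conj_trivial]
  rw [real_inner_comm, real_inner_comm (U t x)] at hu1
  rw [real_inner_comm, real_inner_comm u] at hu2
  -- The velocity equation is used twice, paired with U and with u, both times weighted by ρ.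
  linear_combination ρ * hu1 - ρ * hu2

end IsSmoothEulerSolution

end

section

lemma _root_.MeasureTheory.Integrable.fun_sub {α : Type*} [MeasurableSpace α] {ν : Measure α}
    {f g : α → ℝ} (hf : Integrable f ν) (hg : Integrable g ν) :
    Integrable (fun x => f x - g x) ν := hf.sub hg

/-! ### States of finite energy -/

/-- A density and a velocity of finite energy, over a measure space. -/
structure IsFiniteEnergyState {α : Type*} [MeasurableSpace α] (ν : Measure α) (γ : ℝ)
    (ρ : α → ℝ) (u : α → E3) : Prop where
  nonneg : ∀ᵐ x ∂ν, 0 ≤ ρ x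
  memLp : MemLp ρ (ENNReal.ofReal γ) ν
  momentum : AEStronglyMeasurable (fun x => ρ x • u x) ν
  kinetic : Integrable (fun x => ρ x * ‖u x‖ ^ 2) ν

namespace IsFiniteEnergyState

variable {α : Type*} [MeasurableSpace α] {ν : Measure α} {γ : ℝ}
  {ρ : α → ℝ} {u : α → E3}

lemma integrable_density [IsFiniteMeasure ν] (h : IsFiniteEnergyState ν γ ρ u) (hγ : 1 < γ) :
    Integrable ρ ν :=
  h.memLp.integrable (by rw [← ENNReal.ofReal_one]; exact ENNReal.ofReal_le_ofReal hγ.le)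

lemma integrable_rpow (h : IsFiniteEnergyState ν γ ρ u) (hγ : 1 < γ) :
    Integrable (fun x => ρ x ^ γ) ν := by
  have h1 := h.memLp.integrable_norm_rpow (by simp; linarith) (by simp)
  rw [ENNReal.toReal_ofReal (by linarith)] at h1
  refine h1.congr ?_
  filter_upwards [h.nonneg] with x hx
  rw [Real.norm_of_nonneg hx]

lemma integrable_momentum [IsFiniteMeasure ν] (h : IsFiniteEnergyState ν γ ρ u) (hγ : 1 < γ) :
    Integrable (fun x => ρ x • u x) ν := by
  refine Integrable.mono' ((h.integrable_density hγ).add h.kinetic) h.momentum ?_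
  filter_upwards [h.nonneg] with x hx
  rw [norm_smul, Real.norm_of_nonneg hx]
  simp only [Pi.add_apply]
  nlinarith [mul_nonneg hx (sq_nonneg (‖u x‖ - 1)), mul_nonneg hx (sq_nonneg (‖u x‖))]

lemma integrable_density_mul [IsFiniteMeasure ν] (h : IsFiniteEnergyState ν γ ρ u)
    (hγ : 1 < γ) {b : α → ℝ}
    (hb : AEStronglyMeasurable b ν) {C : ℝ} (hC : ∀ᵐ x ∂ν, ‖b x‖ ≤ C) :
    Integrable (fun x => ρ x * b x) ν :=
  (h.integrable_density hγ).mul_bdd hb hC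

lemma integrable_rpow_mul (h : IsFiniteEnergyState ν γ ρ u) (hγ : 1 < γ) {b : α → ℝ}
    (hb : AEStronglyMeasurable b ν) {C : ℝ} (hC : ∀ᵐ x ∂ν, ‖b x‖ ≤ C) :
    Integrable (fun x => ρ x ^ γ * b x) ν :=
  (h.integrable_rpow hγ).mul_bdd hb hC

lemma integrable_momentum_inner [IsFiniteMeasure ν] (h : IsFiniteEnergyState ν γ ρ u)
    (hγ : 1 < γ) {b : α → E3}
    (hb : AEStronglyMeasurable b ν) {C : ℝ} (hC : ∀ᵐ x ∂ν, ‖b x‖ ≤ C) :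
    Integrable (fun x => ⟪ρ x • u x, b x⟫) ν := by
  refine Integrable.mono' ((h.integrable_momentum hγ).norm.mul_const C)
    (h.momentum.inner hb) ?_
  filter_upwards [hC] with x hx
  exact (norm_inner_le_norm _ _).trans (by gcongr)

lemma integrable_quadratic (h : IsFiniteEnergyState ν γ ρ u) (hu : AEStronglyMeasurable u ν)
    {L : α → E3 →L[ℝ] E3} (hL : AEStronglyMeasurable L ν) {C : ℝ} (hC : ∀ᵐ x ∂ν, ‖L x‖ ≤ C) :
    Integrable (fun x => ρ x * ⟪u x, L x (u x)⟫) ν := by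
  refine Integrable.mono' (h.kinetic.mul_const C) ?_ ?_
  · exact h.memLp.1.mul (hu.inner
      ((ContinuousLinearMap.id ℝ (E3 →L[ℝ] E3)).aestronglyMeasurable_comp₂ hL hu))
  · filter_upwards [hC, h.nonneg] with x hx hρ
    rw [norm_mul, Real.norm_of_nonneg hρ, mul_assoc]
    gcongr
    refine (norm_inner_le_norm _ _).trans ?_
    have h1 : ‖L x (u x)‖ ≤ C * ‖u x‖ := (ContinuousLinearMap.le_opNorm _ _).trans (by gcongr)
    nlinarith [norm_nonneg (u x)]

end IsFiniteEnergyState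

/-! ### The relative energy -/

/-- The energy of `(ρ, u)` relative to `(r, U)`. -/
def relEnergy (Ω : Set E3) (γ : ℝ) (ρ : E3 → ℝ) (u : E3 → E3) (r : E3 → ℝ) (U : E3 → E3) : ℝ :=
  ∫ x, (1 / 2 * (ρ x * ‖u x - U x‖ ^ 2) + relPotential γ (ρ x) (r x)) ∂(volOn Ω)

/-- This form isolates the energy from terms linear in ρ and ρu, which the weak equations can
evaluate. The last term comes from r H'(r) - H(r) = r^γ. -/
lemma relEnergy_density_eq {γ : ℝ} (hγ : 1 < γ) (ρ : ℝ) (u : E3) {r : ℝ} (hr : 0 < r) (U : E3) :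
    1 / 2 * (ρ * ‖u - U‖ ^ 2) + relPotential γ ρ r =
      1 / 2 * ρ * ‖u‖ ^ 2 + ρ ^ γ / (γ - 1) - ⟪ρ • u, U⟫
        + ρ * (1 / 2 * ‖U‖ ^ 2 - γ / (γ - 1) * r ^ (γ - 1)) + r ^ γ := by
  have h1 : r ^ γ = r ^ (γ - 1) * r := by rw [← Real.rpow_add_one hr.ne']; simp
  have h2 : γ - 1 ≠ 0 := by linarith
  rw [norm_sub_sq_real, inner_smul_left, relPotential, h1]
  simp only [conj_trivial]
  field_simp
  ring

section

variable {Ω : Set E3} {γ : ℝ} {ρ : E3 → ℝ} {u : E3 → E3} {r : E3 → ℝ} {U : E3 → E3}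

lemma integrable_energy (h : IsFiniteEnergyState (volOn Ω) γ ρ u) (hγ : 1 < γ) :
    Integrable (fun x => (1 / 2) * ρ x * ‖u x‖ ^ 2 + ρ x ^ γ / (γ - 1)) (volOn Ω) := by
  have := (h.kinetic.const_mul (1 / 2)).fun_add ((h.integrable_rpow hγ).div_const (γ - 1))
  simpa only [mul_assoc] using this

lemma exists_norm_le_of_continuousOn {F : Type*} [NormedAddCommGroup F]
    (hΩ : IsBoundedRegularDomain Ω) {f : E3 → F} (hf : ContinuousOn f (closure Ω)) :
    ∃ C, ∀ᵐ x ∂(volOn Ω), ‖f x‖ ≤ C := by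
  obtain ⟨C, hC⟩ := hΩ.isCompact_closure.exists_bound_of_continuousOn hf
  refine ⟨C, ?_⟩
  filter_upwards [ae_restrict_mem hΩ.isOpen.measurableSet] with x hx using hC x (subset_closure hx)

lemma aestronglyMeasurable_volOn {F : Type*} [NormedAddCommGroup F] [SecondCountableTopology F]
    (hΩ : IsBoundedRegularDomain Ω) {f : E3 → F} (hf : ContinuousOn f (closure Ω)) :
    AEStronglyMeasurable f (volOn Ω) :=
  (hf.mono subset_closure).aestronglyMeasurable hΩ.isOpen.measurableSet

lemma integrable_volOn_of_continuousOn {F : Type*} [NormedAddCommGroup F]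
    (hΩ : IsBoundedRegularDomain Ω) {f : E3 → F} (hf : ContinuousOn f (closure Ω)) :
    Integrable f (volOn Ω) := by
  obtain ⟨C, hC⟩ := hΩ.isCompact_closure.exists_bound_of_continuousOn hf
  exact integrable_volOn_of_continuousOn_of_bounded hΩ (hf.mono subset_closure)
    fun x hx => hC x (subset_closure hx)

lemma continuousOn_massTest (hr : ContinuousOn r (closure Ω)) (hr0 : ∀ x ∈ closure Ω, 0 < r x)
    (hU : ContinuousOn U (closure Ω)) :
    ContinuousOn (fun x => 1 / 2 * ‖U x‖ ^ 2 - γ / (γ - 1) * r x ^ (γ - 1)) (closure Ω) :=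
  (continuousOn_const.mul (hU.norm.pow 2)).sub
    (continuousOn_const.mul (hr.rpow_const fun x hx => Or.inl (hr0 x hx).ne'))

lemma integrable_relEnergy (hΩ : IsBoundedRegularDomain Ω) (hγ : 1 < γ)
    (h : IsFiniteEnergyState (volOn Ω) γ ρ u)
    (hr : ContinuousOn r (closure Ω)) (hr0 : ∀ x ∈ closure Ω, 0 < r x)
    (hU : ContinuousOn U (closure Ω)) :
    Integrable (fun x => 1 / 2 * (ρ x * ‖u x - U x‖ ^ 2) + relPotential γ (ρ x) (r x))
      (volOn Ω) ∧
    relEnergy Ω γ ρ u r U = energy Ω γ ρ u - (∫ x, ⟪ρ x • u x, U x⟫ ∂(volOn Ω))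
      + (∫ x, ρ x * (1 / 2 * ‖U x‖ ^ 2 - γ / (γ - 1) * r x ^ (γ - 1)) ∂(volOn Ω))
      + ∫ x, r x ^ γ ∂(volOn Ω) := by
  have := hΩ.isFiniteMeasure_volOn
  obtain ⟨CU, hCU⟩ := exists_norm_le_of_continuousOn hΩ hU
  have hm := continuousOn_massTest (γ := γ) hr hr0 hU
  obtain ⟨Cm, hCm⟩ := exists_norm_le_of_continuousOn hΩ hm
  have hrγ : ContinuousOn (fun x => r x ^ γ) (closure Ω) :=
    hr.rpow_const fun x hx => Or.inl (hr0 x hx).ne'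
  have i1 := integrable_energy h hγ
  have i2 := h.integrable_momentum_inner hγ (aestronglyMeasurable_volOn hΩ hU) hCU
  have i3 := h.integrable_density_mul hγ (aestronglyMeasurable_volOn hΩ hm) hCm
  have i4 := integrable_volOn_of_continuousOn hΩ hrγ
  have heq : (fun x => 1 / 2 * (ρ x * ‖u x - U x‖ ^ 2) + relPotential γ (ρ x) (r x))
      =ᵐ[volOn Ω] fun x => (1 / 2) * ρ x * ‖u x‖ ^ 2 + ρ x ^ γ / (γ - 1) - ⟪ρ x • u x, U x⟫
        + ρ x * (1 / 2 * ‖U x‖ ^ 2 - γ / (γ - 1) * r x ^ (γ - 1)) + r x ^ γ := by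
    filter_upwards [ae_restrict_mem hΩ.isOpen.measurableSet] with x hx
    exact relEnergy_density_eq hγ _ _ (hr0 x (subset_closure hx)) _
  refine ⟨(((i1.fun_sub i2).fun_add i3).fun_add i4).congr heq.symm, ?_⟩
  rw [relEnergy, integral_congr_ae heq, integral_add ((i1.fun_sub i2).fun_add i3) i4,
    integral_add (i1.fun_sub i2) i3, integral_sub i1 i2]
  rfl

end

/-! ### Quadratic viscous terms -/

lemma contraction_viscousStress_eq (μ η : ℝ) (A B : Matrix (Fin 3) (Fin 3) ℝ) :
    contraction (viscousStress μ η A) B =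
      (∑ i, ∑ j, μ * (A i j * B i j)) + (∑ i, ∑ j, μ * (A j i * B i j))
        + ∑ i, ∑ j, (η - 2 / 3 * μ) * (A i i * B j j) := by
  simp [contraction, viscousStress, Fin.sum_univ_three, Matrix.trace, Matrix.one_apply]
  ring

lemma integrable_contraction_viscousStress {α : Type*} [MeasurableSpace α] {ν : Measure α}
    (μ η : ℝ) {A B : α → Matrix (Fin 3) (Fin 3) ℝ} (hA : ∀ i j, MemLp (fun x => A x i j) 2 ν)
    (hB : ∀ i j, MemLp (fun x => B x i j) 2 ν) :
    Integrable (fun x => contraction (viscousStress μ η (A x)) (B x)) ν := by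
  have h : ∀ i j k l, Integrable (fun x => A x i j * B x k l) ν := fun i j k l =>
    (hA i j).integrable_mul (hB k l)
  simp_rw [contraction_viscousStress_eq]
  refine ((integrable_finsetSum _ fun i _ => ?_).add (integrable_finsetSum _ fun i _ => ?_)).add
    (integrable_finsetSum _ fun i _ => ?_)
  all_goals exact integrable_finsetSum _ fun j _ => (h _ _ _ _).const_mul _

/-! ### Weak continuity in time -/

section

variable {F : Type*} [NormedAddCommGroup F] [InnerProductSpace ℝ F] {Ω : Set E3} {T : ℝ}

lemma WeaklyContinuousLp.continuousOn_of_memLp_top {p q : ℝ≥0∞}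
    (hΩ : IsBoundedRegularDomain Ω) [hpq : ENNReal.HolderConjugate p q] {f : ℝ → E3 → F}
    (hf : WeaklyContinuousLp Ω T p f) {ψ : E3 → F} (hψ : MemLp ψ ⊤ (volOn Ω)) :
    ContinuousOn (fun t => ∫ x, ⟪f t x, ψ x⟫ ∂(volOn Ω)) (Icc 0 T) := by
  have := hΩ.isFiniteMeasure_volOn
  exact hf.2 q hpq ψ (hψ.mono_exponent le_top)

/-- Weak continuity handles the frozen test function φ(t₀); the error f(t)·(φ(t) - φ(t₀)) is
controlled by the uniform L¹ bound M and the uniform continuity of φ on the compact cylinder. -/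
lemma continuousOn_integral_inner_of_weak (hΩ : IsBoundedRegularDomain Ω) {f φ : ℝ → E3 → F}
    (hfi : ∀ t ∈ Icc 0 T, Integrable (f t) (volOn Ω))
    (hf : ∀ ψ : E3 → F, MemLp ψ ⊤ (volOn Ω) →
      ContinuousOn (fun t => ∫ x, ⟪f t x, ψ x⟫ ∂(volOn Ω)) (Icc 0 T))
    {M : ℝ} (hM : ∀ t ∈ Icc 0 T, ∫ x, ‖f t x‖ ∂(volOn Ω) ≤ M)
    (hφ : ContinuousOn (fun z : ℝ × E3 => φ z.1 z.2) (Icc 0 T ×ˢ closure Ω)) :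
    ContinuousOn (fun t => ∫ x, ⟪f t x, φ t x⟫ ∂(volOn Ω)) (Icc 0 T) := by
  have hΩm := hΩ.isOpen.measurableSet
  have hsl : ∀ t ∈ Icc 0 T, ContinuousOn (φ t) (closure Ω) := fun t ht =>
    hφ.comp (f := fun x => (t, x)) (by fun_prop) fun _ hx => ⟨ht, hx⟩
  obtain ⟨C, hC⟩ := (isCompact_Icc.prod hΩ.isCompact_closure).exists_bound_of_continuousOn hφ
  have hmeas : ∀ t ∈ Icc 0 T, AEStronglyMeasurable (φ t) (volOn Ω) := fun t ht =>
    ((hsl t ht).mono subset_closure).aestronglyMeasurable hΩm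
  have hint : ∀ s ∈ Icc 0 T, ∀ t ∈ Icc 0 T, Integrable (fun x => ⟪f s x, φ t x⟫) (volOn Ω) := by
    intro s hs t ht
    refine Integrable.mono' ((hfi s hs).norm.mul_const C) ((hfi s hs).1.inner (hmeas t ht)) ?_
    filter_upwards [ae_restrict_mem hΩm] with x hx
    exact (norm_inner_le_norm _ _).trans
      (by gcongr; exact hC (t, x) ⟨ht, subset_closure hx⟩)
  intro t₀ ht₀
  have hM0 : 0 ≤ M := (integral_nonneg fun _ => norm_nonneg _).trans (hM t₀ ht₀)
  have htop : MemLp (φ t₀) ⊤ (volOn Ω) := by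
    refine memLp_top_of_bound (hmeas t₀ ht₀) C ?_
    filter_upwards [ae_restrict_mem hΩm] with x hx using hC (t₀, x) ⟨ht₀, subset_closure hx⟩
  have h1 := (Metric.tendsto_nhds.1 (hf _ htop t₀ ht₀))
  have huc := (isCompact_Icc.prod hΩ.isCompact_closure).uniformContinuousOn_of_continuous hφ
  rw [Metric.uniformContinuousOn_iff] at huc
  rw [ContinuousWithinAt, Metric.tendsto_nhds]
  intro κ hκ
  obtain ⟨δ, hδ, hδ'⟩ := huc (κ / (2 * (M + 1))) (by positivity)
  filter_upwards [h1 (κ / 2) (by positivity), self_mem_nhdsWithin,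
    mem_nhdsWithin_of_mem_nhds (Metric.ball_mem_nhds t₀ hδ)] with t ht1 ht htδ
  have h2 : ‖∫ x, (⟪f t x, φ t x⟫ - ⟪f t x, φ t₀ x⟫) ∂(volOn Ω)‖ ≤
      M * (κ / (2 * (M + 1))) := by
    calc _ ≤ ∫ x, ‖f t x‖ * (κ / (2 * (M + 1))) ∂(volOn Ω) := by
          apply norm_integral_le_of_norm_le ((hfi t ht).norm.mul_const _)
          filter_upwards [ae_restrict_mem hΩm] with x hx
          rw [← inner_sub_right]
          refine (norm_inner_le_norm _ _).trans ?_
          gcongr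
          rw [← dist_eq_norm]
          refine (hδ' (t, x) ⟨ht, subset_closure hx⟩ (t₀, x) ⟨ht₀, subset_closure hx⟩ ?_).le
          simpa [Prod.dist_eq] using htδ
      _ ≤ _ := by
        rw [integral_mul_const]
        gcongr
        exact hM t ht
  have h3 : M * (κ / (2 * (M + 1))) < κ / 2 := by
    rw [mul_div_assoc', div_lt_div_iff₀ (by positivity) (by positivity)]
    nlinarith
  rw [integral_sub (hint t ht t ht) (hint t ht t₀ ht₀)] at h2
  rw [dist_eq_norm] at ht1 ⊢
  calc _ = ‖((∫ x, ⟪f t x, φ t x⟫ ∂(volOn Ω)) - ∫ x, ⟪f t x, φ t₀ x⟫ ∂(volOn Ω)) +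
        ((∫ x, ⟪f t x, φ t₀ x⟫ ∂(volOn Ω)) - ∫ x, ⟪f t₀ x, φ t₀ x⟫ ∂(volOn Ω))‖ := by
          rw [sub_add_sub_cancel]
    _ ≤ _ := norm_add_le _ _
    _ < κ := by linarith

end

lemma intervalIntegrable_of_timeMeasure {T : ℝ} (hT : 0 ≤ T) {f : ℝ → ℝ}
    (hf : Integrable f (timeMeasure T)) : IntervalIntegrable f volume 0 T := by
  rw [intervalIntegrable_iff_integrableOn_Ioo_of_le hT]
  exact hf

lemma integral_eq_timeMeasure {T : ℝ} (hT : 0 ≤ T) (f : ℝ → ℝ) :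
    ∫ t in (0 : ℝ)..T, f t = ∫ t, f t ∂(timeMeasure T) := by
  rw [intervalIntegral.integral_of_le hT, integral_Ioc_eq_integral_Ioo, timeMeasure]

instance (T : ℝ) : IsFiniteMeasure (timeMeasure T) := by
  unfold timeMeasure; infer_instance

end

section

/-! ### Measurability in space-time -/

namespace SmoothUpToBoundary

variable {F : Type*} [NormedAddCommGroup F] [NormedSpace ℝ F] [SecondCountableTopology F]
  {Ω : Set E3} {T : ℝ} {φ : ℝ → E3 → F}

lemma bounded_spaceTime (hφ : SmoothUpToBoundary Ω T φ) (hΩ : IsBoundedRegularDomain Ω) :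
    AEStronglyMeasurable (fun z : ℝ × E3 => φ z.1 z.2) ((timeMeasure T).prod (volOn Ω)) ∧
    ∃ C, ∀ᵐ z ∂((timeMeasure T).prod (volOn Ω)), ‖φ z.1 z.2‖ ≤ C := by
  refine ⟨aestronglyMeasurable_of_continuousOn hΩ.isOpen hφ.contDiffOn_interior.continuousOn, ?_⟩
  obtain ⟨C, -, hC⟩ := hφ.exists_norm_le hΩ
  refine ⟨C, ?_⟩
  filter_upwards [ae_prod_mem hΩ.isOpen T] with z hz
  exact hC _ (Ioo_subset_Icc_self hz.1) _ (subset_closure hz.2)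

lemma bounded_deriv_time (hφ : SmoothUpToBoundary Ω T φ) (hΩ : IsBoundedRegularDomain Ω) :
    AEStronglyMeasurable (fun z : ℝ × E3 => deriv (fun s => φ s z.2) z.1)
      ((timeMeasure T).prod (volOn Ω)) ∧
    ∃ C, ∀ᵐ z ∂((timeMeasure T).prod (volOn Ω)), ‖deriv (fun s => φ s z.2) z.1‖ ≤ C := by
  refine ⟨aestronglyMeasurable_of_continuousOn hΩ.isOpen (hφ.continuousOn_deriv_time hΩ.isOpen), ?_⟩
  obtain ⟨C, -, hC⟩ := hφ.exists_norm_deriv_le hΩ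
  refine ⟨C, ?_⟩
  filter_upwards [ae_prod_mem hΩ.isOpen T] with z hz using (hC _ hz.1 _ hz.2).1

lemma bounded_fderiv_space [FiniteDimensional ℝ F] (hφ : SmoothUpToBoundary Ω T φ)
    (hΩ : IsBoundedRegularDomain Ω) :
    AEStronglyMeasurable (fun z : ℝ × E3 => fderiv ℝ (φ z.1) z.2)
      ((timeMeasure T).prod (volOn Ω)) ∧
    ∃ C, ∀ᵐ z ∂((timeMeasure T).prod (volOn Ω)), ‖fderiv ℝ (φ z.1) z.2‖ ≤ C := by
  refine ⟨?_, ?_⟩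
  · rw [volOn_prod_eq]
    exact (hφ.continuousOn_fderiv_space hΩ.isOpen).aestronglyMeasurable
      (isOpen_Ioo.prod hΩ.isOpen).measurableSet
  obtain ⟨C, -, hC⟩ := hφ.exists_norm_deriv_le hΩ
  refine ⟨C, ?_⟩
  filter_upwards [ae_prod_mem hΩ.isOpen T] with z hz using (hC _ hz.1 _ hz.2).2

end SmoothUpToBoundary

lemma SmoothUpToBoundary.bounded_gradient {Ω : Set E3} {T : ℝ} {φ : ℝ → E3 → ℝ}
    (hφ : SmoothUpToBoundary Ω T φ) (hΩ : IsBoundedRegularDomain Ω) :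
    AEStronglyMeasurable (fun z : ℝ × E3 => ∇ (φ z.1) z.2) ((timeMeasure T).prod (volOn Ω)) ∧
    ∃ C, ∀ᵐ z ∂((timeMeasure T).prod (volOn Ω)), ‖∇ (φ z.1) z.2‖ ≤ C := by
  obtain ⟨h1, C, hC⟩ := hφ.bounded_fderiv_space hΩ
  refine ⟨(InnerProductSpace.toDual ℝ E3).symm.continuous.comp_aestronglyMeasurable h1, C, ?_⟩
  filter_upwards [hC] with z hz
  rwa [gradient, LinearIsometryEquiv.norm_map]

lemma SmoothUpToBoundary.bounded_divergence {Ω : Set E3} {T : ℝ} {φ : ℝ → E3 → E3}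
    (hφ : SmoothUpToBoundary Ω T φ) (hΩ : IsBoundedRegularDomain Ω) :
    AEStronglyMeasurable (fun z : ℝ × E3 => divergence (φ z.1) z.2)
      ((timeMeasure T).prod (volOn Ω)) ∧
    ∃ C, ∀ᵐ z ∂((timeMeasure T).prod (volOn Ω)), ‖divergence (φ z.1) z.2‖ ≤ C := by
  obtain ⟨h1, C, hC⟩ := hφ.bounded_fderiv_space hΩ
  refine ⟨?_, 3 * C, ?_⟩
  · refine Finset.aestronglyMeasurable_fun_sum (f := fun i (z : ℝ × E3) =>
      fderiv ℝ (φ z.1) z.2 (e i) i) Finset.univ fun i _ => ?_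
    exact (coord i).continuous.comp_aestronglyMeasurable (h1.apply_continuousLinearMap (e i))
  · filter_upwards [hC] with z hz using abs_divergence_le hz

lemma abs_jacobian_le {V : E3 → E3} {x : E3} {C : ℝ} (h : ‖fderiv ℝ V x‖ ≤ C) (i j : Fin 3) :
    |jacobian V x i j| ≤ C := by
  calc |jacobian V x i j| ≤ ‖fderiv ℝ V x (e j)‖ :=
        PiLp.norm_apply_le (fderiv ℝ V x (e j)) i
    _ ≤ ‖fderiv ℝ V x‖ * ‖e j‖ := ContinuousLinearMap.le_opNorm _ _
    _ ≤ C := by rw [norm_e, mul_one]; exact h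

lemma SmoothUpToBoundary.memLp_jacobian {Ω : Set E3} {T : ℝ} {φ : ℝ → E3 → E3}
    (hφ : SmoothUpToBoundary Ω T φ) (hΩ : IsBoundedRegularDomain Ω) (i j : Fin 3) :
    MemLp (fun z : ℝ × E3 => jacobian (φ z.1) z.2 i j) 2 ((timeMeasure T).prod (volOn Ω)) := by
  have := hΩ.isFiniteMeasure_volOn
  obtain ⟨h1, C, hC⟩ := hφ.bounded_fderiv_space hΩ
  refine MemLp.of_bound ?_ C ?_
  · exact (coord i).continuous.comp_aestronglyMeasurable (h1.apply_continuousLinearMap (e j))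
  · filter_upwards [hC] with z hz using abs_jacobian_le hz i j

/-- Fubini for null sets needs a measurable set, so the sign is checked on a measurable
representative of f. -/
lemma ae_prod_of_forall_ae {Ω : Set E3} {T : ℝ} {f : ℝ × E3 → ℝ}
    (hf : AEStronglyMeasurable f ((timeMeasure T).prod (volOn Ω)))
    [SFinite (volOn Ω)] (h : ∀ᵐ t ∂(timeMeasure T), ∀ᵐ x ∂(volOn Ω), 0 ≤ f (t, x)) :
    ∀ᵐ z ∂((timeMeasure T).prod (volOn Ω)), 0 ≤ f z := by
  have h1 := Measure.ae_ae_of_ae_prod hf.ae_eq_mk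
  have hm : MeasurableSet {z | 0 ≤ hf.mk f z} :=
    measurableSet_le measurable_const hf.stronglyMeasurable_mk.measurable
  have h2 : ∀ᵐ z ∂((timeMeasure T).prod (volOn Ω)), 0 ≤ hf.mk f z := by
    apply (Measure.ae_prod_mem_iff_ae_ae_mem hm).2
    filter_upwards [h, h1] with t ht1 ht2
    filter_upwards [ht1, ht2] with x hx1 hx2
    simpa [← hx2] using hx1
  filter_upwards [h2, hf.ae_eq_mk] with z hz1 hz2
  rwa [hz2]

lemma IsAdmissibleInitialData.isFiniteEnergyState {Ω : Set E3} {γ : ℝ} {ρ₀ : E3 → ℝ}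
    {u₀ : E3 → E3} (h : IsAdmissibleInitialData Ω γ ρ₀ u₀) :
    IsFiniteEnergyState (volOn Ω) γ ρ₀ u₀ :=
  ⟨h.nonneg, h.memLp, h.memLp.1.smul h.measurable, h.integrable⟩

/-! ### Consequences of the definition of weak solutions -/

namespace IsFiniteEnergyWeakSolution

variable {Ω : Set E3} {T γ μ η ε β : ℝ} {ρ₀ : E3 → ℝ} {u₀ : E3 → E3} {ρ : ℝ → E3 → ℝ}
  {u : ℝ → E3 → E3}

lemma isFiniteEnergyState (h : IsFiniteEnergyWeakSolution Ω T γ μ η ε β ρ₀ u₀ ρ u) {t : ℝ}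
    (ht : t ∈ Icc 0 T) : IsFiniteEnergyState (volOn Ω) γ (ρ t) (u t) :=
  ⟨h.nonneg t ht, h.density.1 t ht, (h.momentum.1 t ht).1,
    memLp_one_iff_integrable.1 (h.kinetic.1 t ht)⟩

lemma continuousOn_kinetic (h : IsFiniteEnergyWeakSolution Ω T γ μ η ε β ρ₀ u₀ ρ u)
    (hΩ : IsBoundedRegularDomain Ω) :
    ContinuousOn (fun t => ∫ x, ρ t x * ‖u t x‖ ^ 2 ∂(volOn Ω)) (Icc 0 T) := by
  have := hΩ.isFiniteMeasure_volOn
  have := h.kinetic.continuousOn_of_memLp_top (q := ⊤) hΩ (ψ := fun _ => (1 : ℝ))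
    (memLp_const _)
  simpa using this

lemma continuousOn_density (h : IsFiniteEnergyWeakSolution Ω T γ μ η ε β ρ₀ u₀ ρ u) (hγ : 1 < γ)
    {ψ : E3 → ℝ} (hψ : MemLp ψ (ENNReal.ofReal (γ / (γ - 1))) (volOn Ω)) :
    ContinuousOn (fun t => ∫ x, ⟪ρ t x, ψ x⟫ ∂(volOn Ω)) (Icc 0 T) := by
  have : ENNReal.HolderConjugate (ENNReal.ofReal γ) (ENNReal.ofReal (γ / (γ - 1))) :=
    (Real.HolderConjugate.conjExponent hγ).ennrealOfReal
  exact h.density.2 _ this ψ hψ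

lemma continuousOn_density_of_memLp_top (h : IsFiniteEnergyWeakSolution Ω T γ μ η ε β ρ₀ u₀ ρ u)
    (hΩ : IsBoundedRegularDomain Ω) (hγ : 1 < γ) {ψ : E3 → ℝ} (hψ : MemLp ψ ⊤ (volOn Ω)) :
    ContinuousOn (fun t => ∫ x, ⟪ρ t x, ψ x⟫ ∂(volOn Ω)) (Icc 0 T) := by
  have := hΩ.isFiniteMeasure_volOn
  exact h.continuousOn_density hγ (hψ.mono_exponent le_top)

lemma continuousOn_momentum_of_memLp_top (h : IsFiniteEnergyWeakSolution Ω T γ μ η ε β ρ₀ u₀ ρ u)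
    (hΩ : IsBoundedRegularDomain Ω) (hγ : 1 < γ) {ψ : E3 → E3} (hψ : MemLp ψ ⊤ (volOn Ω)) :
    ContinuousOn (fun t => ∫ x, ⟪ρ t x • u t x, ψ x⟫ ∂(volOn Ω)) (Icc 0 T) := by
  have hp : 1 < 2 * γ / (γ + 1) := by rw [lt_div_iff₀] <;> linarith
  have := (Real.HolderConjugate.conjExponent hp).ennrealOfReal
  exact h.momentum.continuousOn_of_memLp_top (hpq := this) hΩ hψ

/-- Weak continuity tested with the constant 1 makes the mass and ∫ρ|u|² continuous, hence bounded,
on [0,T]; the momentum follows from |ρu| ≤ ρ + ρ|u|². -/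
lemma exists_mass_momentum_bound (h : IsFiniteEnergyWeakSolution Ω T γ μ η ε β ρ₀ u₀ ρ u)
    (hΩ : IsBoundedRegularDomain Ω) (hγ : 1 < γ) :
    ∃ M, ∀ t ∈ Icc 0 T, ∫ x, ‖ρ t x‖ ∂(volOn Ω) ≤ M ∧ ∫ x, ‖ρ t x • u t x‖ ∂(volOn Ω) ≤ M ∧
      ∫ x, ρ t x * ‖u t x‖ ^ 2 ∂(volOn Ω) ≤ M := by
  have := hΩ.isFiniteMeasure_volOn
  obtain ⟨A, hA⟩ := isCompact_Icc.exists_bound_of_continuousOn (h.continuousOn_kinetic hΩ)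
  obtain ⟨B, hB⟩ := isCompact_Icc.exists_bound_of_continuousOn
    (h.continuousOn_density_of_memLp_top hΩ hγ (ψ := fun _ => (1 : ℝ)) (memLp_const _))
  have key : ∀ t ∈ Icc 0 T, ∫ x, ‖ρ t x‖ ∂(volOn Ω) ≤ B ∧
      ∫ x, ‖ρ t x • u t x‖ ∂(volOn Ω) ≤ B + A ∧
      ∫ x, ρ t x * ‖u t x‖ ^ 2 ∂(volOn Ω) ≤ A := by
    intro t ht
    have hs := h.isFiniteEnergyState ht
    have h1 : ∫ x, ‖ρ t x‖ ∂(volOn Ω) = ∫ x, ⟪ρ t x, (1 : ℝ)⟫ ∂(volOn Ω) := by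
      apply integral_congr_ae
      filter_upwards [hs.nonneg] with x hx
      simp [abs_of_nonneg hx]
    have h2 : ∫ x, ‖ρ t x‖ ∂(volOn Ω) ≤ B := by rw [h1]; exact (le_abs_self _).trans (hB t ht)
    have h3 : ∫ x, ρ t x * ‖u t x‖ ^ 2 ∂(volOn Ω) ≤ A := (le_abs_self _).trans (hA t ht)
    refine ⟨h2, ?_, h3⟩
    calc ∫ x, ‖ρ t x • u t x‖ ∂(volOn Ω)
        ≤ ∫ x, (‖ρ t x‖ + ρ t x * ‖u t x‖ ^ 2) ∂(volOn Ω) := by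
          apply integral_mono_ae (hs.integrable_momentum hγ).norm
            ((hs.integrable_density hγ).norm.add hs.kinetic)
          filter_upwards [hs.nonneg] with x hx
          simp only [norm_smul, Real.norm_of_nonneg hx, Pi.add_apply]
          nlinarith [mul_nonneg hx (sq_nonneg (‖u t x‖ - 1)), mul_nonneg hx (sq_nonneg (‖u t x‖))]
      _ = _ := integral_add (hs.integrable_density hγ).norm hs.kinetic
      _ ≤ B + A := add_le_add h2 h3
  refine ⟨max (max B A) (B + A), fun t ht => ?_⟩
  obtain ⟨k1, k2, k3⟩ := key t ht
  exact ⟨k1.trans ((le_max_left _ _).trans (le_max_left _ _)), k2.trans (le_max_right _ _),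
    k3.trans ((le_max_right _ _).trans (le_max_left _ _))⟩

lemma continuousOn_integral_density_mul (h : IsFiniteEnergyWeakSolution Ω T γ μ η ε β ρ₀ u₀ ρ u)
    (hΩ : IsBoundedRegularDomain Ω) (hγ : 1 < γ) {φ : ℝ → E3 → ℝ}
    (hφ : SmoothUpToBoundary Ω T φ) :
    ContinuousOn (fun t => ∫ x, ρ t x * φ t x ∂(volOn Ω)) (Icc 0 T) := by
  have := hΩ.isFiniteMeasure_volOn
  obtain ⟨M, hM⟩ := h.exists_mass_momentum_bound hΩ hγ
  have := continuousOn_integral_inner_of_weak hΩ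
    (fun t ht => (h.isFiniteEnergyState ht).integrable_density hγ)
    (fun ψ hψ => h.continuousOn_density_of_memLp_top hΩ hγ hψ) (fun t ht => (hM t ht).1)
    hφ.continuousOn
  simpa [mul_comm] using this

lemma continuousOn_integral_momentum_inner
    (h : IsFiniteEnergyWeakSolution Ω T γ μ η ε β ρ₀ u₀ ρ u)
    (hΩ : IsBoundedRegularDomain Ω) (hγ : 1 < γ) {φ : ℝ → E3 → E3}
    (hφ : SmoothUpToBoundary Ω T φ) :
    ContinuousOn (fun t => ∫ x, ⟪ρ t x • u t x, φ t x⟫ ∂(volOn Ω)) (Icc 0 T) := by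
  have := hΩ.isFiniteMeasure_volOn
  obtain ⟨M, hM⟩ := h.exists_mass_momentum_bound hΩ hγ
  exact continuousOn_integral_inner_of_weak hΩ
    (fun t ht => (h.isFiniteEnergyState ht).integrable_momentum hγ)
    (fun ψ hψ => h.continuousOn_momentum_of_memLp_top hΩ hγ hψ) (fun t ht => (hM t ht).2.1)
    hφ.continuousOn

lemma energy_le (h : IsFiniteEnergyWeakSolution Ω T γ μ η ε β ρ₀ u₀ ρ u)
    (hμ : 0 ≤ μ) (hη : 0 ≤ η) (hε : 0 ≤ ε) (hβ : 0 ≤ β) :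
    ∀ᵐ t ∂(timeMeasure T), energy Ω γ (ρ t) (u t) ≤ energy Ω γ ρ₀ u₀ := by
  obtain ⟨G, w, -, -, -, -, -, -, hen⟩ := h.viscous_part
  filter_upwards [hen, ae_restrict_mem measurableSet_Ioo] with t ht hm
  have h1 : 0 ≤ ∫ s in (0 : ℝ)..t, ∫ x, contraction (viscousStress μ η (G s x)) (G s x)
      ∂(volOn Ω) := intervalIntegral.integral_nonneg hm.1.le fun s _ =>
    integral_nonneg fun x => contraction_viscousStress_self_nonneg hμ hη _
  have h2 : 0 ≤ ∫ s in (0 : ℝ)..t, ∫ x, ‖w s x‖ ^ 2 ∂(surfaceMeasure Ω) :=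
    intervalIntegral.integral_nonneg hm.1.le fun s _ => integral_nonneg fun x => by positivity
  nlinarith [mul_nonneg hε h1, mul_nonneg hβ h2]

/-- A weak solution is a state of finite energy over space-time. -/
lemma isFiniteEnergyState_spaceTime (h : IsFiniteEnergyWeakSolution Ω T γ μ η ε β ρ₀ u₀ ρ u)
    (hΩ : IsBoundedRegularDomain Ω) (hγ : 1 < γ) (hμ : 0 ≤ μ) (hη : 0 ≤ η) (hε : 0 ≤ ε)
    (hβ : 0 ≤ β) :
    IsFiniteEnergyState ((timeMeasure T).prod (volOn Ω)) γ (fun z => ρ z.1 z.2)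
      (fun z => u z.1 z.2) := by
  have := hΩ.isFiniteMeasure_volOn
  have hmem : ∀ᵐ t ∂(timeMeasure T), t ∈ Icc 0 T := by
    filter_upwards [ae_restrict_mem measurableSet_Ioo] with t ht using Ioo_subset_Icc_self ht
  obtain ⟨M, hM⟩ := h.exists_mass_momentum_bound hΩ hγ
  have hnn : ∀ᵐ z ∂((timeMeasure T).prod (volOn Ω)), 0 ≤ ρ z.1 z.2 := by
    apply ae_prod_of_forall_ae h.measurable_density
    filter_upwards [hmem] with t ht using h.nonneg t ht
  refine ⟨hnn, ?_, h.measurable_density.smul h.measurable_velocity, ?_⟩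
  · rw [← integrable_norm_rpow_iff h.measurable_density (by simp; linarith) (by simp),
      ENNReal.toReal_ofReal (by linarith)]
    have hmeas : AEStronglyMeasurable (fun z : ℝ × E3 => ‖ρ z.1 z.2‖ ^ γ)
        ((timeMeasure T).prod (volOn Ω)) :=
      (h.measurable_density.norm.aemeasurable.pow_const γ).aestronglyMeasurable
    have hst : ∀ t ∈ Icc 0 T, Integrable (fun x => ‖ρ t x‖ ^ γ) (volOn Ω) := by
      intro t ht
      refine ((h.isFiniteEnergyState ht).integrable_rpow hγ).congr ?_
      filter_upwards [h.nonneg t ht] with x hx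
      rw [Real.norm_of_nonneg hx]
    rw [integrable_prod_iff hmeas]
    constructor
    · filter_upwards [hmem] with t ht using hst t ht
    -- The energy inequality bounds ∫ρ^γ by γ - 1 times the initial energy for almost every time.
    · refine Integrable.of_bound hmeas.norm.integral_prod_right'
        ((γ - 1) * energy Ω γ ρ₀ u₀) ?_
      filter_upwards [hmem, h.energy_le hμ hη hε hβ] with t ht hen
      have hs := h.isFiniteEnergyState ht
      rw [Real.norm_of_nonneg (integral_nonneg fun _ => norm_nonneg _)]
      refine le_trans ?_ (mul_le_mul_of_nonneg_left hen (by linarith))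
      rw [energy, ← integral_const_mul]
      apply integral_mono_ae (hst t ht).norm ((integrable_energy hs hγ).const_mul _)
      filter_upwards [hs.nonneg] with x hx
      have hγ1 : 0 < γ - 1 := by linarith
      have h1 : 0 ≤ ρ t x ^ γ := Real.rpow_nonneg hx _
      have h2 : 0 ≤ (γ - 1) * (1 / 2 * ρ t x * ‖u t x‖ ^ 2) := by positivity
      have h3 : (γ - 1) * (ρ t x ^ γ / (γ - 1)) = ρ t x ^ γ := by field_simp
      simp only [Real.norm_of_nonneg hx, Real.norm_of_nonneg h1]
      rw [mul_add, h3]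
      linarith
  · have hmeas : AEStronglyMeasurable (fun z : ℝ × E3 => ρ z.1 z.2 * ‖u z.1 z.2‖ ^ 2)
        ((timeMeasure T).prod (volOn Ω)) :=
      h.measurable_density.mul (h.measurable_velocity.norm.pow 2)
    rw [integrable_prod_iff hmeas]
    constructor
    · filter_upwards [hmem] with t ht using (h.isFiniteEnergyState ht).kinetic
    · refine Integrable.of_bound hmeas.norm.integral_prod_right' M ?_
      filter_upwards [hmem] with t ht
      rw [Real.norm_of_nonneg (integral_nonneg fun _ => norm_nonneg _)]
      refine le_trans (le_of_eq ?_) (hM t ht).2.2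
      apply integral_congr_ae
      filter_upwards [h.nonneg t ht] with x hx
      rw [Real.norm_of_nonneg (by positivity)]

end IsFiniteEnergyWeakSolution

end

section

/-! ### Balance laws at every time -/

lemma gradient_const_smul {φ : E3 → ℝ} {x : E3} (hφ : DifferentiableAt ℝ φ x) (c : ℝ) :
    ∇ (fun y => c • φ y) x = c • ∇ φ x := by
  rw [gradient, gradient, fderiv_fun_const_smul hφ, map_smul]

lemma jacobian_const_smul {V : E3 → E3} {x : E3} (hV : DifferentiableAt ℝ V x) (c : ℝ) :
    jacobian (fun y => c • V y) x = c • jacobian V x := by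
  ext i j
  simp [jacobian, fderiv_fun_const_smul hV]

lemma divergence_const_smul {V : E3 → E3} {x : E3} (hV : DifferentiableAt ℝ V x) (c : ℝ) :
    divergence (fun y => c • V y) x = c * divergence V x := by
  rw [divergence, jacobian_const_smul hV, Matrix.trace_smul, smul_eq_mul, divergence]

lemma contraction_smul (A B : Matrix (Fin 3) (Fin 3) ℝ) (c : ℝ) :
    contraction A (c • B) = c * contraction A B := by
  simp only [contraction, Matrix.smul_apply, smul_eq_mul, Finset.mul_sum]
  exact Finset.sum_congr rfl fun i _ => Finset.sum_congr rfl fun j _ => by ring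

lemma TangentToBoundary.const_smul {Ω : Set E3} {V : E3 → E3} (hV : TangentToBoundary Ω V)
    (c : ℝ) : TangentToBoundary Ω fun x => c • V x := fun x ν hν => by
  rw [inner_smul_left, hV x ν hν, mul_zero]

lemma ae_mem_timeMeasure (T : ℝ) : ∀ᵐ t ∂(timeMeasure T), t ∈ Ioo 0 T :=
  ae_restrict_mem measurableSet_Ioo

lemma interval_integral_congr_timeMeasure {T : ℝ} (hT : 0 ≤ T) {f g : ℝ → ℝ}
    (h : ∀ᵐ t ∂(timeMeasure T), f t = g t) :
    ∫ t in (0 : ℝ)..T, f t = ∫ t in (0 : ℝ)..T, g t := by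
  rw [integral_eq_timeMeasure hT, integral_eq_timeMeasure hT]
  exact integral_congr_ae h

/-- Smooth densities are the primitive of their time derivative. -/
lemma SmoothUpToBoundary.integral_balance {Ω : Set E3} {T : ℝ} {φ : ℝ → E3 → ℝ}
    (hφ : SmoothUpToBoundary Ω T φ) (hΩ : IsBoundedRegularDomain Ω) {τ : ℝ} (hτ : τ ∈ Icc 0 T) :
    ∫ x, φ τ x ∂(volOn Ω) = (∫ x, φ 0 x ∂(volOn Ω))
      + ∫ t in (0 : ℝ)..τ, ∫ x, deriv (fun s => φ s x) t ∂(volOn Ω) := by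
  have := hΩ.isFiniteMeasure_volOn
  obtain ⟨C, -, hC⟩ := hφ.exists_norm_deriv_le hΩ
  have hsub : Ioo 0 τ ⊆ Ioo 0 T := Ioo_subset_Ioo_right hτ.2
  have hmeas : AEStronglyMeasurable (fun z : ℝ × E3 => deriv (fun s => φ s z.2) z.1)
      ((timeMeasure τ).prod (volOn Ω)) :=
    aestronglyMeasurable_of_continuousOn hΩ.isOpen
      ((hφ.continuousOn_deriv_time hΩ.isOpen).mono (prod_mono hsub le_rfl))
  have hint : Integrable (fun z : ℝ × E3 => deriv (fun s => φ s z.2) z.1)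
      ((timeMeasure τ).prod (volOn Ω)) := by
    refine Integrable.of_bound hmeas C ?_
    filter_upwards [ae_prod_mem hΩ.isOpen τ] with z hz using (hC _ (hsub hz.1) _ hz.2).1
  have hslice : ∀ x ∈ Ω, ContinuousOn (fun s => φ s x) (Icc 0 τ) := fun x hx =>
    hφ.continuousOn.comp (f := fun s => (s, x)) (by fun_prop)
      fun s hs => ⟨⟨hs.1, hs.2.trans hτ.2⟩, subset_closure hx⟩
  have hftc : ∀ᵐ x ∂(volOn Ω), ∫ t, deriv (fun s => φ s x) t ∂(timeMeasure τ) =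
      φ τ x - φ 0 x := by
    filter_upwards [ae_restrict_mem hΩ.isOpen.measurableSet, hint.prod_left_ae] with x hx hi
    rw [← integral_eq_timeMeasure hτ.1]
    exact intervalIntegral.integral_eq_sub_of_hasDerivAt_of_le hτ.1 (hslice x hx)
      (fun s hs => hφ.hasDerivAt_time hΩ.isOpen (hsub hs) hx)
      (intervalIntegrable_of_timeMeasure hτ.1 hi)
  rw [integral_eq_timeMeasure hτ.1, integral_integral_swap hint, integral_congr_ae hftc,
    integral_sub (integrable_volOn_of_continuousOn hΩ (hφ.continuousOn_slice hτ))
      (integrable_volOn_of_continuousOn hΩ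
        (hφ.continuousOn_slice ⟨le_rfl, hτ.1.trans hτ.2⟩))]
  ring

namespace IsFiniteEnergyWeakSolution

variable {Ω : Set E3} {T γ μ η ε β : ℝ} {ρ₀ : E3 → ℝ} {u₀ : E3 → E3} {ρ : ℝ → E3 → ℝ}
  {u : ℝ → E3 → E3}

lemma integrable_mass_flux (hst : IsFiniteEnergyState ((timeMeasure T).prod (volOn Ω)) γ
      (fun z => ρ z.1 z.2) (fun z => u z.1 z.2))
    (hΩ : IsBoundedRegularDomain Ω) (hγ : 1 < γ) {φ : ℝ → E3 → ℝ}
    (hφ : SmoothUpToBoundary Ω T φ) :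
    Integrable (fun z : ℝ × E3 => ρ z.1 z.2 * deriv (fun s => φ s z.2) z.1
      + ρ z.1 z.2 * ⟪u z.1 z.2, ∇ (φ z.1) z.2⟫) ((timeMeasure T).prod (volOn Ω)) := by
  have := hΩ.isFiniteMeasure_volOn
  obtain ⟨h1, C1, hC1⟩ := hφ.bounded_deriv_time hΩ
  obtain ⟨h2, C2, hC2⟩ := hφ.bounded_gradient hΩ
  have := hst.integrable_momentum_inner hγ h2 hC2
  simp only [inner_smul_left, conj_trivial] at this
  exact (hst.integrable_density_mul hγ h1 hC1).add this

/-- Testing with θ(t)φ, for arbitrary smooth θ, says that the integral of the mass flux against φ is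
the weak time derivative of ∫ρφ, with initial value ∫ρ₀φ(0); continuity in time then gives the
identity at every τ. -/
lemma mass_balance (h : IsFiniteEnergyWeakSolution Ω T γ μ η ε β ρ₀ u₀ ρ u)
    (hst : IsFiniteEnergyState ((timeMeasure T).prod (volOn Ω)) γ
      (fun z => ρ z.1 z.2) (fun z => u z.1 z.2))
    (hΩ : IsBoundedRegularDomain Ω) (hγ : 1 < γ) (hT : 0 < T) {φ : ℝ → E3 → ℝ}
    (hφ : SmoothUpToBoundary Ω T φ) :
    ∀ τ ∈ Icc 0 T, ∫ x, ρ τ x * φ τ x ∂(volOn Ω) = (∫ x, ρ₀ x * φ 0 x ∂(volOn Ω))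
      + ∫ t in (0 : ℝ)..τ, ∫ x, (ρ t x * deriv (fun s => φ s x) t
        + ρ t x * ⟪u t x, ∇ (φ t) x⟫) ∂(volOn Ω) := by
  have := hΩ.isFiniteMeasure_volOn
  have hint := integrable_mass_flux hst hΩ hγ hφ
  apply eq_add_integral_of_weak_deriv hT (h.continuousOn_integral_density_mul hΩ hγ hφ)
    (intervalIntegrable_of_timeMeasure hT.le hint.integral_prod_left)
  intro θ hθ
  have hw := h.mass_equation _ (hφ.time_smul hθ)
  simp only [smul_eq_mul] at hw
  have e1 : ∀ t, ∫ x, ρ t x * (θ t * φ t x) ∂(volOn Ω) = θ t * ∫ x, ρ t x * φ t x ∂(volOn Ω) := by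
    intro t
    rw [← integral_const_mul]
    exact integral_congr_ae (Eventually.of_forall fun x => by ring)
  have e2 : ∫ x, ρ₀ x * (θ 0 * φ 0 x) ∂(volOn Ω) = θ 0 * ∫ x, ρ₀ x * φ 0 x ∂(volOn Ω) := by
    rw [← integral_const_mul]
    exact integral_congr_ae (Eventually.of_forall fun x => by ring)
  rw [e1, e2] at hw
  rw [hw]
  apply interval_integral_congr_timeMeasure hT.le
  obtain ⟨h3, C3, hC3⟩ := hφ.bounded_spaceTime hΩ
  filter_upwards [ae_mem_timeMeasure T, hint.prod_right_ae,
    (hst.integrable_density_mul hγ h3 hC3).prod_right_ae] with t ht hi hi3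
  rw [← integral_const_mul, ← integral_const_mul,
    ← integral_add (hi3.const_mul _) (hi.const_mul _)]
  apply integral_congr_ae
  filter_upwards [ae_restrict_mem hΩ.isOpen.measurableSet] with x hx
  have d1 : deriv (fun s => θ s * φ s x) t = deriv θ t * φ t x + θ t * deriv (fun s => φ s x) t :=
    (((hθ.differentiable (by simp) t).hasDerivAt).mul
      (hφ.hasDerivAt_time hΩ.isOpen ht hx)).deriv
  have d2 : ∇ (fun y => θ t * φ t y) x = θ t • ∇ (φ t) x :=
    gradient_const_smul (hφ.hasFDerivAt_space hΩ.isOpen ht hx).differentiableAt (θ t)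
  rw [d1, d2, inner_smul_right]
  ring

/-- The fluxes of the momentum equation, without the friction. -/
def momentumFlux (γ μ η ε : ℝ) (ρ : ℝ → E3 → ℝ) (u : ℝ → E3 → E3)
    (G : ℝ → E3 → Matrix (Fin 3) (Fin 3) ℝ) (φ : ℝ → E3 → E3) (t : ℝ) (x : E3) : ℝ :=
  ⟪ρ t x • u t x, deriv (fun s => φ s x) t⟫
    + ρ t x * contraction (tensorSquare (u t x)) (jacobian (φ t) x)
    + ρ t x ^ γ * divergence (φ t) x
    - ε * contraction (viscousStress μ η (G t x)) (jacobian (φ t) x)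

lemma integrable_convection (hst : IsFiniteEnergyState ((timeMeasure T).prod (volOn Ω)) γ
      (fun z => ρ z.1 z.2) (fun z => u z.1 z.2))
    (hu : AEStronglyMeasurable (fun z : ℝ × E3 => u z.1 z.2) ((timeMeasure T).prod (volOn Ω)))
    (hΩ : IsBoundedRegularDomain Ω) (hγ : 1 < γ) {φ : ℝ → E3 → E3}
    (hφ : SmoothUpToBoundary Ω T φ) :
    Integrable (fun z : ℝ × E3 => ⟪ρ z.1 z.2 • u z.1 z.2, deriv (fun s => φ s z.2) z.1⟫
        + ρ z.1 z.2 * contraction (tensorSquare (u z.1 z.2)) (jacobian (φ z.1) z.2)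
        + ρ z.1 z.2 ^ γ * divergence (φ z.1) z.2) ((timeMeasure T).prod (volOn Ω)) := by
  have := hΩ.isFiniteMeasure_volOn
  obtain ⟨h1, C1, hC1⟩ := hφ.bounded_deriv_time hΩ
  obtain ⟨h2, C2, hC2⟩ := hφ.bounded_fderiv_space hΩ
  obtain ⟨h3, C3, hC3⟩ := hφ.bounded_divergence hΩ
  simp_rw [contraction_tensorSquare_jacobian]
  exact ((hst.integrable_momentum_inner hγ h1 hC1).add (hst.integrable_quadratic hu h2 hC2)).add
    (hst.integrable_rpow_mul hγ h3 hC3)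

lemma integrable_momentumFlux (hst : IsFiniteEnergyState ((timeMeasure T).prod (volOn Ω)) γ
      (fun z => ρ z.1 z.2) (fun z => u z.1 z.2))
    (hu : AEStronglyMeasurable (fun z : ℝ × E3 => u z.1 z.2) ((timeMeasure T).prod (volOn Ω)))
    {G : ℝ → E3 → Matrix (Fin 3) (Fin 3) ℝ}
    (hG : ∀ i j, MemLp (fun z : ℝ × E3 => G z.1 z.2 i j) 2 ((timeMeasure T).prod (volOn Ω)))
    (hΩ : IsBoundedRegularDomain Ω) (hγ : 1 < γ) {φ : ℝ → E3 → E3}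
    (hφ : SmoothUpToBoundary Ω T φ) :
    Integrable (fun z : ℝ × E3 => momentumFlux γ μ η ε ρ u G φ z.1 z.2)
      ((timeMeasure T).prod (volOn Ω)) :=
  (integrable_convection hst hu hΩ hγ hφ).sub
    ((integrable_contraction_viscousStress μ η hG (hφ.memLp_jacobian hΩ)).const_mul ε)

/-- The work of the friction on a smooth field. -/
lemma integrable_friction (hΩ : IsBoundedRegularDomain Ω) (hβ : 0 ≤ β) {w : ℝ → E3 → E3}
    (hw : AEStronglyMeasurable (fun z : ℝ × E3 => w z.1 z.2)
      ((timeMeasure T).prod (surfaceMeasure Ω)))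
    (hwi : Integrable (fun z : ℝ × E3 => β * ‖w z.1 z.2‖ ^ 2)
      ((timeMeasure T).prod (surfaceMeasure Ω))) {φ : ℝ → E3 → E3}
    (hφ : SmoothUpToBoundary Ω T φ) :
    Integrable (fun z : ℝ × E3 => β * ⟪w z.1 z.2, φ z.1 z.2⟫)
      ((timeMeasure T).prod (surfaceMeasure Ω)) := by
  have := hΩ.isFiniteMeasure_surfaceMeasure
  have hprod : (timeMeasure T).prod (surfaceMeasure Ω) =
      ((volume : Measure ℝ).prod (surfaceMeasure Ω)).restrict (Ioo 0 T ×ˢ frontier Ω) := by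
    have : (surfaceMeasure Ω).restrict (frontier Ω) = surfaceMeasure Ω := by
      rw [surfaceMeasure, Measure.restrict_restrict isClosed_frontier.measurableSet, inter_self]
    conv_lhs => rw [← this, timeMeasure, Measure.prod_restrict]
  have hms : MeasurableSet (Ioo 0 T ×ˢ frontier Ω) :=
    measurableSet_Ioo.prod isClosed_frontier.measurableSet
  have hmem : ∀ᵐ z ∂((timeMeasure T).prod (surfaceMeasure Ω)), z ∈ Ioo 0 T ×ˢ frontier Ω := by
    rw [hprod]; exact ae_restrict_mem hms
  have hφm : AEStronglyMeasurable (fun z : ℝ × E3 => φ z.1 z.2)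
      ((timeMeasure T).prod (surfaceMeasure Ω)) := by
    rw [hprod]
    exact (hφ.continuousOn.mono (prod_mono Ioo_subset_Icc_self
      frontier_subset_closure)).aestronglyMeasurable hms
  obtain ⟨C, hC0, hC⟩ := hφ.exists_norm_le hΩ
  -- The factor β stays inside: the integrability hypothesis concerns β|w|², and β may vanish.
  refine Integrable.mono' (hwi.add (integrable_const (β * C ^ 2))) ((hw.inner hφm).const_mul β) ?_
  filter_upwards [hmem] with z hz
  have h1 := hC z.1 (Ioo_subset_Icc_self hz.1) z.2 (frontier_subset_closure hz.2)
  have h2 := abs_real_inner_le_norm (w z.1 z.2) (φ z.1 z.2)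
  rw [norm_mul, Real.norm_of_nonneg hβ, Real.norm_eq_abs]
  simp only [Pi.add_apply]
  rw [← mul_add]
  gcongr
  nlinarith [norm_nonneg (w z.1 z.2), norm_nonneg (φ z.1 z.2), sq_nonneg (‖w z.1 z.2‖ - C),
    mul_le_mul_of_nonneg_left h1 (norm_nonneg (w z.1 z.2)), sq_nonneg (‖w z.1 z.2‖), sq_nonneg C]

/-- Same argument as for `mass_balance`; the test field θ(t)φ remains tangent to the boundary. -/
lemma momentum_balance (h : IsFiniteEnergyWeakSolution Ω T γ μ η ε β ρ₀ u₀ ρ u)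
    (hst : IsFiniteEnergyState ((timeMeasure T).prod (volOn Ω)) γ
      (fun z => ρ z.1 z.2) (fun z => u z.1 z.2))
    {G : ℝ → E3 → Matrix (Fin 3) (Fin 3) ℝ} {w : ℝ → E3 → E3}
    (hG : ∀ i j, MemLp (fun z : ℝ × E3 => G z.1 z.2 i j) 2 ((timeMeasure T).prod (volOn Ω)))
    (hw : AEStronglyMeasurable (fun z : ℝ × E3 => w z.1 z.2)
      ((timeMeasure T).prod (surfaceMeasure Ω)))
    (hwi : Integrable (fun z : ℝ × E3 => β * ‖w z.1 z.2‖ ^ 2)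
      ((timeMeasure T).prod (surfaceMeasure Ω)))
    (hmom : ∀ φ : ℝ → E3 → E3, SmoothUpToBoundary Ω T φ →
      (∀ t ∈ Icc 0 T, TangentToBoundary Ω (φ t)) →
      (∫ x, ⟪ρ T x • u T x, φ T x⟫ ∂(volOn Ω)) - ∫ x, ⟪ρ₀ x • u₀ x, φ 0 x⟫ ∂(volOn Ω) =
        - β * (∫ t in (0 : ℝ)..T, ∫ x, ⟪w t x, φ t x⟫ ∂(surfaceMeasure Ω))
        + ∫ t in (0 : ℝ)..T, ∫ x, momentumFlux γ μ η ε ρ u G φ t x ∂(volOn Ω))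
    (hΩ : IsBoundedRegularDomain Ω) (hγ : 1 < γ) (hT : 0 < T) (hβ : 0 ≤ β) {φ : ℝ → E3 → E3}
    (hφ : SmoothUpToBoundary Ω T φ) (hφt : ∀ t ∈ Icc 0 T, TangentToBoundary Ω (φ t)) :
    ∀ τ ∈ Icc 0 T, ∫ x, ⟪ρ τ x • u τ x, φ τ x⟫ ∂(volOn Ω) =
      (∫ x, ⟪ρ₀ x • u₀ x, φ 0 x⟫ ∂(volOn Ω))
      + ∫ t in (0 : ℝ)..τ, ((∫ x, momentumFlux γ μ η ε ρ u G φ t x ∂(volOn Ω))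
        - ∫ x, β * ⟪w t x, φ t x⟫ ∂(surfaceMeasure Ω)) := by
  have := hΩ.isFiniteMeasure_volOn
  have := hΩ.isFiniteMeasure_surfaceMeasure
  have hflux := integrable_momentumFlux (μ := μ) (η := η) (ε := ε) hst h.measurable_velocity hG
    hΩ hγ hφ
  have hfr := integrable_friction hΩ hβ hw hwi hφ
  have hfi := intervalIntegrable_of_timeMeasure hT.le hflux.integral_prod_left
  have hfri := intervalIntegrable_of_timeMeasure hT.le hfr.integral_prod_left
  obtain ⟨h3, C3, hC3⟩ := hφ.bounded_spaceTime hΩ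
  have hmi := hst.integrable_momentum_inner hγ h3 hC3
  have hmii := intervalIntegrable_of_timeMeasure hT.le hmi.integral_prod_left
  apply eq_add_integral_of_weak_deriv hT (h.continuousOn_integral_momentum_inner hΩ hγ hφ)
    (hfi.sub hfri)
  intro θ hθ
  have hw := hmom _ (hφ.time_smul hθ) fun t ht => (hφt t ht).const_smul _
  have e1 : ∀ t, ∫ x, ⟪ρ t x • u t x, θ t • φ t x⟫ ∂(volOn Ω) =
      θ t * ∫ x, ⟪ρ t x • u t x, φ t x⟫ ∂(volOn Ω) := by
    intro t
    rw [← integral_const_mul]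
    simp_rw [inner_smul_right]
  have e2 : ∫ x, ⟪ρ₀ x • u₀ x, θ 0 • φ 0 x⟫ ∂(volOn Ω) =
      θ 0 * ∫ x, ⟪ρ₀ x • u₀ x, φ 0 x⟫ ∂(volOn Ω) := by
    rw [← integral_const_mul]
    simp_rw [inner_smul_right]
  have e3 : -β * (∫ t in (0 : ℝ)..T, ∫ x, ⟪w t x, θ t • φ t x⟫ ∂(surfaceMeasure Ω)) =
      -∫ t in (0 : ℝ)..T, θ t * ∫ x, β * ⟪w t x, φ t x⟫ ∂(surfaceMeasure Ω) := by
    rw [neg_mul, ← intervalIntegral.integral_const_mul]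
    simp_rw [inner_smul_right, integral_const_mul]
    congr 2
    ext t
    ring
  have e4 : ∫ t in (0 : ℝ)..T, ∫ x, momentumFlux γ μ η ε ρ u G (fun t x => θ t • φ t x) t x
        ∂(volOn Ω) =
      ∫ t in (0 : ℝ)..T, (deriv θ t * (∫ x, ⟪ρ t x • u t x, φ t x⟫ ∂(volOn Ω))
        + θ t * ∫ x, momentumFlux γ μ η ε ρ u G φ t x ∂(volOn Ω)) := by
    apply interval_integral_congr_timeMeasure hT.le
    filter_upwards [ae_mem_timeMeasure T, hflux.prod_right_ae, hmi.prod_right_ae]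
      with t ht hi hi3
    rw [← integral_const_mul, ← integral_const_mul,
      ← integral_add (hi3.const_mul _) (hi.const_mul _)]
    apply integral_congr_ae
    filter_upwards [ae_restrict_mem hΩ.isOpen.measurableSet] with x hx
    have d1 : deriv (fun s => θ s • φ s x) t = θ t • deriv (fun s => φ s x) t
        + deriv θ t • φ t x :=
      (((hθ.differentiable (by simp) t).hasDerivAt).smul
        (hφ.hasDerivAt_time hΩ.isOpen ht hx)).deriv
    have hd := (hφ.hasFDerivAt_space hΩ.isOpen ht hx).differentiableAt
    simp only [momentumFlux]
    rw [d1, jacobian_const_smul hd, divergence_const_smul hd, contraction_smul, contraction_smul,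
      inner_add_right, inner_smul_right, inner_smul_right]
    ring
  have hθc : ContinuousOn θ (uIcc 0 T) := hθ.continuous.continuousOn
  have hθ'c : ContinuousOn (deriv θ) (uIcc 0 T) :=
    (hθ.continuous_deriv (by simp)).continuousOn
  rw [e1, e2, e3, e4] at hw
  rw [hw, neg_add_eq_sub, ← intervalIntegral.integral_sub
    ((hmii.continuousOn_mul hθ'c).add (hfi.continuousOn_mul hθc)) (hfri.continuousOn_mul hθc)]
  congr 1
  ext t
  ring

end IsFiniteEnergyWeakSolution

end

section

/-! ### The relative energy inequality -/

lemma intervalIntegrable_mono_right {T τ : ℝ} (hτ : τ ∈ Icc 0 T) {f : ℝ → ℝ}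
    (hf : IntervalIntegrable f volume 0 T) : IntervalIntegrable f volume 0 τ :=
  hf.mono_set (by
    rw [uIcc_of_le hτ.1, uIcc_of_le (hτ.1.trans hτ.2)]; exact Icc_subset_Icc_right hτ.2)

lemma interval_integral_mono_timeMeasure {T τ : ℝ} (hτ : τ ∈ Icc 0 T) {f g : ℝ → ℝ}
    (hf : IntervalIntegrable f volume 0 T) (hg : IntervalIntegrable g volume 0 T)
    (h : ∀ᵐ t ∂(timeMeasure T), f t ≤ g t) :
    ∫ t in (0 : ℝ)..τ, f t ≤ ∫ t in (0 : ℝ)..τ, g t := by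
  apply intervalIntegral.integral_mono_ae_restrict hτ.1 (intervalIntegrable_mono_right hτ hf)
    (intervalIntegrable_mono_right hτ hg)
  rw [Measure.restrict_congr_set Ioo_ae_eq_Icc.symm]
  exact ae_restrict_of_ae_restrict_of_subset (Ioo_subset_Ioo_right hτ.2) h

variable {Ω : Set E3} {T γ μ η : ℝ} {ρE₀ : E3 → ℝ} {uE₀ : E3 → E3} {r : ℝ → E3 → ℝ}
  {U : ℝ → E3 → E3}

lemma IsSmoothEulerSolution.exists_remainder_bound (hE : IsSmoothEulerSolution Ω T γ ρE₀ uE₀ r U)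
    (hΩ : IsBoundedRegularDomain Ω) (hγ : 1 < γ) (hT : 0 < T) :
    ∃ C, 0 ≤ C ∧ ∀ t ∈ Ioo 0 T, ∀ x ∈ Ω, ∀ (ρ : ℝ) (u : E3), 0 ≤ ρ →
      -(ρ * ⟪u - U t x, fderiv ℝ (U t) x (u - U t x)⟫)
        - (γ - 1) * relPotential γ ρ (r t x) * divergence (U t) x
      ≤ C * (1 / 2 * (ρ * ‖u - U t x‖ ^ 2) + relPotential γ ρ (r t x)) := by
  obtain ⟨C, hC0, hC⟩ := hE.smooth_velocity.exists_norm_deriv_le hΩ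
  have hγ1 : 0 < γ - 1 := by linarith
  -- The factor 2 compensates the ½ of the kinetic part; 3C bounds the divergence when C bounds the
  -- gradient.
  refine ⟨2 * C + (γ - 1) * (3 * C), by positivity, fun t ht x hx ρ u hρ => ?_⟩
  have hr := hE.density_pos hT (Ioo_subset_Icc_self ht) (subset_closure hx)
  have hH := relPotential_nonneg hγ hρ hr
  have h1 : |⟪u - U t x, fderiv ℝ (U t) x (u - U t x)⟫| ≤ C * ‖u - U t x‖ ^ 2 := by
    refine (abs_real_inner_le_norm _ _).trans ?_
    have h2 : ‖fderiv ℝ (U t) x (u - U t x)‖ ≤ C * ‖u - U t x‖ :=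
      (ContinuousLinearMap.le_opNorm _ _).trans (by gcongr; exact (hC t ht x hx).2)
    nlinarith [norm_nonneg (u - U t x)]
  have h3 := abs_divergence_le (hC t ht x hx).2
  have h4 : -(ρ * ⟪u - U t x, fderiv ℝ (U t) x (u - U t x)⟫) ≤ ρ * (C * ‖u - U t x‖ ^ 2) := by
    rw [← mul_neg]
    exact mul_le_mul_of_nonneg_left ((neg_le_abs _).trans h1) hρ
  have h5 : -((γ - 1) * relPotential γ ρ (r t x) * divergence (U t) x) ≤
      (γ - 1) * relPotential γ ρ (r t x) * (3 * C) := by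
    rw [← mul_neg]
    exact mul_le_mul_of_nonneg_left ((neg_le_abs _).trans h3) (by positivity)
  have h6 : 0 ≤ (γ - 1) * (3 * C) * (1 / 2 * (ρ * ‖u - U t x‖ ^ 2)) := by positivity
  have h7 : 0 ≤ 2 * C * relPotential γ ρ (r t x) := by positivity
  linarith

lemma IsSmoothEulerSolution.smooth_pressure_flux (hE : IsSmoothEulerSolution Ω T γ ρE₀ uE₀ r U)
    (hT : 0 < T) : SmoothUpToBoundary Ω T fun t x => r t x ^ γ • U t x :=
  ContDiffOn.smul (hE.smooth_rpow hT γ) hE.smooth_velocity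

/-- The field r^γ U inherits the tangency of U, so its flux through the boundary is zero. -/
lemma IsSmoothEulerSolution.integral_divergence_pressure_flux
    (hE : IsSmoothEulerSolution Ω T γ ρE₀ uE₀ r U) (hΩ : IsBoundedRegularDomain Ω) (hT : 0 < T)
    {t : ℝ} (ht : t ∈ Ioo 0 T) :
    Integrable (fun x => divergence (fun y => r t y ^ γ • U t y) x) (volOn Ω) ∧
    ∫ x, divergence (fun y => r t y ^ γ • U t y) x ∂(volOn Ω) = 0 := by
  have hV := hE.smooth_pressure_flux hT
  have ht' := Ioo_subset_Icc_self ht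
  obtain ⟨C, -, hC⟩ := hV.exists_norm_deriv_le hΩ
  refine ⟨integrable_volOn_of_continuousOn_of_bounded hΩ
    (continuousOn_divergence hΩ.isOpen (hV.contDiffOn_slice ht'))
    fun x hx => abs_divergence_le (hC t ht x hx).2, ?_⟩
  refine integral_divergence_eq_zero_of_tangent hΩ (hV.continuousOn_slice ht')
    (hV.contDiffOn_slice ht') (fun x hx => (hC t ht x hx).2) fun x ν hν => ?_
  rw [inner_smul_left, hE.boundary t ht' x ν hν, mul_zero]

lemma IsSmoothEulerSolution.relEnergy_eq (hE : IsSmoothEulerSolution Ω T γ ρE₀ uE₀ r U)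
    (hΩ : IsBoundedRegularDomain Ω) (hγ : 1 < γ) (hT : 0 < T) {t : ℝ} (ht : t ∈ Icc 0 T)
    {ρ : E3 → ℝ} {u : E3 → E3} (h : IsFiniteEnergyState (volOn Ω) γ ρ u) :
    relEnergy Ω γ ρ u (r t) (U t) = energy Ω γ ρ u - (∫ x, ⟪ρ x • u x, U t x⟫ ∂(volOn Ω))
      + (∫ x, ρ x * massTest γ r U t x ∂(volOn Ω)) + ∫ x, r t x ^ γ ∂(volOn Ω) :=
  (integrable_relEnergy hΩ hγ h (hE.smooth_density.continuousOn_slice ht)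
    (fun _ hx => hE.density_pos hT ht hx) (hE.smooth_velocity.continuousOn_slice ht)).2

lemma IsSmoothEulerSolution.integrable_relEnergy (hE : IsSmoothEulerSolution Ω T γ ρE₀ uE₀ r U)
    (hΩ : IsBoundedRegularDomain Ω) (hγ : 1 < γ) (hT : 0 < T) {t : ℝ} (ht : t ∈ Icc 0 T)
    {ρ : E3 → ℝ} {u : E3 → E3} (h : IsFiniteEnergyState (volOn Ω) γ ρ u) :
    Integrable (fun x => 1 / 2 * (ρ x * ‖u x - U t x‖ ^ 2) + relPotential γ (ρ x) (r t x))
      (volOn Ω) :=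
  (CompressibleNS.integrable_relEnergy hΩ hγ h (hE.smooth_density.continuousOn_slice ht)
    (fun _ hx => hE.density_pos hT ht hx) (hE.smooth_velocity.continuousOn_slice ht)).1

lemma SmoothUpToBoundary.continuousOn_integral {φ : ℝ → E3 → ℝ} (hφ : SmoothUpToBoundary Ω T φ)
    (hΩ : IsBoundedRegularDomain Ω) :
    ContinuousOn (fun t => ∫ x, φ t x ∂(volOn Ω)) (Icc 0 T) := by
  have := hΩ.isFiniteMeasure_volOn
  have := continuousOn_integral_inner_of_weak hΩ (f := fun _ _ => (1 : ℝ)) (φ := φ) (T := T)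
    (fun _ _ => integrable_const _) (fun _ _ => continuousOn_const) (fun _ _ => le_rfl)
    hφ.continuousOn
  simpa using this

namespace IsFiniteEnergyWeakSolution

variable {ε β : ℝ} {ρ₀ : E3 → ℝ} {u₀ : E3 → E3} {ρ : ℝ → E3 → ℝ} {u : ℝ → E3 → E3}

/-- The energy is integrable in time by Fubini; the three other terms of the expansion are
continuous. -/
lemma intervalIntegrable_relEnergy (h : IsFiniteEnergyWeakSolution Ω T γ μ η ε β ρ₀ u₀ ρ u)
    (hst : IsFiniteEnergyState ((timeMeasure T).prod (volOn Ω)) γ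
      (fun z => ρ z.1 z.2) (fun z => u z.1 z.2))
    (hE : IsSmoothEulerSolution Ω T γ ρE₀ uE₀ r U)
    (hΩ : IsBoundedRegularDomain Ω) (hγ : 1 < γ) (hT : 0 < T) :
    IntervalIntegrable (fun t => relEnergy Ω γ (ρ t) (u t) (r t) (U t)) volume 0 T := by
  have := hΩ.isFiniteMeasure_volOn
  have hen : Integrable (fun z : ℝ × E3 => (1 / 2) * ρ z.1 z.2 * ‖u z.1 z.2‖ ^ 2
      + ρ z.1 z.2 ^ γ / (γ - 1)) ((timeMeasure T).prod (volOn Ω)) := by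
    have := (hst.kinetic.const_mul (1 / 2)).fun_add ((hst.integrable_rpow hγ).div_const (γ - 1))
    simpa only [mul_assoc] using this
  have i1 : IntervalIntegrable (fun t => energy Ω γ (ρ t) (u t)) volume 0 T :=
    intervalIntegrable_of_timeMeasure hT.le hen.integral_prod_left
  have hci : ∀ f : ℝ → ℝ, ContinuousOn f (Icc 0 T) → IntervalIntegrable f volume 0 T :=
    fun f hf => ContinuousOn.intervalIntegrable (by rwa [uIcc_of_le hT.le])
  have i2 := hci _ (h.continuousOn_integral_momentum_inner hΩ hγ hE.smooth_velocity)
  have i3 := hci _ (h.continuousOn_integral_density_mul hΩ hγ (hE.smooth_massTest hT))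
  have i4 := hci _ ((hE.smooth_rpow hT γ).continuousOn_integral hΩ)
  refine (((i1.sub i2).add i3).add i4).congr fun t ht => ?_
  rw [uIoc_of_le hT.le] at ht
  exact (hE.relEnergy_eq hΩ hγ hT (Ioc_subset_Icc_self ht)
    (h.isFiniteEnergyState (Ioc_subset_Icc_self ht))).symm

end IsFiniteEnergyWeakSolution

/-- The relative energy inequality for finite energy weak solutions. -/
theorem IsSmoothEulerSolution.exists_relEnergy_le (hE : IsSmoothEulerSolution Ω T γ ρE₀ uE₀ r U)
    (hΩ : IsBoundedRegularDomain Ω) (hγ : 1 < γ) (hμ : 0 ≤ μ) (hη : 0 ≤ η) (hT : 0 < T) :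
    ∃ C K, 0 ≤ C ∧ 0 ≤ K ∧ ∀ (ε β : ℝ) (ρ₀ : E3 → ℝ) (u₀ : E3 → E3) (ρ : ℝ → E3 → ℝ)
      (u : ℝ → E3 → E3), 0 ≤ ε → 0 ≤ β → IsAdmissibleInitialData Ω γ ρ₀ u₀ →
      IsFiniteEnergyWeakSolution Ω T γ μ η ε β ρ₀ u₀ ρ u →
      ∀ᵐ τ ∂(timeMeasure T), relEnergy Ω γ (ρ τ) (u τ) (r τ) (U τ) ≤
        relEnergy Ω γ ρ₀ u₀ (r 0) (U 0) + K * (ε + β)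
          + C * ∫ t in (0 : ℝ)..τ, relEnergy Ω γ (ρ t) (u t) (r t) (U t) := by
  have := hΩ.isFiniteMeasure_volOn
  have := hΩ.isFiniteMeasure_surfaceMeasure
  obtain ⟨C, hC0, hC⟩ := hE.exists_remainder_bound hΩ hγ hT
  obtain ⟨CU, hCU0, hCU⟩ := hE.smooth_velocity.exists_norm_le hΩ
  have hJ := hE.smooth_velocity.memLp_jacobian hΩ
  set DU : ℝ → ℝ := fun t => ∫ x, contraction (viscousStress μ η (jacobian (U t) x))
    (jacobian (U t) x) ∂(volOn Ω) with hDU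
  have hDUi : IntervalIntegrable DU volume 0 T := intervalIntegrable_of_timeMeasure hT.le
    (integrable_contraction_viscousStress μ η hJ hJ).integral_prod_left
  have hDU0 : ∀ t, 0 ≤ DU t := fun t => integral_nonneg fun x =>
    contraction_viscousStress_self_nonneg hμ hη _
  set K₁ : ℝ := ∫ t in (0 : ℝ)..T, DU t
  have hK₁ : 0 ≤ K₁ := intervalIntegral.integral_nonneg hT.le fun t _ => hDU0 t
  set K₂ : ℝ := CU ^ 2 * (surfaceMeasure Ω).real univ with hK₂def
  have hK₂ : 0 ≤ K₂ := by positivity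
  -- K₁ is the dissipation of U over (0,T) and K₂ the squared bound of U times the boundary area.
  -- The constants are fixed before ε, β and the weak solution.
  refine ⟨C, K₁ + T * K₂, hC0, by positivity, ?_⟩
  intro ε β ρ₀ u₀ ρ u hε hβ h₀ h
  have hst := h.isFiniteEnergyState_spaceTime hΩ hγ hμ hη hε hβ
  obtain ⟨G, w, -, hG, -, hw, hwi, hmom, hen⟩ := h.viscous_part
  have hrel := h.intervalIntegrable_relEnergy hst hE hΩ hγ hT
  -- space-time integrability
  have iD := integrable_contraction_viscousStress μ η hG hG
  have iGU := integrable_contraction_viscousStress μ η hG hJ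
  have iUU := integrable_contraction_viscousStress μ η hJ hJ
  have iconv := IsFiniteEnergyWeakSolution.integrable_convection hst h.measurable_velocity hΩ hγ
    hE.smooth_velocity
  have iflux := IsFiniteEnergyWeakSolution.integrable_momentumFlux (μ := μ) (η := η) (ε := ε) hst
    h.measurable_velocity hG hΩ hγ hE.smooth_velocity
  have imass := IsFiniteEnergyWeakSolution.integrable_mass_flux hst hΩ hγ (hE.smooth_massTest hT)
  have ifr := IsFiniteEnergyWeakSolution.integrable_friction hΩ hβ hw hwi hE.smooth_velocity
  have ipr : Integrable (fun z : ℝ × E3 => deriv (fun s => r s z.2 ^ γ) z.1)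
      ((timeMeasure T).prod (volOn Ω)) := by
    obtain ⟨h1, C1, hC1⟩ := (hE.smooth_rpow hT γ).bounded_deriv_time hΩ
    exact Integrable.of_bound h1 C1 hC1
  -- the functions of time
  set D : ℝ → ℝ := fun t => ∫ x, contraction (viscousStress μ η (G t x)) (G t x) ∂(volOn Ω)
  set W : ℝ → ℝ := fun t => ∫ x, ‖w t x‖ ^ 2 ∂(surfaceMeasure Ω)
  set Bu : ℝ → ℝ := fun t =>
    (∫ x, IsFiniteEnergyWeakSolution.momentumFlux γ μ η ε ρ u G U t x ∂(volOn Ω))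
      - ∫ x, β * ⟪w t x, U t x⟫ ∂(surfaceMeasure Ω)
  set Bm : ℝ → ℝ := fun t => ∫ x, (ρ t x * deriv (fun s => massTest γ r U s x) t
        + ρ t x * ⟪u t x, ∇ (massTest γ r U t) x⟫) ∂(volOn Ω)
  set Bp : ℝ → ℝ := fun t => ∫ x, deriv (fun s => r s x ^ γ) t ∂(volOn Ω)
  have tD : IntervalIntegrable D volume 0 T :=
    intervalIntegrable_of_timeMeasure hT.le iD.integral_prod_left
  have tW : IntervalIntegrable (fun t => β * W t) volume 0 T := by
    have := intervalIntegrable_of_timeMeasure hT.le hwi.integral_prod_left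
    simpa only [integral_const_mul] using this
  have tBu : IntervalIntegrable Bu volume 0 T :=
    (intervalIntegrable_of_timeMeasure hT.le iflux.integral_prod_left).sub
      (intervalIntegrable_of_timeMeasure hT.le ifr.integral_prod_left)
  have tBm : IntervalIntegrable Bm volume 0 T :=
    intervalIntegrable_of_timeMeasure hT.le imass.integral_prod_left
  have tBp : IntervalIntegrable Bp volume 0 T :=
    intervalIntegrable_of_timeMeasure hT.le ipr.integral_prod_left
  have tDn : IntervalIntegrable (fun t => -(ε * D t)) volume 0 T := (tD.const_mul ε).neg
  -- the differential inequality
  have key : ∀ᵐ t ∂(timeMeasure T), -(ε * D t) - β * W t - Bu t + Bm t + Bp t ≤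
      C * relEnergy Ω γ (ρ t) (u t) (r t) (U t) + ε * DU t + β * K₂ := by
    filter_upwards [ae_mem_timeMeasure T, iD.prod_right_ae, iGU.prod_right_ae, iUU.prod_right_ae,
      iconv.prod_right_ae, imass.prod_right_ae, ifr.prod_right_ae, ipr.prod_right_ae,
      hwi.prod_right_ae] with t ht jD jGU jUU jconv jmass jfr jpr jw
    have ht' := Ioo_subset_Icc_self ht
    obtain ⟨idiv, hdiv⟩ := hE.integral_divergence_pressure_flux hΩ hT ht
    have irel := hE.integrable_relEnergy hΩ hγ hT ht' (h.isFiniteEnergyState ht')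
    -- Young's inequality leaves a quarter of the dissipation of U, bounded here by the whole.
    have hvisc : -(D t) + ∫ x, contraction (viscousStress μ η (G t x)) (jacobian (U t) x)
        ∂(volOn Ω) ≤ DU t := by
      rw [neg_add_eq_sub, ← integral_sub jGU jD]
      apply integral_mono (jGU.sub jD) jUU
      intro x
      have h1 := contraction_viscousStress_le hμ hη (G t x) (jacobian (U t) x)
      have h2 := contraction_viscousStress_self_nonneg hμ hη (jacobian (U t) x)
      simp only [Pi.sub_apply]
      linarith
    -- Pointwise on the boundary, w·U - |w|² ≤ CU².
    have hfric : -(β * W t) + ∫ x, β * ⟪w t x, U t x⟫ ∂(surfaceMeasure Ω) ≤ β * K₂ := by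
      have e1 : β * W t = ∫ x, β * ‖w t x‖ ^ 2 ∂(surfaceMeasure Ω) :=
        (integral_const_mul _ _).symm
      rw [e1, neg_add_eq_sub, ← integral_sub jfr jw]
      have e2 : β * K₂ = ∫ x, β * CU ^ 2 ∂(surfaceMeasure Ω) := by
        rw [integral_const, smul_eq_mul, hK₂def]; ring
      rw [e2]
      apply integral_mono_ae (jfr.sub jw) (integrable_const _)
      filter_upwards [ae_restrict_mem isClosed_frontier.measurableSet] with x hx
      simp only [Pi.sub_apply]
      rw [← mul_sub]
      gcongr
      have h1 := hCU t ht' x (frontier_subset_closure hx)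
      have h2 := real_inner_le_norm (w t x) (U t x)
      nlinarith [norm_nonneg (w t x), sq_nonneg (‖w t x‖ - CU),
        mul_le_mul_of_nonneg_left h1 (norm_nonneg (w t x))]
    have hflux : (∫ x, IsFiniteEnergyWeakSolution.momentumFlux γ μ η ε ρ u G U t x ∂(volOn Ω)) =
        (∫ x, (⟪ρ t x • u t x, deriv (fun s => U s x) t⟫
          + ρ t x * contraction (tensorSquare (u t x)) (jacobian (U t) x)
          + ρ t x ^ γ * divergence (U t) x) ∂(volOn Ω))
        - ε * ∫ x, contraction (viscousStress μ η (G t x)) (jacobian (U t) x) ∂(volOn Ω) := by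
      rw [← integral_const_mul, ← integral_sub jconv (jGU.const_mul ε)]
      rfl
    have hrem : -(∫ x, (⟪ρ t x • u t x, deriv (fun s => U s x) t⟫
          + ρ t x * contraction (tensorSquare (u t x)) (jacobian (U t) x)
          + ρ t x ^ γ * divergence (U t) x) ∂(volOn Ω)) + Bm t + Bp t ≤
        C * relEnergy Ω γ (ρ t) (u t) (r t) (U t) := by
      -- The divergence term has zero integral, so it can be inserted for free to match the
      -- pointwise remainder.
      have e1 : C * relEnergy Ω γ (ρ t) (u t) (r t) (U t) =
          ∫ x, (C * (1 / 2 * (ρ t x * ‖u t x - U t x‖ ^ 2) + relPotential γ (ρ t x) (r t x))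
            - divergence (fun y => r t y ^ γ • U t y) x) ∂(volOn Ω) := by
        rw [integral_sub (irel.const_mul C) idiv, hdiv, integral_const_mul, sub_zero]; rfl
      have jneg : Integrable (fun x => -(⟪ρ t x • u t x, deriv (fun s => U s x) t⟫
          + ρ t x * contraction (tensorSquare (u t x)) (jacobian (U t) x)
          + ρ t x ^ γ * divergence (U t) x)) (volOn Ω) := jconv.neg
      simp only [Bm, Bp]
      rw [e1, ← integral_neg, ← integral_add jneg jmass, ← integral_add (jneg.fun_add jmass) jpr]
      apply integral_mono_ae ((jneg.fun_add jmass).fun_add jpr) ((irel.const_mul C).fun_sub idiv)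
      filter_upwards [ae_restrict_mem hΩ.isOpen.measurableSet, h.nonneg t ht'] with x hx hρ
      have h1 := hE.remainder_eq hΩ.isOpen hγ hT ht hx (ρ t x) (u t x)
      have h2 := hC t ht x hx (ρ t x) (u t x) hρ
      linarith
    have hvisc' := mul_le_mul_of_nonneg_left hvisc hε
    simp only [Bu]
    rw [hflux]
    linarith
  filter_upwards [hen, ae_mem_timeMeasure T] with τ hτ hm
  have hτ' := Ioo_subset_Icc_self hm
  have b1 := h.momentum_balance hst hG hw hwi hmom hΩ hγ hT hβ hE.smooth_velocity hE.boundary τ hτ'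
  have b2 := h.mass_balance hst hΩ hγ hT (hE.smooth_massTest hT) τ hτ'
  have b3 := (hE.smooth_rpow hT γ).integral_balance hΩ hτ'
  have m := fun {f : ℝ → ℝ} (hf : IntervalIntegrable f volume 0 T) =>
    intervalIntegrable_mono_right hτ' hf
  have hmono := interval_integral_mono_timeMeasure hτ'
    ((((tDn.sub tW).sub tBu).add tBm).add tBp)
    (((hrel.const_mul C).add (hDUi.const_mul ε)).add intervalIntegrable_const) key
  have s1 : ∫ t in (0 : ℝ)..τ, (-(ε * D t) - β * W t - Bu t + Bm t + Bp t) =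
      -(ε * ∫ t in (0 : ℝ)..τ, D t) - β * (∫ t in (0 : ℝ)..τ, W t)
        - (∫ t in (0 : ℝ)..τ, Bu t) + (∫ t in (0 : ℝ)..τ, Bm t) + ∫ t in (0 : ℝ)..τ, Bp t := by
    rw [intervalIntegral.integral_add (m (((tDn.sub tW).sub tBu).add tBm)) (m tBp),
      intervalIntegral.integral_add (m ((tDn.sub tW).sub tBu)) (m tBm),
      intervalIntegral.integral_sub (m (tDn.sub tW)) (m tBu),
      intervalIntegral.integral_sub (m tDn) (m tW),
      intervalIntegral.integral_neg, intervalIntegral.integral_const_mul,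
      intervalIntegral.integral_const_mul]
  have s2 : ∫ t in (0 : ℝ)..τ, (C * relEnergy Ω γ (ρ t) (u t) (r t) (U t) + ε * DU t + β * K₂) =
      C * (∫ t in (0 : ℝ)..τ, relEnergy Ω γ (ρ t) (u t) (r t) (U t))
        + ε * (∫ t in (0 : ℝ)..τ, DU t) + τ * (β * K₂) := by
    rw [intervalIntegral.integral_add (m ((hrel.const_mul C).add (hDUi.const_mul ε)))
        intervalIntegrable_const, intervalIntegral.integral_add (m (hrel.const_mul C))
        (m (hDUi.const_mul ε)), intervalIntegral.integral_const_mul,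
      intervalIntegral.integral_const_mul, intervalIntegral.integral_const]
    simp
  have s3 : ∫ t in (0 : ℝ)..τ, DU t ≤ K₁ :=
    intervalIntegral.integral_mono_interval le_rfl hτ'.1 hτ'.2
      (Eventually.of_forall hDU0) hDUi
  rw [s1, s2] at hmono
  have r1 := hE.relEnergy_eq hΩ hγ hT hτ' (h.isFiniteEnergyState hτ')
  have r0 := hE.relEnergy_eq hΩ hγ hT (t := 0) ⟨le_rfl, hT.le⟩ h₀.isFiniteEnergyState
  have f1 : ε * (∫ t in (0 : ℝ)..τ, DU t) ≤ ε * K₁ := by gcongr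
  have f2 : τ * (β * K₂) ≤ T * (β * K₂) := by gcongr; exact hm.2.le
  have f3 : 0 ≤ β * K₁ := by positivity
  have f4 : 0 ≤ ε * (T * K₂) := by positivity
  have f5 : (K₁ + T * K₂) * (ε + β) = ε * K₁ + T * (β * K₂) + β * K₁ + ε * (T * K₂) := by ring
  rw [f5, r1, r0, b1, b2, b3]
  linarith

end

section

/-! ### The relative energy at every time -/

section

variable {Ω : Set E3} {γ : ℝ} {ρ ρ' : E3 → ℝ} {u u' : E3 → E3}

/-- The conjugate power of ρ^(γ-1) is ρ^γ. Thus ρ(τ)^(γ-1) may serve as a dual test function for the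
weak continuity of the density. -/
lemma IsFiniteEnergyState.memLp_rpow_sub_one (h : IsFiniteEnergyState (volOn Ω) γ ρ u)
    (hγ : 1 < γ) :
    MemLp (fun x => ρ x ^ (γ - 1)) (ENNReal.ofReal (γ / (γ - 1))) (volOn Ω) := by
  have h1 : 0 < γ - 1 := by linarith
  have h2 : 0 < γ / (γ - 1) := by positivity
  have hm : AEStronglyMeasurable (fun x => ρ x ^ (γ - 1)) (volOn Ω) :=
    (h.memLp.1.aemeasurable.pow_const _).aestronglyMeasurable
  rw [← integrable_norm_rpow_iff hm (by simpa using h2) (by simp), ENNReal.toReal_ofReal h2.le]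
  refine (h.integrable_rpow hγ).congr ?_
  filter_upwards [h.nonneg] with x hx
  rw [Real.norm_of_nonneg (Real.rpow_nonneg hx _), ← Real.rpow_mul hx]
  congr 1
  field_simp

/-- The energy lies above its tangent, with respect to the density, at `ρ'`. -/
lemma IsFiniteEnergyState.tangent_le_energy (h : IsFiniteEnergyState (volOn Ω) γ ρ u)
    (h' : IsFiniteEnergyState (volOn Ω) γ ρ' u') (hγ : 1 < γ) :
    1 / 2 * (∫ x, ρ x * ‖u x‖ ^ 2 ∂(volOn Ω))
      + γ / (γ - 1) * (∫ x, ⟪ρ x, ρ' x ^ (γ - 1)⟫ ∂(volOn Ω)) - ∫ x, ρ' x ^ γ ∂(volOn Ω)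
      ≤ energy Ω γ ρ u := by
  have h1 : 0 < γ - 1 := by linarith
  have hconj : ENNReal.HolderConjugate (ENNReal.ofReal γ) (ENNReal.ofReal (γ / (γ - 1))) :=
    (Real.HolderConjugate.conjExponent hγ).ennrealOfReal
  have i1 : Integrable (fun x => ⟪ρ x, ρ' x ^ (γ - 1)⟫) (volOn Ω) := by
    have := h.memLp.integrable_mul (h'.memLp_rpow_sub_one hγ)
    refine this.congr (Eventually.of_forall fun x => ?_)
    simp [mul_comm]
  have i2 := h'.integrable_rpow hγ
  rw [← integral_const_mul, ← integral_const_mul, ← integral_add (h.kinetic.const_mul _)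
    (i1.const_mul _), ← integral_sub ((h.kinetic.const_mul _).fun_add (i1.const_mul _)) i2, energy]
  apply integral_mono_ae (((h.kinetic.const_mul _).fun_add (i1.const_mul _)).fun_sub i2)
    (integrable_energy h hγ)
  filter_upwards [h.nonneg, h'.nonneg] with x hx hx'
  have k1 := rpow_tangent_le hγ hx' hx
  have k2 : ρ' x ^ γ = ρ' x ^ (γ - 1) * ρ' x := by
    rw [← Real.rpow_add_one' hx' (by linarith)]; simp
  have k3 : ⟪ρ x, ρ' x ^ (γ - 1)⟫ = ρ' x ^ (γ - 1) * ρ x := by simp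
  have k4 : γ / (γ - 1) * (ρ' x ^ (γ - 1) * ρ x) - ρ' x ^ γ ≤ ρ x ^ γ / (γ - 1) := by
    rw [le_div_iff₀ h1]
    have : (γ / (γ - 1) * (ρ' x ^ (γ - 1) * ρ x) - ρ' x ^ γ) * (γ - 1) =
        ρ' x ^ γ + γ * ρ' x ^ (γ - 1) * (ρ x - ρ' x) := by
      rw [k2]; field_simp; ring
    rw [this]; exact k1
  simp only [k3]
  linarith

/-- The equality case of `tangent_le_energy`: a tangent touches the graph at its own base point. -/
lemma IsFiniteEnergyState.energy_eq_tangent (h : IsFiniteEnergyState (volOn Ω) γ ρ u)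
    (hγ : 1 < γ) :
    energy Ω γ ρ u = 1 / 2 * (∫ x, ρ x * ‖u x‖ ^ 2 ∂(volOn Ω))
      + γ / (γ - 1) * (∫ x, ⟪ρ x, ρ x ^ (γ - 1)⟫ ∂(volOn Ω)) - ∫ x, ρ x ^ γ ∂(volOn Ω) := by
  have h1 : γ - 1 ≠ 0 := by linarith
  have e1 : ∫ x, ⟪ρ x, ρ x ^ (γ - 1)⟫ ∂(volOn Ω) = ∫ x, ρ x ^ γ ∂(volOn Ω) := by
    apply integral_congr_ae
    filter_upwards [h.nonneg] with x hx
    have : ρ x ^ γ = ρ x ^ (γ - 1) * ρ x := by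
      rw [← Real.rpow_add_one' hx (by linarith)]; simp
    simp [this]
  have e2 : energy Ω γ ρ u = 1 / 2 * (∫ x, ρ x * ‖u x‖ ^ 2 ∂(volOn Ω))
      + (∫ x, ρ x ^ γ ∂(volOn Ω)) / (γ - 1) := by
    rw [energy, ← integral_const_mul, ← integral_div, ← integral_add (h.kinetic.const_mul _)
      ((h.integrable_rpow hγ).div_const _)]
    simp only [mul_assoc]
  rw [e1, e2]
  field_simp
  ring

end

lemma le_of_ae_le_of_continuousOn {T c : ℝ} {L : ℝ → ℝ} (hL : ContinuousOn L (Icc 0 T))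
    (h : ∀ᵐ t ∂(timeMeasure T), L t ≤ c) {τ : ℝ} (hτ : τ ∈ Ioo 0 T) : L τ ≤ c := by
  rw [timeMeasure, ae_restrict_iff' measurableSet_Ioo] at h
  by_contra! hc
  have h1 : ∀ᶠ t in 𝓝 τ, c < L t ∧ t ∈ Ioo 0 T :=
    ((hL.continuousAt (Icc_mem_nhds hτ.1 hτ.2)).eventually (lt_mem_nhds hc)).and
      (isOpen_Ioo.mem_nhds hτ)
  obtain ⟨t, ht, ht'⟩ := (Measure.dense_of_ae h).inter_nhds_nonempty h1
  exact absurd (ht ht'.2) (not_le.2 ht'.1)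

variable {Ω : Set E3} {T γ : ℝ} {ρE₀ : E3 → ℝ} {uE₀ : E3 → E3} {r : ℝ → E3 → ℝ}
  {U : ℝ → E3 → E3}

/-- Lower semicontinuity at τ. Replacing the internal energy by its tangent at ρ(τ) yields a
function L that is continuous in time, lies below the relative energy and equals it at τ; the bound
on L extends by continuity. The kinetic part is already continuous and needs no tangent. -/
lemma IsFiniteEnergyWeakSolution.relEnergy_le_of_ae {μ η ε β c : ℝ} {ρ₀ : E3 → ℝ}
    {u₀ : E3 → E3} {ρ : ℝ → E3 → ℝ} {u : ℝ → E3 → E3}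
    (h : IsFiniteEnergyWeakSolution Ω T γ μ η ε β ρ₀ u₀ ρ u)
    (hE : IsSmoothEulerSolution Ω T γ ρE₀ uE₀ r U)
    (hΩ : IsBoundedRegularDomain Ω) (hγ : 1 < γ) (hT : 0 < T)
    (hc : ∀ᵐ t ∂(timeMeasure T), relEnergy Ω γ (ρ t) (u t) (r t) (U t) ≤ c)
    {τ : ℝ} (hτ : τ ∈ Ioo 0 T) : relEnergy Ω γ (ρ τ) (u τ) (r τ) (U τ) ≤ c := by
  have hτ' := Ioo_subset_Icc_self hτ
  have sτ := h.isFiniteEnergyState hτ'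
  set L : ℝ → ℝ := fun s => (1 / 2 * (∫ x, ρ s x * ‖u s x‖ ^ 2 ∂(volOn Ω))
      + γ / (γ - 1) * (∫ x, ⟪ρ s x, ρ τ x ^ (γ - 1)⟫ ∂(volOn Ω)) - ∫ x, ρ τ x ^ γ ∂(volOn Ω))
      - (∫ x, ⟪ρ s x • u s x, U s x⟫ ∂(volOn Ω))
      + (∫ x, ρ s x * IsSmoothEulerSolution.massTest γ r U s x ∂(volOn Ω))
      + ∫ x, r s x ^ γ ∂(volOn Ω) with hLdef
  have hL : ContinuousOn L (Icc 0 T) := by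
    refine ContinuousOn.add (ContinuousOn.add (ContinuousOn.sub (ContinuousOn.sub
      (ContinuousOn.add (continuousOn_const.mul (h.continuousOn_kinetic hΩ))
        (continuousOn_const.mul (h.continuousOn_density hγ (sτ.memLp_rpow_sub_one hγ))))
        continuousOn_const) (h.continuousOn_integral_momentum_inner hΩ hγ hE.smooth_velocity))
      (h.continuousOn_integral_density_mul hΩ hγ (hE.smooth_massTest hT)))
      ((hE.smooth_rpow hT γ).continuousOn_integral hΩ)
  have h1 : ∀ᵐ t ∂(timeMeasure T), L t ≤ c := by
    filter_upwards [hc, ae_mem_timeMeasure T] with t ht htm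
    have ht' := Ioo_subset_Icc_self htm
    have st := h.isFiniteEnergyState ht'
    have k1 := hE.relEnergy_eq hΩ hγ hT ht' st
    have k2 := st.tangent_le_energy sτ hγ
    simp only [hLdef]
    linarith
  have h2 := le_of_ae_le_of_continuousOn hL h1 hτ
  rw [hE.relEnergy_eq hΩ hγ hT hτ' sτ, sτ.energy_eq_tangent hγ]
  exact h2

/-! ### Relative energy and distance -/

namespace IsSmoothEulerSolution

lemma relEnergy_density_nonneg (hE : IsSmoothEulerSolution Ω T γ ρE₀ uE₀ r U)
    (hΩ : IsBoundedRegularDomain Ω) (hγ : 1 < γ) (hT : 0 < T) {t : ℝ} (ht : t ∈ Icc 0 T)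
    {ρ : E3 → ℝ} {u : E3 → E3} (h : IsFiniteEnergyState (volOn Ω) γ ρ u) :
    ∀ᵐ x ∂(volOn Ω),
      0 ≤ 1 / 2 * (ρ x * ‖u x - U t x‖ ^ 2) + relPotential γ (ρ x) (r t x) := by
  filter_upwards [ae_restrict_mem hΩ.isOpen.measurableSet, h.nonneg] with x hx hρ
  have := relPotential_nonneg hγ hρ (hE.density_pos hT ht (subset_closure hx))
  positivity

lemma relEnergy_nonneg (hE : IsSmoothEulerSolution Ω T γ ρE₀ uE₀ r U)
    (hΩ : IsBoundedRegularDomain Ω) (hγ : 1 < γ) (hT : 0 < T) {t : ℝ} (ht : t ∈ Icc 0 T)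
    {ρ : E3 → ℝ} {u : E3 → E3} (h : IsFiniteEnergyState (volOn Ω) γ ρ u) :
    0 ≤ relEnergy Ω γ ρ u (r t) (U t) :=
  integral_nonneg_of_ae (hE.relEnergy_density_nonneg hΩ hγ hT ht h)

lemma ofReal_relEnergy (hE : IsSmoothEulerSolution Ω T γ ρE₀ uE₀ r U)
    (hΩ : IsBoundedRegularDomain Ω) (hγ : 1 < γ) (hT : 0 < T) {t : ℝ} (ht : t ∈ Icc 0 T)
    {ρ : E3 → ℝ} {u : E3 → E3} (h : IsFiniteEnergyState (volOn Ω) γ ρ u) :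
    ENNReal.ofReal (relEnergy Ω γ ρ u (r t) (U t)) = ∫⁻ x, ENNReal.ofReal
      (1 / 2 * (ρ x * ‖u x - U t x‖ ^ 2) + relPotential γ (ρ x) (r t x)) ∂(volOn Ω) :=
  ofReal_integral_eq_lintegral_ofReal (hE.integrable_relEnergy hΩ hγ hT ht h)
    (hE.relEnergy_density_nonneg hΩ hγ hT ht h)

end IsSmoothEulerSolution

lemma lintegral_ofReal_abs_rpow {α : Type*} [MeasurableSpace α] {ν : Measure α} (hγ : 1 < γ)
    (f : α → ℝ) :
    ∫⁻ x, ENNReal.ofReal (|f x| ^ γ) ∂ν = eLpNorm f (ENNReal.ofReal γ) ν ^ γ := by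
  have h0 : 0 < γ := by linarith
  rw [eLpNorm_eq_lintegral_rpow_enorm_toReal (by simpa using h0) (by simp),
    ENNReal.toReal_ofReal h0.le, ← ENNReal.rpow_mul, one_div_mul_cancel h0.ne', ENNReal.rpow_one]
  refine lintegral_congr fun x => ?_
  rw [Real.enorm_eq_ofReal_abs, ENNReal.ofReal_rpow_of_nonneg (abs_nonneg _) h0.le]

/-- The relative energy controls the distance. -/
lemma IsSmoothEulerSolution.exists_stateDistance_le
    (hE : IsSmoothEulerSolution Ω T γ ρE₀ uE₀ r U) (hΩ : IsBoundedRegularDomain Ω) (hγ : 1 < γ)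
    (hT : 0 < T) {κ : ℝ} (hκ : 0 < κ) :
    ∃ C, 0 ≤ C ∧ ∀ t ∈ Icc 0 T, ∀ (ρ : E3 → ℝ) (u : E3 → E3),
      IsFiniteEnergyState (volOn Ω) γ ρ u →
      stateDistance Ω γ (1 / 2) ρ u (r t) (U t) ≤
        ENNReal.ofReal (κ + C * relEnergy Ω γ ρ u (r t) (U t)) ^ γ⁻¹
          + ENNReal.ofReal (relEnergy Ω γ ρ u (r t) (U t)) := by
  have := hΩ.isFiniteMeasure_volOn
  have h0 : 0 < γ := by linarith
  obtain ⟨a, b, ha, hb, hab⟩ := hE.exists_density_bounds hT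
  set V := (volOn Ω).real univ
  have hV : 0 ≤ V := measureReal_nonneg
  -- The slack is scaled so that, after multiplication by r^γ ≤ b^γ and integration over a volume V,
  -- it contributes at most κ.
  obtain ⟨C, hC, hCs⟩ := exists_abs_sub_one_rpow_le hγ
    (κ := κ / (b ^ γ * (V + 1))) (by positivity)
  refine ⟨C, hC.le, fun t ht ρ u h => ?_⟩
  have hpt : ∀ᵐ x ∂(volOn Ω), |ρ x - r t x| ^ γ ≤ κ / (V + 1)
      + C * (1 / 2 * (ρ x * ‖u x - U t x‖ ^ 2) + relPotential γ (ρ x) (r t x)) := by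
    filter_upwards [ae_restrict_mem hΩ.isOpen.measurableSet, h.nonneg] with x hx hρ
    have hr := hE.density_pos hT ht (subset_closure hx)
    have k1 := hCs (ρ x / r t x) (by positivity)
    have k2 : |ρ x - r t x| ^ γ = r t x ^ γ * |ρ x / r t x - 1| ^ γ := by
      rw [← Real.mul_rpow hr.le (abs_nonneg _)]
      congr 1
      rw [← abs_of_pos hr, ← abs_mul, abs_of_pos hr]
      congr 1
      field_simp
    have k3 : r t x ^ γ ≤ b ^ γ :=
      Real.rpow_le_rpow hr.le (hab t ht x (subset_closure hx)).2 h0.le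
    have k4 : r t x ^ γ * (κ / (b ^ γ * (V + 1))) ≤ κ / (V + 1) := by
      calc _ ≤ b ^ γ * (κ / (b ^ γ * (V + 1))) := by gcongr
        _ = κ / (V + 1) := by field_simp
    rw [k2, relPotential_eq_mul hr hρ]
    have k5 : 0 ≤ C * (1 / 2 * (ρ x * ‖u x - U t x‖ ^ 2)) := by positivity
    calc _ ≤ r t x ^ γ * (κ / (b ^ γ * (V + 1)) + C * relPotential γ (ρ x / r t x) 1) := by gcongr
      _ ≤ _ := by linarith
  have hi := hE.integrable_relEnergy hΩ hγ hT ht h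
  have hnn := hE.relEnergy_density_nonneg hΩ hγ hT ht h
  have hν : eLpNorm (fun x => ρ x - r t x) (ENNReal.ofReal γ) (volOn Ω) ^ γ ≤
      ENNReal.ofReal (κ + C * relEnergy Ω γ ρ u (r t) (U t)) := by
    rw [← lintegral_ofReal_abs_rpow hγ]
    calc _ ≤ ∫⁻ x, ENNReal.ofReal (κ / (V + 1) + C * (1 / 2 * (ρ x * ‖u x - U t x‖ ^ 2)
          + relPotential γ (ρ x) (r t x))) ∂(volOn Ω) := by
          apply lintegral_mono_ae
          filter_upwards [hpt] with x hx using ENNReal.ofReal_le_ofReal hx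
      _ = ENNReal.ofReal (∫ x, (κ / (V + 1) + C * (1 / 2 * (ρ x * ‖u x - U t x‖ ^ 2)
          + relPotential γ (ρ x) (r t x))) ∂(volOn Ω)) := by
          rw [ofReal_integral_eq_lintegral_ofReal
            ((integrable_const _).fun_add (hi.const_mul C))]
          filter_upwards [hnn] with x hx
          positivity
      _ ≤ _ := by
          apply ENNReal.ofReal_le_ofReal
          rw [integral_add (integrable_const _) (hi.const_mul C), integral_const,
            integral_const_mul, smul_eq_mul]
          have : V * (κ / (V + 1)) ≤ κ := by
            rw [mul_div_assoc', div_le_iff₀ (by positivity)]; nlinarith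
          exact add_le_add this le_rfl
  refine add_le_add ?_ ?_
  · rw [← ENNReal.rpow_rpow_inv h0.ne'
      (eLpNorm (fun x => ρ x - r t x) (ENNReal.ofReal γ) (volOn Ω))]
    exact ENNReal.rpow_le_rpow hν (by positivity)
  · rw [hE.ofReal_relEnergy hΩ hγ hT ht h]
    apply lintegral_mono_ae
    filter_upwards [ae_restrict_mem hΩ.isOpen.measurableSet, h.nonneg] with x hx hρ
    apply ENNReal.ofReal_le_ofReal
    have := relPotential_nonneg hγ hρ (hE.density_pos hT ht (subset_closure hx))
    linarith

/-- The distance controls the relative energy. -/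
lemma IsSmoothEulerSolution.exists_relEnergy_le_stateDistance
    (hE : IsSmoothEulerSolution Ω T γ ρE₀ uE₀ r U) (hΩ : IsBoundedRegularDomain Ω) (hγ : 1 < γ)
    (hT : 0 < T) :
    ∃ C K : ℝ≥0∞, C ≠ ⊤ ∧ K ≠ ⊤ ∧ ∀ t ∈ Icc 0 T, ∀ (ρ : E3 → ℝ) (u : E3 → E3),
      IsFiniteEnergyState (volOn Ω) γ ρ u →
      ENNReal.ofReal (relEnergy Ω γ ρ u (r t) (U t)) ≤
        stateDistance Ω γ 1 ρ u (r t) (U t)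
          + C * (stateDistance Ω γ 1 ρ u (r t) (U t) ^ γ
            + K * stateDistance Ω γ 1 ρ u (r t) (U t)) := by
  have := hΩ.isFiniteMeasure_volOn
  have h0 : 0 < γ := by linarith
  obtain ⟨a, b, ha, hb, hab⟩ := hE.exists_density_bounds hT
  obtain ⟨C, hC, hCs⟩ := exists_relPotential_one_le hγ
  -- Undoing the scaling by r gives the coefficients 1 and r^(γ-1) to |f|^γ and |f|; B dominates
  -- both.
  set B : ℝ := max 1 (b ^ (γ - 1)) with hB
  have hB1 : 1 ≤ B := le_max_left _ _
  refine ⟨ENNReal.ofReal (C * B),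
    (volOn Ω) univ ^ (1 / (1 : ℝ≥0∞).toReal - 1 / (ENNReal.ofReal γ).toReal),
    ENNReal.ofReal_ne_top, ENNReal.rpow_ne_top_of_nonneg ?_ (measure_ne_top _ _),
    fun t ht ρ u h => ?_⟩
  · rw [ENNReal.toReal_one, ENNReal.toReal_ofReal h0.le, sub_nonneg, div_one,
      div_le_one h0]
    exact hγ.le
  set f : E3 → ℝ := fun x => ρ x - r t x with hf
  set d := stateDistance Ω γ 1 ρ u (r t) (U t) with hd
  have hfm : AEStronglyMeasurable f (volOn Ω) :=
    h.memLp.1.sub (aestronglyMeasurable_volOn hΩ (hE.smooth_density.continuousOn_slice ht))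
  have hdf : eLpNorm f (ENNReal.ofReal γ) (volOn Ω) ≤ d := le_self_add
  have hdk : ∫⁻ x, ENNReal.ofReal (1 * (ρ x * ‖u x - U t x‖ ^ 2)) ∂(volOn Ω) ≤ d := le_add_self
  have hm1 : AEMeasurable (fun x => ENNReal.ofReal (|f x| ^ γ)) (volOn Ω) :=
    (hfm.norm.aemeasurable.pow_const γ).ennreal_ofReal
  have hm2 : AEMeasurable (fun x => ENNReal.ofReal |f x|) (volOn Ω) :=
    hfm.norm.aemeasurable.ennreal_ofReal
  rw [hE.ofReal_relEnergy hΩ hγ hT ht h]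
  calc _ ≤ ∫⁻ x, (ENNReal.ofReal (1 * (ρ x * ‖u x - U t x‖ ^ 2)) + ENNReal.ofReal (C * B) *
        (ENNReal.ofReal (|f x| ^ γ) + ENNReal.ofReal |f x|)) ∂(volOn Ω) := by
        apply lintegral_mono_ae
        filter_upwards [ae_restrict_mem hΩ.isOpen.measurableSet, h.nonneg] with x hx hρ
        have hr := hE.density_pos hT ht (subset_closure hx)
        have hrb := (hab t ht x (subset_closure hx)).2
        have k0 : 0 ≤ ρ x * ‖u x - U t x‖ ^ 2 := by positivity
        have k1 : ρ x / r t x - 1 = f x / r t x := by rw [hf]; field_simp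
        have k2 := hCs (ρ x / r t x) (by positivity)
        rw [k1, abs_div, abs_of_pos hr, Real.div_rpow (abs_nonneg _) hr.le] at k2
        have k3 : r t x ^ γ = r t x ^ (γ - 1) * r t x := by
          rw [← Real.rpow_add_one hr.ne']; simp
        have k4 : r t x ^ (γ - 1) ≤ B :=
          (Real.rpow_le_rpow hr.le hrb (by linarith)).trans (le_max_right _ _)
        have k5 : relPotential γ (ρ x) (r t x) ≤ C * B * (|f x| ^ γ + |f x|) := by
          rw [relPotential_eq_mul hr hρ]
          have hp : 0 < r t x ^ γ := by positivity
          calc _ ≤ r t x ^ γ * (C * (|f x| ^ γ / r t x ^ γ + |f x| / r t x)) := by gcongr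
            _ = C * (1 * |f x| ^ γ + r t x ^ (γ - 1) * |f x|) := by
              rw [mul_left_comm, mul_add, mul_div_cancel₀ _ hp.ne', one_mul]
              congr 2
              rw [k3]; field_simp
            _ ≤ C * (B * |f x| ^ γ + B * |f x|) := by gcongr
            _ = _ := by ring
        rw [← ENNReal.ofReal_add (by positivity) (by positivity),
          ← ENNReal.ofReal_mul (by positivity),
          ← ENNReal.ofReal_add (by positivity) (by positivity)]
        apply ENNReal.ofReal_le_ofReal
        linarith
    _ = (∫⁻ x, ENNReal.ofReal (1 * (ρ x * ‖u x - U t x‖ ^ 2)) ∂(volOn Ω))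
        + ENNReal.ofReal (C * B) * ((∫⁻ x, ENNReal.ofReal (|f x| ^ γ) ∂(volOn Ω))
          + ∫⁻ x, ENNReal.ofReal |f x| ∂(volOn Ω)) := by
        have hm3 : AEMeasurable (fun x => ENNReal.ofReal (|f x| ^ γ) + ENNReal.ofReal |f x|)
            (volOn Ω) := hm1.add hm2
        rw [lintegral_add_right' _ (hm3.const_mul _),
          lintegral_const_mul' _ _ ENNReal.ofReal_ne_top, lintegral_add_left' hm1]
    _ ≤ _ := by
        have e1 : ∫⁻ x, ENNReal.ofReal |f x| ∂(volOn Ω) = eLpNorm f 1 (volOn Ω) := by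
          rw [eLpNorm_one_eq_lintegral_enorm]
          simp_rw [Real.enorm_eq_ofReal_abs]
        -- Hölder on the bounded domain turns the L¹ norm into the L^γ norm, with the power 1 - 1/γ
        -- of the volume as constant K.
        have e2 := eLpNorm_le_eLpNorm_mul_rpow_measure_univ (p := 1) (q := ENNReal.ofReal γ)
          (by rw [← ENNReal.ofReal_one]; exact ENNReal.ofReal_le_ofReal hγ.le) hfm
        rw [lintegral_ofReal_abs_rpow hγ, e1]
        gcongr
        refine e2.trans ?_
        rw [mul_comm]
        gcongr

/-- The initial condition prescribes the momentum; since the density is positive, it determines the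
velocity in Ω. -/
lemma IsSmoothEulerSolution.stateDistance_initial
    (hE : IsSmoothEulerSolution Ω T γ ρE₀ uE₀ r U) (hΩ : IsBoundedRegularDomain Ω) (hT : 0 < T)
    (c : ℝ) (ρ : E3 → ℝ) (u : E3 → E3) :
    stateDistance Ω γ c ρ u (r 0) (U 0) = stateDistance Ω γ c ρ u ρE₀ uE₀ := by
  have h1 : ∀ x ∈ Ω, r 0 x = ρE₀ x ∧ U 0 x = uE₀ x := by
    intro x hx
    have hr := hE.initial_density x hx
    have hp := hE.density_pos hT (t := 0) ⟨le_rfl, hT.le⟩ (subset_closure hx)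
    refine ⟨hr, ?_⟩
    have hm := hE.initial_momentum x hx
    rw [← hr] at hm
    exact smul_right_injective _ hp.ne' hm
  unfold stateDistance
  congr 1
  · apply eLpNorm_congr_ae
    filter_upwards [ae_restrict_mem hΩ.isOpen.measurableSet] with x hx
    rw [(h1 x hx).1]
  · apply lintegral_congr_ae
    filter_upwards [ae_restrict_mem hΩ.isOpen.measurableSet] with x hx
    rw [(h1 x hx).2]

/-- The relative energy is controlled, at every time, by its initial value and by the viscosity
and friction coefficients. -/
lemma IsSmoothEulerSolution.exists_relEnergy_le_initial {μ η : ℝ}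
    (hE : IsSmoothEulerSolution Ω T γ ρE₀ uE₀ r U)
    (hΩ : IsBoundedRegularDomain Ω) (hγ : 1 < γ) (hμ : 0 ≤ μ) (hη : 0 ≤ η) (hT : 0 < T) :
    ∃ C K : ℝ, ∀ (ε β : ℝ) (ρ₀ : E3 → ℝ) (u₀ : E3 → E3) (ρ : ℝ → E3 → ℝ)
      (u : ℝ → E3 → E3), 0 ≤ ε → 0 ≤ β → IsAdmissibleInitialData Ω γ ρ₀ u₀ →
      IsFiniteEnergyWeakSolution Ω T γ μ η ε β ρ₀ u₀ ρ u →
      ∀ τ ∈ Ioo 0 T, relEnergy Ω γ (ρ τ) (u τ) (r τ) (U τ) ≤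
        (relEnergy Ω γ ρ₀ u₀ (r 0) (U 0) + K * (ε + β)) * C := by
  obtain ⟨C, K, hC, hK, hCK⟩ := hE.exists_relEnergy_le hΩ hγ hμ hη hT
  refine ⟨Real.exp (C * T), K, fun ε β ρ₀ u₀ ρ u hε hβ h₀ h τ hτ => ?_⟩
  have hR := hE.relEnergy_nonneg hΩ hγ hT (t := 0) ⟨le_rfl, hT.le⟩ h₀.isFiniteEnergyState
  have hst := h.isFiniteEnergyState_spaceTime hΩ hγ hμ hη hε hβ
  refine h.relEnergy_le_of_ae hE hΩ hγ hT ?_ hτ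
  exact gronwall_ae hT.le hC (by positivity) (h.intervalIntegrable_relEnergy hst hE hΩ hγ hT)
    (hCK ε β ρ₀ u₀ ρ u hε hβ h₀ h)

end

end

end CompressibleNS

/-! ### The limit of vanishing viscosity and friction. -/

open CompressibleNS in
theorem mainTheorem2
    (Ω : Set E3) (hΩ : IsBoundedRegularDomain Ω)
    (γ μ η T : ℝ) (hγ : 3 / 2 < γ) (hμ : 0 < μ) (hη : 0 ≤ η) (hT : 0 < T)
    (ρE₀ : E3 → ℝ) (uE₀ : E3 → E3) (ρE : ℝ → E3 → ℝ) (uE : ℝ → E3 → E3)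
    (hE : IsSmoothEulerSolution Ω T γ ρE₀ uE₀ ρE uE)
    (β : ℝ → ℝ) (hβ : ∀ ε ∈ Set.Ioo (0 : ℝ) 1, 0 ≤ β ε)
    (ρ₀ : ℝ → E3 → ℝ) (u₀ : ℝ → E3 → E3)
    (h₀ : ∀ ε ∈ Set.Ioo (0 : ℝ) 1, IsAdmissibleInitialData Ω γ (ρ₀ ε) (u₀ ε))
    (ρ : ℝ → ℝ → E3 → ℝ) (u : ℝ → ℝ → E3 → E3)
    (hNS : ∀ ε ∈ Set.Ioo (0 : ℝ) 1,
      IsFiniteEnergyWeakSolution Ω T γ μ η ε (β ε) (ρ₀ ε) (u₀ ε) (ρ ε) (u ε))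
    (hinit : Filter.Tendsto (fun ε => stateDistance Ω γ 1 (ρ₀ ε) (u₀ ε) ρE₀ uE₀)
      (nhdsWithin 0 (Set.Ioi 0)) (nhds 0))
    (hβ₀ : Filter.Tendsto β (nhdsWithin 0 (Set.Ioi 0)) (nhds 0)) :
    Filter.Tendsto
      (fun ε => ⨆ t ∈ Set.Ioo (0 : ℝ) T,
        stateDistance Ω γ (1 / 2) (ρ ε t) (u ε t) (ρE t) (uE t))
      (nhdsWithin 0 (Set.Ioi 0)) (nhds 0) := by
  have hγ1 : 1 < γ := by linarith
  have hγ0 : 0 < γ := by linarith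
  have hmem : ∀ᶠ ε in 𝓝[>] (0 : ℝ), ε ∈ Ioo (0 : ℝ) 1 := Ioo_mem_nhdsGT one_pos
  have h0T : (0 : ℝ) ∈ Icc 0 T := ⟨le_rfl, hT.le⟩
  obtain ⟨C, K, hCK⟩ := hE.exists_relEnergy_le_initial hΩ hγ1 hμ.le hη hT
  set R : ℝ → ℝ := fun ε => relEnergy Ω γ (ρ₀ ε) (u₀ ε) (ρE 0) (uE 0)
  have hR : Tendsto R (𝓝[>] 0) (𝓝 0) := by
    obtain ⟨A, B, hA, hB, hAB⟩ := hE.exists_relEnergy_le_stateDistance hΩ hγ1 hT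
    have hg : Tendsto (fun ε => stateDistance Ω γ 1 (ρ₀ ε) (u₀ ε) ρE₀ uE₀
        + A * (stateDistance Ω γ 1 (ρ₀ ε) (u₀ ε) ρE₀ uE₀ ^ γ
          + B * stateDistance Ω γ 1 (ρ₀ ε) (u₀ ε) ρE₀ uE₀)) (𝓝[>] 0) (𝓝 0) := by
      have h1 := (ENNReal.continuous_rpow_const (y := γ)).tendsto 0
      rw [ENNReal.zero_rpow_of_pos hγ0] at h1
      have h2 := hinit.add (ENNReal.Tendsto.const_mul ((h1.comp hinit).add
        (ENNReal.Tendsto.const_mul hinit (Or.inr hB))) (Or.inr hA))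
      simpa using h2
    have h3 : Tendsto (fun ε => ENNReal.ofReal (R ε)) (𝓝[>] 0) (𝓝 0) := by
      refine tendsto_of_tendsto_of_tendsto_of_le_of_le' tendsto_const_nhds hg
        (Eventually.of_forall fun _ => zero_le) ?_
      filter_upwards [hmem] with ε hε
      have := hAB 0 h0T _ _ (h₀ ε hε).isFiniteEnergyState
      rwa [hE.stateDistance_initial hΩ hT] at this
    have h4 := (ENNReal.tendsto_toReal ENNReal.zero_ne_top).comp h3
    rw [ENNReal.toReal_zero] at h4
    refine h4.congr' ?_
    filter_upwards [hmem] with ε hε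
    exact ENNReal.toReal_ofReal
      (hE.relEnergy_nonneg hΩ hγ1 hT h0T (h₀ ε hε).isFiniteEnergyState)
  set M : ℝ → ℝ := fun ε => (R ε + K * (ε + β ε)) * C
  have hM : Tendsto M (𝓝[>] 0) (𝓝 0) := by
    have h1 : Tendsto (fun ε : ℝ => ε) (𝓝[>] 0) (𝓝 0) := nhdsWithin_le_nhds
    simpa using (hR.add ((h1.add hβ₀).const_mul K)).mul_const C
  rw [ENNReal.tendsto_nhds_zero]
  intro δ hδ
  -- κ is fixed before ε, because the constant A below depends on it; its contribution alone is
  -- already below δ.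
  obtain ⟨κ, hκδ, hκ⟩ : ∃ κ : ℝ, ENNReal.ofReal κ ^ γ⁻¹ < δ ∧ 0 < κ := by
    have h1 : Tendsto (fun κ : ℝ => ENNReal.ofReal κ ^ γ⁻¹) (𝓝[>] 0) (𝓝 0) := by
      have h2 : Continuous fun κ : ℝ => ENNReal.ofReal κ ^ γ⁻¹ :=
        ENNReal.continuous_rpow_const.comp ENNReal.continuous_ofReal
      have h3 := h2.tendsto 0
      rw [ENNReal.ofReal_zero, ENNReal.zero_rpow_of_pos (by positivity)] at h3
      exact h3.mono_left nhdsWithin_le_nhds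
    exact ((h1.eventually (gt_mem_nhds hδ)).and self_mem_nhdsWithin).exists
  obtain ⟨A, hA, hAd⟩ := hE.exists_stateDistance_le hΩ hγ1 hT hκ
  -- With κ frozen, the bound tends to the contribution of κ as M ε → 0, hence is eventually below
  -- δ, uniformly in t.
  have hlim : Tendsto (fun ε => ENNReal.ofReal (κ + A * M ε) ^ γ⁻¹ + ENNReal.ofReal (M ε))
      (𝓝[>] 0) (𝓝 (ENNReal.ofReal κ ^ γ⁻¹)) := by
    have h1 : Tendsto (fun ε => κ + A * M ε) (𝓝[>] 0) (𝓝 κ) := by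
      simpa using (hM.const_mul A).const_add κ
    have h2 := (ENNReal.continuous_rpow_const (y := γ⁻¹)).tendsto _ |>.comp
      (ENNReal.tendsto_ofReal h1)
    simpa using h2.add (ENNReal.tendsto_ofReal hM)
  filter_upwards [hmem, hlim.eventually (gt_mem_nhds hκδ)] with ε hε hlt
  refine (iSup₂_le fun t ht => ?_).trans hlt.le
  have k1 := hCK ε (β ε) _ _ _ _ hε.1.le (hβ ε hε) (h₀ ε hε) (hNS ε hε) t ht
  have k2 := hAd t (Ioo_subset_Icc_self ht) _ _
    ((hNS ε hε).isFiniteEnergyState (Ioo_subset_Icc_self ht))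
  refine k2.trans ?_
  gcongr
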